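/- Work in the lattice $N=\mathbb{Z}^2$ (column vectors), on which $GL(2,\mathbb{Z})$ acts, and put $$A=\begin{pmatrix}1&-1\\1&0\end{pmatrix},\quad B=\begin{pmatrix}0&-1\\1&0\end{pmatrix},\quad C=\begin{pmatrix}0&1\\1&0\end{pmatrix},\quad C'=\begin{pmatrix}1&0\\0&-1\end{pmatrix}.$$ Consider the following finite subgroups of $GL(2,\mathbb{Z})$ (each taken up to conjugacy): $C_2=\langle -I\rangle$, $C_3=\langle A^2\rangle$, $C_4=\langle B\rangle$, $C_6=\langle A\rangle$, $D_2=\langle C\rangle$, $D_2'=\langle C'\rangle$, $D_4=\langle -I,C\rangle$, $D_4'=\langle -I,C'\rangle$, $D_6=\langle A^2,C\rangle$, $D_6'=\langle A^2,-C\rangle$, $D_8=\langle B,C\rangle$, $D_{12}=\langle A,C\rangle$. Let $K$ be a field, let $Y$ be the split smooth projective toric surface over $K$ of a smooth complete fan $\Sigma$ in $N$, and let $G$ be a non-trivial finite subgroup of $GL(2,\mathbb{Z})$ acting on $Y$ by fan automorphisms, that is, every $g\in G$ permutes the cones of $\Sigma$. Call $Y$ *$G$-minimal* if there is no non-empty $G$-invariant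 set of pairwise disjoint torus invariant $(-1)$-curves on $Y$ (a $(-1)$-curve being a curve isomorphic to $\mathbb{P}^1_K$ with self-intersection number $-1$). Write $F_a=\mathrm{Proj}(\mathcal{O}_{\mathbb{P}^1}\oplus\mathcal{O}_{\mathbb{P}^1}(a))$ for the Hirzebruch surface and $S$ for the blow-up of $\mathbb{P}^2$ along its three torus invariant points (the toric del Pezzo surface of degree $6$). As toric surfaces, these have the complete fans with the following rays: $(1,0),(0,1),(-1,-1)$ for $\mathbb{P}^2$; $(1,0),(0,1),(-1,a),(0,-1)$ for $F_a$, with $F_0=\mathbb{P}^1\times\mathbb{P}^1$; and $\pm(1,0),\pm(0,1),\pm(1,1)$ for $S$. Then $Y$ is $G$-minimal if and only if one of the following holds, where isomorphisms are isomorphisms of toric surfaces over $K$: - $G$ is conjugate to $D_2$, and $Y$ is isomorphic to $\mathbb{P}^2$, to $\mathbb{P}^1\times\mathbb{P}^1$, or to $F_{2a+1}$ for some $a\ge 1$; - $G$ is conjugate to $D_2'$, and $Y$ is isomorphic to $F_{2a}$ for some $a\ge 0$; - $G$ is conjugate to $C_2$, $C_4$, $D_4$, $D_4'$ or $D_8$,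 and $Y$ is isomorphic to $\mathbb{P}^1\times\mathbb{P}^1$; - $G$ is conjugate to $C_3$ or $D_6$, and $Y$ is isomorphic to $\mathbb{P}^2$; - $G$ is conjugate to $C_6$, $D_6'$ or $D_{12}$, and $Y$ is isomorphic to $S$. Moreover, for each of these twelve groups $H$: if $G$ is conjugate to $H$, then $Y$ is $G$-minimal if and only if $Y$ is one of the surfaces listed for $H$. -/

import Mathlib

open CategoryTheory CategoryTheory.Limits AlgebraicGeometry

universe u

namespace ToricSurface

/-! ### Fans in `ℤ²` -/

/-- The lattice `N = ℤ²` of one-parameter subgroups; its dual `M = ℤ²` (characters of the torus)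
is paired with it by the dot product. -/
abbrev Lattice : Type := Fin 2 → ℤ

/-- The lattice points `σ ∩ N` of the cone with set of generators `σ`, when `σ` is part of a
`ℤ`-basis of `N`. -/
def conePoints (σ : Finset Lattice) : AddSubmonoid Lattice :=
  AddSubmonoid.closure (σ : Set Lattice)

/-- A smooth complete fan in `N = ℤ²`. Every cone of a smooth fan is simplicial, and is recorded
by the finite set of the minimal generators of its rays; the faces of a cone are then the subsets
of that set. As all cones are rational, intersections of cones and completeness are
expressed through the lattice points. -/
structure Fan where
  cones : Finset (Finset Lattice)
  /-- a face of a cone of the fan is in the fan -/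
  face_mem : ∀ σ ∈ cones, ∀ τ, τ ⊆ σ → τ ∈ cones
  /-- smoothness: the generators of a cone are part of a basis of the lattice -/
  smooth : ∀ σ ∈ cones, ∃ b : Module.Basis (Fin 2) ℤ Lattice, (σ : Set Lattice) ⊆ Set.range b
  /-- two cones meet in a common face -/
  inter : ∀ σ ∈ cones, ∀ τ ∈ cones, conePoints σ ⊓ conePoints τ ≤ conePoints (σ ∩ τ)
  /-- completeness: the cones cover everything -/
  complete : ∀ x : Lattice, ∃ σ ∈ cones, x ∈ conePoints σ

lemma Fan.empty_mem (Δ : Fan) : ∅ ∈ Δ.cones := by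
  obtain ⟨σ, hσ, -⟩ := Δ.complete 0
  exact Δ.face_mem σ hσ ∅ (Finset.empty_subset _)

/-- The characters `S_σ = σ^∨ ∩ M` that are regular on the affine chart of `σ`. -/
def dualMonoid (σ : Finset Lattice) : AddSubmonoid Lattice where
  carrier := {m | ∀ v ∈ σ, 0 ≤ m ⬝ᵥ v}
  zero_mem' := by intro v _; simp
  add_mem' := by
    intro a b ha hb v hv
    rw [add_dotProduct]
    exact add_nonneg (ha v hv) (hb v hv)

lemma mem_dualMonoid {σ : Finset Lattice} {m : Lattice} :
    m ∈ dualMonoid σ ↔ ∀ v ∈ σ, 0 ≤ m ⬝ᵥ v := Iff.rfl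

lemma dualMonoid_anti {σ τ : Finset Lattice} (h : τ ⊆ σ) : dualMonoid σ ≤ dualMonoid τ :=
  fun _ hm v hv => hm v (h hv)

/-- For a face `τ` of a smooth cone `ρ` there is a character that vanishes on the generators of `τ`
and is positive on the other generators of `ρ`. -/
lemma exists_face_character {ρ τ : Finset Lattice}
    (h : ∃ b : Module.Basis (Fin 2) ℤ Lattice, (ρ : Set Lattice) ⊆ Set.range b) :
    ∃ m : Lattice, (∀ v ∈ ρ, v ∈ τ → m ⬝ᵥ v = 0) ∧ (∀ v ∈ ρ, v ∉ τ → 0 < m ⬝ᵥ v) := by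
  classical
  obtain ⟨b, hb⟩ := h
  let φ : Lattice →ₗ[ℤ] ℤ := b.constr ℤ (fun i => if b i ∈ τ then 0 else 1)
  refine ⟨fun i => φ (Pi.single i 1), ?_⟩
  have key : ∀ v : Lattice, (fun i => φ (Pi.single i 1)) ⬝ᵥ v = φ v := by
    intro v
    have hv : v = ∑ i, v i • (Pi.single i 1 : Lattice) := by
      ext j
      simp [Finset.sum_apply, Pi.single_apply]
    conv_rhs => rw [hv, map_sum]
    simp only [map_smul, dotProduct, smul_eq_mul, mul_comm]
  constructor
  · intro v hv hvt
    obtain ⟨i, rfl⟩ := hb hv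
    rw [key, Module.Basis.constr_basis, if_pos hvt]
  · intro v hv hvt
    obtain ⟨i, rfl⟩ := hb hv
    rw [key, Module.Basis.constr_basis, if_neg hvt]
    exact one_pos

/-! ### The split toric surface of a fan -/

section Charts

variable (K : Type u) [Field K]

/-- The coordinate ring `K[S_σ]` of the affine chart of `σ`. -/
abbrev chartRing (σ : Finset Lattice) : Type u := AddMonoidAlgebra K (dualMonoid σ)

/-- The inclusion `K[S_σ] ⊆ K[S_τ]` for a face `τ` of `σ`. -/
noncomputable def chartRingMap {σ τ : Finset Lattice} (h : τ ⊆ σ) :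
    chartRing K σ →ₐ[K] chartRing K τ :=
  AddMonoidAlgebra.mapDomainAlgHom K K (AddSubmonoid.inclusion (dualMonoid_anti h))

lemma chartRingMap_single {σ τ : Finset Lattice} (h : τ ⊆ σ) (m : dualMonoid σ) (r : K) :
    chartRingMap K h (AddMonoidAlgebra.single m r) =
      AddMonoidAlgebra.single (AddSubmonoid.inclusion (dualMonoid_anti h) m) r := by
  simp [chartRingMap]

lemma chartRingMap_injective {σ τ : Finset Lattice} (h : τ ⊆ σ) :
    Function.Injective (chartRingMap K h) :=
  AddMonoidAlgebra.mapDomain_injective (AddSubmonoid.inclusion_injective _)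

/-- For a face `τ` of `ρ`, the ring `K[S_τ]` is the localization of `K[S_ρ]` at a character that
vanishes on `τ` and is positive on the remaining generators of `ρ`. -/
lemma chartRing_isLocalization {ρ τ : Finset Lattice} (h : τ ⊆ ρ) (m : dualMonoid ρ)
    (h0 : ∀ v ∈ τ, m.1 ⬝ᵥ v = 0) (h1 : ∀ v ∈ ρ, v ∉ τ → 0 < m.1 ⬝ᵥ v) :
    @IsLocalization.Away _ _ (AddMonoidAlgebra.single m (1 : K)) (chartRing K τ) _
      (chartRingMap K h).toRingHom.toAlgebra := by
  let alg := (chartRingMap K h).toRingHom.toAlgebra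
  have halg : ∀ x, algebraMap (chartRing K ρ) (chartRing K τ) x = chartRingMap K h x :=
    fun _ => rfl
  have hneg : -m.1 ∈ dualMonoid τ := by
    intro v hv
    rw [neg_dotProduct, h0 v hv, neg_zero]
  have hpow : ∀ n : ℕ, (AddMonoidAlgebra.single m (1 : K)) ^ n =
      AddMonoidAlgebra.single (n • m) (1 : K) := by
    intro n
    rw [AddMonoidAlgebra.single_pow, one_pow]
  refine IsLocalization.Away.mk _ ?_ ?_ ?_
  · rw [halg, chartRingMap_single]
    refine IsUnit.of_mul_eq_one (AddMonoidAlgebra.single ⟨-m.1, hneg⟩ 1) ?_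
    rw [AddMonoidAlgebra.single_mul_single, AddMonoidAlgebra.one_def, mul_one]
    congr 1
    ext1
    simp
  · intro s
    induction s using AddMonoidAlgebra.induction_linear with
    | zero => exact ⟨0, 0, by simp⟩
    | add f g hf hg =>
      obtain ⟨n, a, ha⟩ := hf
      obtain ⟨k, b, hb⟩ := hg
      refine ⟨n + k, a * (AddMonoidAlgebra.single m (1 : K)) ^ k +
        b * (AddMonoidAlgebra.single m (1 : K)) ^ n, ?_⟩
      rw [map_add, map_mul, map_mul, ← ha, ← hb, map_pow, map_pow]
      ring
    | single w r =>
      have hk : ∃ k : ℕ, w.1 + k • m.1 ∈ dualMonoid ρ := by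
        refine ⟨∑ v ∈ ρ, (w.1 ⬝ᵥ v).natAbs, ?_⟩
        intro v hv
        rw [add_dotProduct, smul_dotProduct]
        by_cases hvt : v ∈ τ
        · rw [h0 v hvt, smul_zero, add_zero]
          exact w.2 v hvt
        · have h2 := h1 v hv hvt
          have h3 : (w.1 ⬝ᵥ v).natAbs ≤ ∑ v ∈ ρ, (w.1 ⬝ᵥ v).natAbs :=
            Finset.single_le_sum (f := fun v => (w.1 ⬝ᵥ v).natAbs) (fun _ _ => Nat.zero_le _) hv
          rw [nsmul_eq_mul]
          have h4 : ((∑ v ∈ ρ, (w.1 ⬝ᵥ v).natAbs : ℕ) : ℤ) ≤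
              ((∑ v ∈ ρ, (w.1 ⬝ᵥ v).natAbs : ℕ) : ℤ) * (m.1 ⬝ᵥ v) :=
            le_mul_of_one_le_right (Int.natCast_nonneg _) h2
          omega
      obtain ⟨k, hk⟩ := hk
      refine ⟨k, AddMonoidAlgebra.single ⟨_, hk⟩ r, ?_⟩
      rw [← map_pow, hpow, halg, halg, chartRingMap_single, chartRingMap_single,
        AddMonoidAlgebra.single_mul_single, mul_one]
      congr 1
  · intro a b hab
    exact ⟨0, by rw [chartRingMap_injective K h hab]⟩

end Charts

namespace Fan

variable (K : Type u) [Field K] (Δ : Fan)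

/-- The diagram of the affine charts `U_σ = Spec K[S_σ]`, `σ ∈ Δ`, with the inclusions
`U_τ ⊆ U_σ` for the faces `τ` of `σ`. -/
noncomputable def chartDiagram : {σ // σ ∈ Δ.cones} ⥤ Scheme.{u} where
  obj σ := Spec (CommRingCat.of (chartRing K σ.1))
  map {τ σ} f := Spec.map (CommRingCat.ofHom (chartRingMap K (leOfHom f)).toRingHom)
  map_id σ := by
    rw [← Spec.map_id]
    congr 1
    ext1
    exact congrArg AlgHom.toRingHom
      (AddMonoidAlgebra.mapDomainAlgHom_id (R := K) (A := K) (M := dualMonoid σ.1))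
  map_comp {σ τ ρ} f g := by
    rw [← Spec.map_comp]
    congr 1
    ext1
    exact congrArg AlgHom.toRingHom (AddMonoidAlgebra.mapDomainAlgHom_comp (R := K) (A := K)
      (AddSubmonoid.inclusion (dualMonoid_anti (leOfHom g)))
      (AddSubmonoid.inclusion (dualMonoid_anti (leOfHom f))))

variable {K Δ} in
lemma exists_localization {τ ρ : {σ // σ ∈ Δ.cones}} (h : τ.1 ⊆ ρ.1) :
    ∃ m : dualMonoid ρ.1, (∀ v ∈ τ.1, m.1 ⬝ᵥ v = 0) ∧ (∀ v ∈ ρ.1, v ∉ τ.1 → 0 < m.1 ⬝ᵥ v) := by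
  obtain ⟨m, h0, h1⟩ := exists_face_character (τ := τ.1) (Δ.smooth ρ.1 ρ.2)
  refine ⟨⟨m, fun v hv => ?_⟩, fun v hv => h0 v (h hv) hv, h1⟩
  by_cases hvt : v ∈ τ.1
  · exact (h0 v hv hvt).ge
  · exact (h1 v hv hvt).le

lemma chartDiagram_range {τ ρ : {σ // σ ∈ Δ.cones}} (f : τ ⟶ ρ) (m : dualMonoid ρ.1)
    (h0 : ∀ v ∈ τ.1, m.1 ⬝ᵥ v = 0) (h1 : ∀ v ∈ ρ.1, v ∉ τ.1 → 0 < m.1 ⬝ᵥ v) :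
    Set.range ((Δ.chartDiagram K).map f) =
      (PrimeSpectrum.basicOpen (AddMonoidAlgebra.single m (1 : K)) :
        Set (PrimeSpectrum (chartRing K ρ.1))) := by
  let alg := (chartRingMap K (leOfHom f)).toRingHom.toAlgebra
  have := chartRing_isLocalization K (leOfHom f) m h0 h1
  exact PrimeSpectrum.localization_away_comap_range (chartRing K τ.1)
    (AddMonoidAlgebra.single m (1 : K))

instance chartDiagram_isOpenImmersion {τ ρ : {σ // σ ∈ Δ.cones}} (f : τ ⟶ ρ) :
    IsOpenImmersion ((Δ.chartDiagram K).map f) := by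
  obtain ⟨m, h0, h1⟩ := exists_localization (leOfHom f)
  let alg := (chartRingMap K (leOfHom f)).toRingHom.toAlgebra
  have := chartRing_isLocalization K (leOfHom f) m h0 h1
  exact IsOpenImmersion.of_isLocalization (S := chartRing K τ.1)
    (AddMonoidAlgebra.single m (1 : K))

instance chartDiagram_isLocallyDirected :
    (Δ.chartDiagram K ⋙ Scheme.forget).IsLocallyDirected where
  cond {σ τ ρ} f g x y hxy := by
    classical
    let κ : {σ // σ ∈ Δ.cones} := ⟨σ.1 ∩ τ.1, Δ.face_mem σ.1 σ.2 _ Finset.inter_subset_left⟩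
    let fκσ : κ ⟶ σ := homOfLE (Finset.inter_subset_left : σ.1 ∩ τ.1 ⊆ σ.1)
    let fκτ : κ ⟶ τ := homOfLE (Finset.inter_subset_right : σ.1 ∩ τ.1 ⊆ τ.1)
    obtain ⟨m, hm0, hm1⟩ := exists_localization (leOfHom f)
    obtain ⟨n, hn0, hn1⟩ := exists_localization (leOfHom g)
    have hx := Δ.chartDiagram_range K f m hm0 hm1
    have hy := Δ.chartDiagram_range K g n hn0 hn1
    have hz := Δ.chartDiagram_range K (fκσ ≫ f) (m + n)
      (fun v hv => by
        have hv' := Finset.mem_inter.1 hv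
        simp [add_dotProduct, hm0 v hv'.1, hn0 v hv'.2])
      (fun v hv hvκ => by
        have h1 := m.2 v hv
        have h2 := n.2 v hv
        simp only [AddSubmonoid.coe_add, add_dotProduct]
        by_cases hvσ : v ∈ σ.1
        · have hvτ : v ∉ τ.1 := fun hvτ => hvκ (Finset.mem_inter.2 ⟨hvσ, hvτ⟩)
          have := hn1 v hv hvτ
          omega
        · have := hm1 v hv hvσ
          omega)
    have key : (Δ.chartDiagram K).map f x ∈ Set.range ((Δ.chartDiagram K).map (fκσ ≫ f)) := by
      rw [hz]
      have e : AddMonoidAlgebra.single (m + n) (1 : K) =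
          AddMonoidAlgebra.single m (1 : K) * AddMonoidAlgebra.single n (1 : K) := by
        rw [AddMonoidAlgebra.single_mul_single, mul_one]
      rw [e, PrimeSpectrum.basicOpen_mul]
      refine ⟨?_, ?_⟩
      · rw [← hx]
        exact ⟨x, rfl⟩
      · rw [← hy]
        exact ⟨y, hxy.symm⟩
    obtain ⟨z, hz'⟩ := key
    refine ⟨κ, fκσ, fκτ, z, ?_, ?_⟩
    · apply ((Δ.chartDiagram K).map f).isOpenEmbedding.injective
      rw [← hz', Functor.map_comp]
      rfl
    · apply ((Δ.chartDiagram K).map g).isOpenEmbedding.injective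
      refine Eq.trans ?_ hxy
      refine Eq.trans ?_ hz'
      have : fκσ ≫ f = fκτ ≫ g := Subsingleton.elim _ _
      rw [this, Functor.map_comp]
      rfl

/-- The split toric surface over `K` with fan `Δ`: the charts `U_σ`, `σ ∈ Δ`, glued along
`U_σ ∩ U_τ = U_{σ ∩ τ}`. -/
noncomputable def surface : Scheme.{u} := colimit (Δ.chartDiagram K)

/-- The structure morphism of the toric surface. -/
noncomputable def str : Δ.surface K ⟶ Spec (CommRingCat.of K) :=
  colimit.desc (Δ.chartDiagram K)
    { pt := Spec (CommRingCat.of K)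
      ι :=
        { app := fun σ => Spec.map (CommRingCat.ofHom (algebraMap K (chartRing K σ.1)))
          naturality := fun σ τ f => by
            dsimp only [chartDiagram, Functor.const_obj_obj, Functor.const_obj_map]
            rw [← Spec.map_comp, Category.comp_id]
            congr 1
            ext1
            exact (chartRingMap K (leOfHom f)).comp_algebraMap } }

variable {Δ} in
/-- The open immersion of the affine chart `U_σ`. -/
noncomputable def chart {σ : Finset Lattice} (hσ : σ ∈ Δ.cones) :
    Spec (CommRingCat.of (chartRing K σ)) ⟶ Δ.surface K :=
  colimit.ι (Δ.chartDiagram K) ⟨σ, hσ⟩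

variable {Δ} in
lemma chart_comp {σ τ : Finset Lattice} (hσ : σ ∈ Δ.cones) (hτ : τ ∈ Δ.cones) (h : τ ⊆ σ) :
    Spec.map (CommRingCat.ofHom (chartRingMap K h).toRingHom) ≫ chart K hσ = chart K hτ :=
  colimit.w (Δ.chartDiagram K)
    (homOfLE h : (⟨τ, hτ⟩ : {ρ // ρ ∈ Δ.cones}) ⟶ ⟨σ, hσ⟩)

/-- The open immersion of the torus `T = Spec K[M]`, which is the chart of the zero cone. -/
noncomputable def torus : Spec (CommRingCat.of (chartRing K ∅)) ⟶ Δ.surface K :=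
  chart K Δ.empty_mem

end Fan

/-! ### Toric morphisms, fan automorphisms -/

/-- The group `GL(2, ℤ)`, acting on the lattice `N = ℤ²` (column vectors). -/
abbrev GL2Z : Type := GL (Fin 2) ℤ

/-- If `g` maps the generators of `σ` to generators of `τ`, then the transpose of `g`
maps `S_τ` to `S_σ`. -/
def dualMap (g : GL2Z) {σ τ : Finset Lattice} (h : ∀ v ∈ σ, g.1.mulVec v ∈ τ) :
    dualMonoid τ →+ dualMonoid σ where
  toFun m := ⟨Matrix.vecMul m.1 g.1, fun v hv => by
    rw [← Matrix.dotProduct_mulVec]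
    exact m.2 _ (h v hv)⟩
  map_zero' := by
    ext1
    exact Matrix.zero_vecMul g.1
  map_add' a b := by
    ext1
    exact Matrix.add_vecMul g.1 a.1 b.1

/-- The morphism `U_σ → U_τ` given by `χ^m ↦ χ^(m ∘ g)`. -/
noncomputable def chartHom (K : Type u) [Field K] (g : GL2Z) {σ τ : Finset Lattice}
    (h : ∀ v ∈ σ, g.1.mulVec v ∈ τ) :
    Spec (CommRingCat.of (chartRing K σ)) ⟶ Spec (CommRingCat.of (chartRing K τ)) :=
  Spec.map (CommRingCat.ofHom (AddMonoidAlgebra.mapDomainRingHom K (dualMap g h)))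

lemma chartHom_naturality (K : Type u) [Field K] (g : GL2Z) {σ τ σ' τ' : Finset Lattice}
    (h : ∀ v ∈ σ, g.1.mulVec v ∈ τ) (h' : ∀ v ∈ σ', g.1.mulVec v ∈ τ') (hσ : σ' ⊆ σ)
    (hτ : τ' ⊆ τ) :
    Spec.map (CommRingCat.ofHom (chartRingMap K hσ).toRingHom) ≫ chartHom K g h =
      chartHom K g h' ≫ Spec.map (CommRingCat.ofHom (chartRingMap K hτ).toRingHom) := by
  dsimp only [chartHom]
  rw [← Spec.map_comp, ← Spec.map_comp]
  congr 1
  ext1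
  refine (AddMonoidAlgebra.mapDomainRingHom_comp (R := K)
    (AddSubmonoid.inclusion (dualMonoid_anti hσ)) (dualMap g h)).symm.trans ?_
  exact AddMonoidAlgebra.mapDomainRingHom_comp (R := K)
    (dualMap g h') (AddSubmonoid.inclusion (dualMonoid_anti hτ))

/-- The automorphism of the torus `T = N ⊗ 𝔾_m` induced by `g ∈ GL(2, ℤ)`. -/
noncomputable def torusHom (K : Type u) [Field K] (g : GL2Z) :
    Spec (CommRingCat.of (chartRing K ∅)) ⟶ Spec (CommRingCat.of (chartRing K ∅)) :=
  chartHom K g (fun v hv => absurd hv (Finset.notMem_empty v))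

/-- `g` maps each cone of `Δ` onto a cone of `Δ'`. -/
def Fan.MapsTo (g : GL2Z) (Δ Δ' : Fan) : Prop :=
  ∀ σ ∈ Δ.cones, σ.image (fun v => g.1.mulVec v) ∈ Δ'.cones

/-- The toric morphism induced by `g`; on the chart `U_σ` it is `U_σ → U_{g σ}`. -/
noncomputable def Fan.toricHom (K : Type u) [Field K] {g : GL2Z} {Δ Δ' : Fan}
    (hg : Fan.MapsTo g Δ Δ') : Δ.surface K ⟶ Δ'.surface K :=
  colimit.desc (Δ.chartDiagram K)
    { pt := Δ'.surface K
      ι :=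
        { app := fun σ =>
            chartHom K g (fun _ hv => Finset.mem_image_of_mem _ hv) ≫ chart K (hg σ.1 σ.2)
          naturality := fun σ τ f => by
            have h1 := chartHom_naturality K g
              (fun v hv => Finset.mem_image_of_mem (fun v => g.1.mulVec v) hv)
              (fun v hv => Finset.mem_image_of_mem (fun v => g.1.mulVec v) hv) (leOfHom f)
              (Finset.image_subset_image (leOfHom f))
            have h2 := chart_comp K (hg τ.1 τ.2) (hg σ.1 σ.2)
              (Finset.image_subset_image (leOfHom f))
            refine Eq.trans ?_ (Category.comp_id _).symm
            refine (Category.assoc _ _ _).symm.trans ?_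
            refine (congrArg (fun k => k ≫ chart K (hg τ.1 τ.2)) h1).trans ?_
            refine (Category.assoc _ _ _).trans ?_
            exact congrArg (fun k => chartHom K g _ ≫ k) h2 } }

/-- Isomorphism of split toric surfaces: an isomorphism over `K` that restricts to an isomorphism
of the tori (as algebraic groups). -/
def ToricIso (K : Type u) [Field K] (Δ Δ' : Fan) : Prop :=
  ∃ (e : Δ.surface K ≅ Δ'.surface K) (g : GL2Z),
    e.hom ≫ Δ'.str K = Δ.str K ∧ Δ.torus K ≫ e.hom = torusHom K g ≫ Δ'.torus K

/-! ### Torus invariant `(-1)`-curves, minimality -/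

section Curves

variable {K : Type u} [Field K] {X : Scheme.{u}}

/-- A function on an open set vanishes at all points of `E` in that open set. -/
def VanishesOn (E : Set X) {V : X.Opens} (f : Γ(X, V)) : Prop :=
  Disjoint E (X.basicOpen f : Set X)

/-- The scalars `K → Γ(X, V)` of a `K`-scheme `X`. -/
noncomputable def scalars (s : X ⟶ Spec (CommRingCat.of K)) (V : X.Opens) : K →+* Γ(X, V) :=
  ((Scheme.ΓSpecIso (CommRingCat.of K)).inv ≫ s.appTop ≫ X.presheaf.map (homOfLE le_top).op).hom

/-- On the affine open set `V`, the ideal of `E` is generated by `f`, and `E ∩ V` is an affine line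
over `K` with coordinate `x`. -/
structure IsAffineLine (s : X ⟶ Spec (CommRingCat.of K)) (E : Set X) {V : X.Opens}
    (x f : Γ(X, V)) : Prop where
  affine : IsAffineOpen V
  generates : ∀ h : Γ(X, V), VanishesOn E h ↔ f ∣ h
  coordinate : ∀ h : Γ(X, V), ∃! p : Polynomial K, VanishesOn E (h - p.eval₂ (scalars s V) x)

/-- `E` is a `(-1)`-curve on the smooth surface `X` over `K`: a closed subset that, with its reduced
structure, is isomorphic to `ℙ¹` and has self-intersection number `-1`, that is, conormal bundle
`𝓘/𝓘² ≅ 𝒪(1)`.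

Here `ℙ¹` is presented as two affine lines `E ∩ V₀` and `E ∩ V₁`, with coordinates `x₀` and `x₁`,
glued along `x₀ ≠ 0` and `x₁ ≠ 0` by `x₁ = x₀⁻¹`. The functions `f₀` and `f₁` generate the ideal
`𝓘` of `E` on `V₀` and `V₁`, so their classes trivialize `𝓘/𝓘²` on the two lines. Its transition
function is `f₁ / f₀ = x₀`, as for the sections `X₀` and `X₁` of `𝒪(1)`, where `x₀ = X₁ / X₀`. -/
def IsNegOneCurve (s : X ⟶ Spec (CommRingCat.of K)) (E : Set X) : Prop :=
  IsClosed E ∧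
  ∃ (V₀ V₁ : X.Opens) (x₀ f₀ : Γ(X, V₀)) (x₁ f₁ : Γ(X, V₁)) (t : Γ(X, V₀ ⊓ V₁)),
    E ⊆ (V₀ : Set X) ∪ V₁ ∧
    IsAffineLine s E x₀ f₀ ∧ IsAffineLine s E x₁ f₁ ∧
    E ∩ X.basicOpen x₀ = E ∩ (V₀ ⊓ V₁ : X.Opens) ∧
    E ∩ X.basicOpen x₁ = E ∩ (V₀ ⊓ V₁ : X.Opens) ∧
    VanishesOn E (x₀ |_ (V₀ ⊓ V₁) * x₁ |_ (V₀ ⊓ V₁) - 1) ∧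
    f₁ |_ (V₀ ⊓ V₁) = t * f₀ |_ (V₀ ⊓ V₁) ∧
    VanishesOn E (t - x₀ |_ (V₀ ⊓ V₁))

end Curves

namespace Fan

/-- The torus invariant curve `D_v` of the ray generated by `v`: the closure of the one-dimensional
torus orbit `U_v ∖ T`, where `U_v` is the chart of the ray. -/
def rayCurve (K : Type u) [Field K] (Δ : Fan) {v : Lattice} (hv : {v} ∈ Δ.cones) :
    Set (Δ.surface K) :=
  closure (Set.range (chart K hv) \ Set.range (Δ.torus K))

/-- The torus invariant curves of the toric surface. -/
def IsInvariantCurve (K : Type u) [Field K] (Δ : Fan) (E : Set (Δ.surface K)) : Prop :=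
  ∃ (v : Lattice) (hv : {v} ∈ Δ.cones), E = Δ.rayCurve K hv

/-- `G`-minimality of the toric surface of `Δ` over `K`, for a group `G` of fan automorphisms: there
is no non-empty `G`-invariant set of pairwise disjoint torus invariant `(-1)`-curves. -/
def IsMinimal (K : Type u) [Field K] (Δ : Fan) (G : Subgroup GL2Z)
    (hG : ∀ g ∈ G, MapsTo g Δ Δ) : Prop :=
  ¬ ∃ C : Set (Set (Δ.surface K)), C.Nonempty ∧
    (∀ E ∈ C, Δ.IsInvariantCurve K E ∧ IsNegOneCurve (Δ.str K) E) ∧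
    (∀ E ∈ C, ∀ E' ∈ C, E ≠ E' → Disjoint E E') ∧
    (∀ g, ∀ hg : g ∈ G, ∀ E ∈ C, (toricHom K (hG g hg)) '' E ∈ C)

end Fan

/-! ### The standard fans -/

/-- The determinant of two lattice vectors. -/
def detPair (u v : Lattice) : ℤ := u 0 * v 1 - u 1 * v 0

/-- The set of generators, among `u` and `v`, that occur in `p • u + q • v`. -/
def carrierPair (u v : Lattice) (p q : ℕ) : Finset Lattice :=
  (if p = 0 then ∅ else {u}) ∪ (if q = 0 then ∅ else {v})

/-- The fan whose maximal cones are generated by the given pairs of lattice vectors. -/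
def Fan.ofPairs (P : Finset (Lattice × Lattice)) (hdet : ∀ c ∈ P, detPair c.1 c.2 = 1)
    (hS : ∃ S : Lattice → Finset Lattice,
      ∀ c ∈ P, ∀ p q : ℕ, S (p • c.1 + q • c.2) = carrierPair c.1 c.2 p q)
    (hcov : ∀ x : Lattice, ∃ c ∈ P, ∃ p q : ℕ, x = p • c.1 + q • c.2) : Fan where
  cones := P.biUnion fun c => ({c.1, c.2} : Finset Lattice).powerset
  face_mem := by
    intro σ hσ τ hτ
    simp only [Finset.mem_biUnion, Finset.mem_powerset] at hσ ⊢
    obtain ⟨c, hc, h⟩ := hσ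
    exact ⟨c, hc, hτ.trans h⟩
  smooth := by
    intro σ hσ
    simp only [Finset.mem_biUnion, Finset.mem_powerset] at hσ
    obtain ⟨c, hc, h⟩ := hσ
    have hd : (Matrix.of ![![c.1 0, c.2 0], ![c.1 1, c.2 1]]).det = 1 := by
      rw [Matrix.det_fin_two]
      have := hdet c hc
      simp only [detPair] at this
      simp only [Matrix.of_apply, Matrix.cons_val', Matrix.cons_val_zero, Matrix.cons_val_one,
        Matrix.cons_val_fin_one]
      linarith
    let b := (Pi.basisFun ℤ (Fin 2)).map (Matrix.toLinearEquiv (Pi.basisFun ℤ (Fin 2))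
      (Matrix.of ![![c.1 0, c.2 0], ![c.1 1, c.2 1]]) (by rw [hd]; exact isUnit_one))
    have hb : ∀ i, b i = (Matrix.of ![![c.1 0, c.2 0], ![c.1 1, c.2 1]]).mulVec
        (Pi.single i 1) := by
      intro i
      simp only [b, Module.Basis.map_apply, Matrix.toLinearEquiv_apply, Pi.basisFun_apply]
      rw [Matrix.toLin_eq_toLin', Matrix.toLin'_apply]
    refine ⟨b, fun v hv => ?_⟩
    have := h hv
    simp only [Finset.mem_insert, Finset.mem_singleton] at this
    rcases this with rfl | rfl
    · refine ⟨0, ?_⟩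
      rw [hb]
      ext i
      fin_cases i <;> simp
    · refine ⟨1, ?_⟩
      rw [hb]
      ext i
      fin_cases i <;> simp
  inter := by
    obtain ⟨S, hS⟩ := hS
    have key : ∀ σ ∈ P.biUnion (fun c => ({c.1, c.2} : Finset Lattice).powerset),
        ∀ x ∈ conePoints σ, S x ⊆ σ ∧ x ∈ conePoints (S x) := by
      intro σ hσ x hx
      simp only [Finset.mem_biUnion, Finset.mem_powerset] at hσ
      obtain ⟨c, hc, h⟩ := hσ
      have hrep : ∃ p q : ℕ, x = p • c.1 + q • c.2 ∧ (p ≠ 0 → c.1 ∈ σ) ∧ (q ≠ 0 → c.2 ∈ σ) := by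
        induction hx using AddSubmonoid.closure_induction with
        | mem v hv =>
          have := h hv
          simp only [Finset.mem_insert, Finset.mem_singleton] at this
          rcases this with rfl | rfl
          · exact ⟨1, 0, by simp, fun _ => hv, fun h => absurd rfl h⟩
          · exact ⟨0, 1, by simp, fun h => absurd rfl h, fun _ => hv⟩
        | zero => exact ⟨0, 0, by simp, fun h => absurd rfl h, fun h => absurd rfl h⟩
        | add y z _ _ hy hz =>
          obtain ⟨p, q, rfl, h1, h2⟩ := hy
          obtain ⟨p', q', rfl, h1', h2'⟩ := hz
          refine ⟨p + p', q + q', ?_, ?_, ?_⟩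
          · rw [add_smul, add_smul]
            abel
          · intro hne
            by_cases hp : p = 0
            · exact h1' (by omega)
            · exact h1 hp
          · intro hne
            by_cases hq : q = 0
            · exact h2' (by omega)
            · exact h2 hq
      obtain ⟨p, q, rfl, h1, h2⟩ := hrep
      rw [hS c hc]
      constructor
      · intro v hv
        simp only [carrierPair, Finset.mem_union] at hv
        rcases hv with hv | hv <;> split_ifs at hv with h0 <;> simp at hv
        · subst hv
          exact h1 h0
        · subst hv
          exact h2 h0
      · refine add_mem ?_ ?_
        · by_cases hp : p = 0
          · simp [hp]
          · refine nsmul_mem (AddSubmonoid.subset_closure ?_) p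
            simp [carrierPair, hp]
        · by_cases hq : q = 0
          · simp [hq]
          · refine nsmul_mem (AddSubmonoid.subset_closure ?_) q
            simp [carrierPair, hq]
    intro σ hσ τ hτ x hx
    have h1 := key σ hσ x hx.1
    have h2 := key τ hτ x hx.2
    exact AddSubmonoid.closure_mono
      (Finset.coe_subset.2 (Finset.subset_inter h1.1 h2.1)) h1.2
  complete := by
    intro x
    obtain ⟨c, hc, p, q, rfl⟩ := hcov x
    refine ⟨{c.1, c.2}, ?_, ?_⟩
    · simp only [Finset.mem_biUnion, Finset.mem_powerset]
      exact ⟨c, hc, subset_rfl⟩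
    · exact add_mem (nsmul_mem (AddSubmonoid.subset_closure (by simp)) p)
        (nsmul_mem (AddSubmonoid.subset_closure (by simp)) q)

lemma smul_add_smul_apply (u v : Lattice) (p q : ℕ) (i : Fin 2) :
    (p • u + q • v) i = p * u i + q * v i := by
  simp

/-- The fan of `ℙ²`: rays `(1,0)`, `(0,1)`, `(-1,-1)`. -/
def fanP2 : Fan :=
  Fan.ofPairs {(![1, 0], ![0, 1]), (![0, 1], ![-1, -1]), (![-1, -1], ![1, 0])}
    (by
      simp only [Finset.mem_insert, Finset.mem_singleton]
      rintro c (rfl | rfl | rfl) <;> simp [detPair])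
    (by
      refine ⟨fun x => (if 0 < x 0 ∨ x 1 < x 0 then {![1, 0]} else ∅) ∪
        ((if 0 < x 1 ∨ x 0 < x 1 then {![0, 1]} else ∅) ∪
        (if x 0 < 0 ∨ x 1 < 0 then {![-1, -1]} else ∅)), ?_⟩
      simp only [Finset.mem_insert, Finset.mem_singleton]
      rintro c (rfl | rfl | rfl) p q <;>
      simp only [carrierPair, smul_add_smul_apply, Matrix.cons_val_zero,
        Matrix.cons_val_one, mul_one, mul_zero, mul_neg] <;>
      rcases Nat.eq_zero_or_pos p with hp | hp <;> rcases Nat.eq_zero_or_pos q with hq | hq <;>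
      simp (disch := omega) only [if_pos, if_neg, Finset.empty_union, Finset.union_empty,
        Finset.union_comm])
    (by
      intro x
      have hx : x = ![x 0, x 1] := by ext i; fin_cases i <;> rfl
      by_cases h1 : 0 ≤ x 0 ∧ 0 ≤ x 1
      · refine ⟨(![1, 0], ![0, 1]), by simp, (x 0).toNat, (x 1).toNat, ?_⟩
        rw [hx]
        ext i
        fin_cases i <;> simp <;> omega
      · by_cases h2 : x 0 ≤ x 1
        · refine ⟨(![0, 1], ![-1, -1]), by simp, (x 1 - x 0).toNat, (- x 0).toNat, ?_⟩
          rw [hx]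
          ext i
          fin_cases i <;> simp <;> omega
        · refine ⟨(![-1, -1], ![1, 0]), by simp, (- x 1).toNat, (x 0 - x 1).toNat, ?_⟩
          rw [hx]
          ext i
          fin_cases i <;> simp <;> omega)

/-- The fan of the Hirzebruch surface `F_a = Proj(𝒪 ⊕ 𝒪(a))` over `ℙ¹`: rays `(1,0)`, `(0,1)`,
`(-1,a)`, `(0,-1)`. -/
def fanHirzebruch (a : ℕ) : Fan :=
  Fan.ofPairs {(![1, 0], ![0, 1]), (![0, 1], ![-1, (a : ℤ)]), (![-1, (a : ℤ)], ![0, -1]),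
      (![0, -1], ![1, 0])}
    (by
      simp only [Finset.mem_insert, Finset.mem_singleton]
      rintro c (rfl | rfl | rfl | rfl) <;> simp [detPair])
    (by
      refine ⟨fun x => (if 0 < x 0 then {![1, 0]} else ∅) ∪
        ((if x 0 < 0 then {![-1, (a : ℤ)]} else ∅) ∪
        ((if 0 < x 1 + a * min 0 (x 0) then {![0, 1]} else ∅) ∪
        (if x 1 + a * min 0 (x 0) < 0 then {![0, -1]} else ∅))), ?_⟩
      simp only [Finset.mem_insert, Finset.mem_singleton]
      rintro c (rfl | rfl | rfl | rfl) p q <;>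
      simp only [carrierPair, smul_add_smul_apply, Matrix.cons_val_zero,
        Matrix.cons_val_one, mul_one, mul_zero, mul_neg, zero_add, add_zero]
      · have : min (0 : ℤ) p = 0 := by omega
        rw [this, mul_zero, add_zero]
        rcases Nat.eq_zero_or_pos p with hp | hp <;> rcases Nat.eq_zero_or_pos q with hq | hq <;>
        simp (disch := omega) only [if_pos, if_neg, Finset.empty_union, Finset.union_empty,
          Finset.union_comm]
      · have : min (0 : ℤ) (-q) = -q := by omega
        have h : (p : ℤ) + q * a + a * (-q) = p := by ring
        rw [this, h]
        rcases Nat.eq_zero_or_pos p with hp | hp <;> rcases Nat.eq_zero_or_pos q with hq | hq <;>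
        simp (disch := omega) only [if_pos, if_neg, Finset.empty_union, Finset.union_empty,
          Finset.union_comm]
      · have : min (0 : ℤ) (-p) = -p := by omega
        have h : (p : ℤ) * a + -q + a * (-p) = -q := by ring
        rw [this, h]
        rcases Nat.eq_zero_or_pos p with hp | hp <;> rcases Nat.eq_zero_or_pos q with hq | hq <;>
        simp (disch := omega) only [if_pos, if_neg, Finset.empty_union, Finset.union_empty,
          Finset.union_comm]
      · have : min (0 : ℤ) q = 0 := by omega
        rw [this, mul_zero, add_zero]
        rcases Nat.eq_zero_or_pos p with hp | hp <;> rcases Nat.eq_zero_or_pos q with hq | hq <;>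
        simp (disch := omega) only [if_pos, if_neg, Finset.empty_union, Finset.union_empty,
          Finset.union_comm])
    (by
      intro x
      have hx : x = ![x 0, x 1] := by ext i; fin_cases i <;> rfl
      by_cases h1 : 0 ≤ x 0
      · by_cases h2 : 0 ≤ x 1
        · refine ⟨(![1, 0], ![0, 1]), by simp, (x 0).toNat, (x 1).toNat, ?_⟩
          rw [hx]
          ext i
          fin_cases i <;> simp <;> omega
        · refine ⟨(![0, -1], ![1, 0]), by simp, (- x 1).toNat, (x 0).toNat, ?_⟩
          rw [hx]
          ext i
          fin_cases i <;> simp <;> omega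
      · obtain ⟨n, hn⟩ : ∃ n : ℕ, x 0 = -n := ⟨(- x 0).toNat, by omega⟩
        by_cases h2 : 0 ≤ x 1 - n * a
        · refine ⟨(![0, 1], ![-1, (a : ℤ)]), by simp, (x 1 - n * a).toNat, n, ?_⟩
          rw [hx]
          ext i
          fin_cases i <;> simp <;> omega
        · refine ⟨(![-1, (a : ℤ)], ![0, -1]), by simp, n, (n * a - x 1).toNat, ?_⟩
          rw [hx]
          ext i
          fin_cases i <;> simp <;> omega)

/-- The fan of `ℙ¹ × ℙ¹`: rays `(1,0)`, `(0,1)`, `(-1,0)`, `(0,-1)`. -/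
def fanP1P1 : Fan := fanHirzebruch 0

/-- The fan of the blow-up `S` of `ℙ²` along its three torus invariant points, obtained from the fan
of `ℙ²` by subdividing each of its maximal cones by the sum of the two generators: rays
`(1,0)`, `(1,1)`, `(0,1)`, `(-1,0)`, `(-1,-1)`, `(0,-1)`. -/
def fanDP6 : Fan :=
  Fan.ofPairs {(![1, 0], ![1, 1]), (![1, 1], ![0, 1]), (![0, 1], ![-1, 0]), (![-1, 0], ![-1, -1]),
      (![-1, -1], ![0, -1]), (![0, -1], ![1, 0])}
    (by
      simp only [Finset.mem_insert, Finset.mem_singleton]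
      rintro c (rfl | rfl | rfl | rfl | rfl | rfl) <;> simp [detPair])
    (by
      refine ⟨fun x => (if 0 < x 0 ∧ x 1 < x 0 then {![1, 0]} else ∅) ∪
        ((if 0 < x 0 ∧ 0 < x 1 then {![1, 1]} else ∅) ∪
        ((if 0 < x 1 ∧ x 0 < x 1 then {![0, 1]} else ∅) ∪
        ((if x 0 < 0 ∧ x 0 < x 1 then {![-1, 0]} else ∅) ∪
        ((if x 0 < 0 ∧ x 1 < 0 then {![-1, -1]} else ∅) ∪
        (if x 1 < 0 ∧ x 1 < x 0 then {![0, -1]} else ∅))))), ?_⟩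
      simp only [Finset.mem_insert, Finset.mem_singleton]
      rintro c (rfl | rfl | rfl | rfl | rfl | rfl) p q <;>
      simp only [carrierPair, smul_add_smul_apply, Matrix.cons_val_zero,
        Matrix.cons_val_one, mul_one, mul_zero, mul_neg, zero_add, add_zero] <;>
      rcases Nat.eq_zero_or_pos p with hp | hp <;> rcases Nat.eq_zero_or_pos q with hq | hq <;>
      simp (disch := omega) only [if_pos, if_neg, Finset.empty_union, Finset.union_empty,
        Finset.union_comm])
    (by
      intro x
      have hx : x = ![x 0, x 1] := by ext i; fin_cases i <;> rfl
      by_cases h1 : 0 ≤ x 0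
      · by_cases h2 : 0 ≤ x 1
        · by_cases h3 : x 1 ≤ x 0
          · refine ⟨(![1, 0], ![1, 1]), by simp, (x 0 - x 1).toNat, (x 1).toNat, ?_⟩
            rw [hx]
            ext i
            fin_cases i <;> simp <;> omega
          · refine ⟨(![1, 1], ![0, 1]), by simp, (x 0).toNat, (x 1 - x 0).toNat, ?_⟩
            rw [hx]
            ext i
            fin_cases i <;> simp <;> omega
        · refine ⟨(![0, -1], ![1, 0]), by simp, (- x 1).toNat, (x 0).toNat, ?_⟩
          rw [hx]
          ext i
          fin_cases i <;> simp <;> omega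
      · by_cases h2 : 0 ≤ x 1
        · refine ⟨(![0, 1], ![-1, 0]), by simp, (x 1).toNat, (- x 0).toNat, ?_⟩
          rw [hx]
          ext i
          fin_cases i <;> simp <;> omega
        · by_cases h3 : x 0 ≤ x 1
          · refine ⟨(![-1, 0], ![-1, -1]), by simp, (x 1 - x 0).toNat, (- x 1).toNat, ?_⟩
            rw [hx]
            ext i
            fin_cases i <;> simp <;> omega
          · refine ⟨(![-1, -1], ![0, -1]), by simp, (- x 0).toNat, (x 0 - x 1).toNat, ?_⟩
            rw [hx]
            ext i
            fin_cases i <;> simp <;> omega)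

/-! ### Finite subgroups of `GL(2, ℤ)` and the classification -/

/-- `A = (1, -1; 1, 0)`, of order `6`. -/
def matA : GL2Z := ⟨!![1, -1; 1, 0], !![0, 1; -1, 1], by decide, by decide⟩

/-- `B = (0, -1; 1, 0)`, of order `4`. -/
def matB : GL2Z := ⟨!![0, -1; 1, 0], !![0, 1; -1, 0], by decide, by decide⟩

/-- `C = (0, 1; 1, 0)`, a reflection. -/
def matC : GL2Z := ⟨!![0, 1; 1, 0], !![0, 1; 1, 0], by decide, by decide⟩

/-- `C' = (1, 0; 0, -1)`, a reflection. -/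
def matCprime : GL2Z := ⟨!![1, 0; 0, -1], !![1, 0; 0, -1], by decide, by decide⟩

/-- The labels of the conjugacy classes of non-trivial finite subgroups of `GL(2, ℤ)`; the index is
the order of the group. -/
inductive GroupClass : Type
  | C2 | C3 | C4 | C6 | D2 | D2' | D4 | D4' | D6 | D6' | D8 | D12

/-- The representatives of the conjugacy classes. -/
def GroupClass.subgroup : GroupClass → Subgroup GL2Z
  | C2 => Subgroup.closure {-1}
  | C3 => Subgroup.closure {matA ^ 2}
  | C4 => Subgroup.closure {matB}
  | C6 => Subgroup.closure {matA}
  | D2 => Subgroup.closure {matC}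
  | D2' => Subgroup.closure {matCprime}
  | D4 => Subgroup.closure {-1, matC}
  | D4' => Subgroup.closure {-1, matCprime}
  | D6 => Subgroup.closure {matA ^ 2, matC}
  | D6' => Subgroup.closure {matA ^ 2, -matC}
  | D8 => Subgroup.closure {matB, matC}
  | D12 => Subgroup.closure {matA, matC}

/-- `G` is conjugate in `GL(2, ℤ)` to the representative of the class `c`. -/
def GroupClass.Contains (c : GroupClass) (G : Subgroup GL2Z) : Prop :=
  ∃ h : GL2Z, G = c.subgroup.map (MulAut.conj h).toMonoidHom

/-- The toric surface of `Δ` over `K` is one of the surfaces listed for the class. -/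
def GroupClass.Lists (K : Type u) [Field K] (Δ : Fan) : GroupClass → Prop
  | D2 => ToricIso K Δ fanP2 ∨ ToricIso K Δ fanP1P1 ∨
      ∃ a : ℕ, 1 ≤ a ∧ ToricIso K Δ (fanHirzebruch (2 * a + 1))
  | D2' => ∃ a : ℕ, ToricIso K Δ (fanHirzebruch (2 * a))
  | C2 | C4 | D4 | D4' | D8 => ToricIso K Δ fanP1P1
  | C3 | D6 => ToricIso K Δ fanP2
  | C6 | D6' | D12 => ToricIso K Δ fanDP6

end ToricSurface

/-!
The proof translates minimality into a property of the fan, which is then analysed by means of a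
positive definite form on the lattice that is invariant under the group.

*From the surface to the fan.* Let `v` be a ray with neighbours `u` and `w`. By smoothness and
completeness `u + w = a v` for an integer `a`, which is recorded in `Fan.Star`. In the two charts
that meet the curve `D_v` of `v`, the curve is an affine line, and the characters that generate its
ideal differ by the `a`-th power of the coordinate, so that the conormal bundle of `D_v` is `𝒪(a)`.
The degree does not depend on the presentation of `D_v` as a union of two affine lines
(`ConormalPresentation.degree_eq_one`): the global sections of `𝒪(a)` are the polynomials of degree
at most `a`, and are counted by their dimension. Hence `D_v` is a `(-1)`-curve if and only if
`a = 1` (`Fan.Star.isNegOneCurve_iff`). The curves `D_v` and `D_w` are disjoint if and only if `v`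
and `w` do not span a cone (`Fan.disjoint_rayCurve_iff`), and a toric morphism carries curves of
rays to curves of rays. So minimality is the combinatorial condition `Fan.IsRayMinimal`
(`Fan.isMinimal_iff`). Isomorphisms of toric surfaces, which are those equivariant for an
automorphism of the torus, are induced by isomorphisms of fans (`Fan.toricIso_iff`): the image of
the distinguished point of a chart lies in some chart, and the characters that are regular there
pull back to characters that are regular on the given chart.

*Minimal fans.* Let `v` be a ray of maximal norm for an invariant form. By the parallelogram law
`|u + w| < 2 |v|`, hence `a` is `1`, `0` or `-1` (`Fan.Star.abs_le_one`). If `a = 1` for one of the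
longest rays, then minimality provides an adjacent ray in its orbit, and the norms leave only a
hexagon (`Fan.exists_mapsTo_fanDP6`). If `a = -1`, then every ray between `w` and `u` other than
`w + u = -v` is longer than `v`, and `-v` would be a longest ray with `a = 1`; the fan is that of
`ℙ²` (`Fan.exists_mapsTo_fanP2`). If `a = 0`, then the neighbours of `v` are `u` and `-u`, and a
single ray lies on the other side of their line, which gives the fan of a Hirzebruch surface
(`Fan.exists_mapsTo_fanHirzebruch`).

*The groups.* The fan of `ℙ²`, of `ℙ¹ × ℙ¹` and the hexagon have the dihedral automorphism groups
`D₆`, `D₈` and `D₁₂`, whose subgroups are listed. The only non-trivial automorphism of the fan of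
`F_k`, `k ≥ 1`, is a reflection; it is conjugate to `C` or `C'` according to the parity of `k`, and
for `k = 1` it fixes the only `(-1)`-curve. Conversely, the fans of `ℙ²` and of `F_k`, `k ≠ 1`, have
no ray with `a = 1`, while all the rays of the hexagon have `a = 1`, so that the hexagon is minimal
if and only if the group moves every ray to an adjacent one. The twelve classes are pairwise
distinct, since they are told apart by traces and determinants, by triviality of the action modulo
`2` and by the existence of fixed vectors modulo `3` (`GroupClass.Contains.unique`); this gives the
classification for each class separately.
-/

namespace ToricSurface

/-! ### The degree of the conormal bundle -/

section ConormalDegree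

/-- Polynomials in `x` of degree less than `m` and, up to the factor `w`, polynomials in `y` of
degree less than `n` form the same space only if `m = n`, by comparison of dimensions. -/
lemma eq_of_polynomial_spaces_eq {K F : Type*} [Field K] [Field F] [Algebra K F] {x y w : F}
    (hx : Function.Injective (Polynomial.aeval (R := K) x))
    (hy : Function.Injective (Polynomial.aeval (R := K) y)) (hw : w ≠ 0) {m n : ℕ}
    (h : ∀ φ : F, (∃ P ∈ Polynomial.degreeLT K m, φ = Polynomial.aeval x P) ↔
      ∃ Q ∈ Polynomial.degreeLT K n, φ * w = Polynomial.aeval y Q) : m = n := by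
  let Lx : Polynomial.degreeLT K m →ₗ[K] F :=
    (Polynomial.aeval (R := K) x).toLinearMap ∘ₗ (Polynomial.degreeLT K m).subtype
  let Ly : Polynomial.degreeLT K n →ₗ[K] F :=
    LinearMap.mulRight K w⁻¹ ∘ₗ
      (Polynomial.aeval (R := K) y).toLinearMap ∘ₗ (Polynomial.degreeLT K n).subtype
  have hLx : Function.Injective Lx := hx.comp Subtype.val_injective
  have hLy : Function.Injective Ly :=
    (mul_left_injective₀ (inv_ne_zero hw)).comp (hy.comp Subtype.val_injective)
  have hr : LinearMap.range Lx = LinearMap.range Ly := by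
    ext φ
    constructor
    · rintro ⟨P, rfl⟩
      obtain ⟨Q, hQ, e⟩ := (h _).1 ⟨P.1, P.2, rfl⟩
      refine ⟨⟨Q, hQ⟩, ?_⟩
      change Polynomial.aeval y Q * w⁻¹ = Polynomial.aeval x P.1
      rw [← e, mul_assoc, mul_inv_cancel₀ hw, mul_one]
    · rintro ⟨Q, rfl⟩
      obtain ⟨P, hP, e⟩ := (h (Polynomial.aeval y Q.1 * w⁻¹)).2
        ⟨Q.1, Q.2, by rw [mul_assoc, inv_mul_cancel₀ hw, mul_one]⟩
      exact ⟨⟨P, hP⟩, e.symm⟩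
  have h1 := LinearMap.finrank_range_of_inj hLx
  have h2 := LinearMap.finrank_range_of_inj hLy
  rw [hr, h2, LinearEquiv.finrank_eq (Polynomial.degreeLTEquiv K n),
    LinearEquiv.finrank_eq (Polynomial.degreeLTEquiv K m)] at h1
  simpa using h1.symm

lemma eval₂_reflect_eq {K F : Type*} [Field K] [Field F] (c : K →+* F) {y : F} (hy : y ≠ 0)
    {N : ℕ} {Q : Polynomial K} (hQ : Q.natDegree ≤ N) :
    (Q.reflect N).eval₂ c y = Q.eval₂ c y⁻¹ * y ^ N := by
  let : Invertible y⁻¹ := ⟨y, mul_inv_cancel₀ hy, inv_mul_cancel₀ hy⟩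
  have h := Polynomial.eval₂_reflect_mul_pow c y⁻¹ N Q hQ
  change (Q.reflect N).eval₂ c y * _ = _ at h
  rw [← h, mul_assoc, ← mul_pow, inv_mul_cancel₀ hy, one_pow, mul_one]

/-- A polynomial in `y` that is `y ^ a` times a polynomial in `y⁻¹` has degree at most `a`. -/
lemma mem_degreeLT_of_eval₂_eq {K F : Type*} [Field K] [Field F] (c : K →+* F) {y : F}
    (hy : y ≠ 0) (hinj : Function.Injective (fun P : Polynomial K => P.eval₂ c y)) {a : ℤ}
    {P Q : Polynomial K} (h : P.eval₂ c y = y ^ a * Q.eval₂ c y⁻¹) :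
    P ∈ Polynomial.degreeLT K (a + 1).toNat := by
  have hr := eval₂_reflect_eq c hy (le_refl Q.natDegree)
  have hd : (Q.reflect Q.natDegree).natDegree ≤ Q.natDegree :=
    (Q.natDegree_reflect_le).trans (by simp)
  by_cases hP : P = 0
  · rw [hP]
    exact zero_mem _
  rw [Polynomial.mem_degreeLT, Polynomial.degree_eq_natDegree hP, Nat.cast_lt]
  rcases Int.le_total 0 a with ha | ha
  · obtain ⟨n, rfl⟩ := Int.eq_ofNat_of_zero_le ha
    have e : P * Polynomial.X ^ Q.natDegree = Polynomial.X ^ n * Q.reflect Q.natDegree := by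
      apply hinj
      simp only [Polynomial.eval₂_mul, Polynomial.eval₂_X_pow, hr, h, zpow_natCast]
      ring
    have e' := congrArg Polynomial.natDegree e
    rw [Polynomial.natDegree_mul_X_pow _ hP] at e'
    have := Polynomial.natDegree_mul_le (p := Polynomial.X ^ n) (q := Q.reflect Q.natDegree)
    rw [Polynomial.natDegree_X_pow] at this
    omega
  · obtain ⟨n, hn⟩ := Int.eq_ofNat_of_zero_le (neg_nonneg.2 ha)
    obtain rfl : a = -n := by omega
    have e : P * Polynomial.X ^ (Q.natDegree + n) = Q.reflect Q.natDegree := by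
      apply hinj
      simp only [Polynomial.eval₂_mul, Polynomial.eval₂_X_pow, hr, h, zpow_neg, zpow_natCast]
      field_simp
      ring
    have e' := congrArg Polynomial.natDegree e
    rw [Polynomial.natDegree_mul_X_pow _ hP] at e'
    omega

variable {K : Type u} [Field K] {X : Scheme.{u}}

/-- The value at `η` of a section over a neighbourhood of `η`. -/
noncomputable abbrev valueAt (η : X) {V : X.Opens} (hV : η ∈ V) : Γ(X, V) →+* X.residueField η :=
  (X.residue η).hom.comp (X.presheaf.germ V η hV).hom

/-- The scalars `K → κ(η)` of the residue field of a `K`-scheme. -/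
noncomputable def scalarsAt (s : X ⟶ Spec (CommRingCat.of K)) (η : X) : K →+* X.residueField η :=
  (valueAt η (V := ⊤) trivial).comp (scalars s ⊤)

lemma valueAt_scalars (s : X ⟶ Spec (CommRingCat.of K)) (η : X) {V : X.Opens} (hV : η ∈ V) :
    (valueAt η hV).comp (scalars s V) = scalarsAt s η := by
  have h : scalars s V = (X.presheaf.map (homOfLE le_top : V ⟶ ⊤).op).hom.comp (scalars s ⊤) := by
    rw [scalars, scalars, ← CommRingCat.hom_comp]
    congr 1
    simp only [Category.assoc, ← Functor.map_comp]
    rfl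
  rw [h, scalarsAt]
  ext k
  simp [valueAt]

lemma generic_mem {E : Set X} {η : X} (hE : E = closure {η}) {U : X.Opens} {p : X} (hp : p ∈ E)
    (hpU : p ∈ U) : η ∈ U := by
  rw [hE] at hp
  exact (specializes_iff_mem_closure.2 hp).mem_open U.isOpen hpU

lemma vanishesOn_iff_notMem {E : Set X} {η : X} (hE : E = closure {η}) {V : X.Opens}
    (h : Γ(X, V)) : VanishesOn E h ↔ η ∉ X.basicOpen h := by
  rw [VanishesOn]
  constructor
  · intro hd hη
    exact Set.disjoint_left.1 hd (hE ▸ subset_closure rfl) hη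
  · intro hη
    rw [Set.disjoint_left]
    exact fun p hp hp' => hη (generic_mem hE hp hp')

/-- A function vanishes on an irreducible closed set if and only if its value at the generic point
is zero. -/
lemma vanishesOn_iff_valueAt {E : Set X} {η : X} (hE : E = closure {η}) {V : X.Opens}
    (hV : η ∈ V) (h : Γ(X, V)) : VanishesOn E h ↔ valueAt η hV h = 0 := by
  have h1 := X.evaluation_eq_zero_iff_notMem_basicOpen η hV h
  change valueAt η hV h = 0 ↔ _ at h1
  rw [h1, vanishesOn_iff_notMem hE]

lemma IsAffineLine.generic_mem {s : X ⟶ Spec (CommRingCat.of K)} {E : Set X} {η : X}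
    (hE : E = closure {η}) {V : X.Opens} {x f : Γ(X, V)} (L : IsAffineLine s E x f) : η ∈ V := by
  by_contra hη
  have h0 : ∀ h : Γ(X, V), VanishesOn E h := fun h => by
    rw [VanishesOn, Set.disjoint_left]
    exact fun p hp hp' => hη (ToricSurface.generic_mem hE hp (X.basicOpen_le h hp'))
  obtain ⟨p, -, hp⟩ := L.coordinate 0
  exact zero_ne_one ((hp 0 (h0 _)).trans (hp 1 (h0 _)).symm)

/-- The elements `φ` of the residue field at the generic point `η` of `E` for which `φ g` is a
global section of the conormal sheaf of `E`, where `g` is a function at `η` that generates the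
ideal of `E` there: in a neighbourhood of each point of `E` there is a function that vanishes on
`E` and is congruent to `φ g` modulo the square of the ideal. -/
def conormalSections (E : Set X) (η : X) (g : X.presheaf.stalk η) : Set (X.residueField η) :=
  {φ | ∀ p ∈ E, ∃ (W : X.Opens) (_ : p ∈ W) (hη : η ∈ W) (h : Γ(X, W)) (r : X.presheaf.stalk η),
    VanishesOn E h ∧ X.presheaf.germ W η hη h = r * g ∧ X.residue η r = φ}

lemma mul_mem_conormalSections {E : Set X} {η : X} {g r' φ}
    (hφ : φ ∈ conormalSections E η (r' * g)) : φ * X.residue η r' ∈ conormalSections E η g := by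
  intro p hp
  obtain ⟨W, hpW, hη, h, r, h1, h2, h3⟩ := hφ p hp
  exact ⟨W, hpW, hη, h, r * r', h1, by rw [h2, mul_assoc], by rw [map_mul, h3]⟩

/-- A function near the generic point of `E` that vanishes on `E` can be moved to any affine open
set that meets `E`, at the cost of a denominator. -/
lemma exists_denominator {E : Set X} {η : X} (hE : E = closure {η}) {V W : X.Opens}
    (hV : IsAffineOpen V) {p : X} (hp : p ∈ E) (hpV : p ∈ V) (hpW : p ∈ W) (hηV : η ∈ V)
    (hηW : η ∈ W) {h : Γ(X, W)} (hh : VanishesOn E h) :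
    ∃ (d h' : Γ(X, V)) (n : ℕ), p ∈ X.basicOpen d ∧ VanishesOn E h' ∧
      X.presheaf.germ V η hηV d ^ n * X.presheaf.germ W η hηW h = X.presheaf.germ V η hηV h' := by
  obtain ⟨d, hdW, hpd⟩ := hV.exists_basicOpen_le ⟨p, hpW⟩ hpV
  have hηd : η ∈ X.basicOpen d := ToricSurface.generic_mem hE hp hpd
  have := hV.isLocalization_basicOpen d
  obtain ⟨n, h', e⟩ := IsLocalization.Away.surj d (X.presheaf.map (homOfLE hdW).op h)
  have e' := congrArg (X.presheaf.germ _ η hηd) e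
  rw [map_mul, map_pow] at e'
  have ea : ∀ z : Γ(X, V), X.presheaf.germ _ η hηd (algebraMap Γ(X, V) Γ(X, X.basicOpen d) z) =
      X.presheaf.germ V η hηV z := fun z =>
    X.presheaf.germ_res_apply (homOfLE (X.basicOpen_le d)) η hηd z
  have eb : X.presheaf.germ _ η hηd (X.presheaf.map (homOfLE hdW).op h) =
      X.presheaf.germ W η hηW h := X.presheaf.germ_res_apply (homOfLE hdW) η hηd h
  rw [ea, ea, eb] at e'
  refine ⟨d, h', n, hpd, ?_, by rw [mul_comm, e']⟩
  rw [vanishesOn_iff_valueAt hE hηV]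
  rw [vanishesOn_iff_valueAt hE hηW] at hh
  change X.residue η _ = 0
  rw [← e', map_mul]
  change valueAt η hηW h * _ = 0
  rw [hh, zero_mul]

/-- A local section of the conormal sheaf at each point of the affine line `E ∩ V` is a polynomial
multiple of the generator `f`: the denominators form an ideal that lies in no maximal ideal. -/
lemma IsAffineLine.exists_eval₂ {s : X ⟶ Spec (CommRingCat.of K)} {E : Set X} {η : X}
    (hE : E = closure {η}) [IsDomain (X.presheaf.stalk η)] {V : X.Opens} {x f : Γ(X, V)}
    (L : IsAffineLine s E x f) (hη : η ∈ V) (hf : X.presheaf.germ V η hη f ≠ 0)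
    {φ : X.residueField η} (hφ : φ ∈ conormalSections E η (X.presheaf.germ V η hη f)) :
    ∃ P : Polynomial K, φ = P.eval₂ (scalarsAt s η) (valueAt η hη x) := by
  have hrange : φ ∈ (valueAt η hη).range := by
    let A := (valueAt η hη).range
    let ρ : Γ(X, V) →+* A := (valueAt η hη).rangeRestrict
    let J : Ideal A :=
      { carrier := {a | (a : X.residueField η) * φ ∈ A}
        zero_mem' := by simp
        add_mem' := by
          intro a b ha hb
          simp only [Set.mem_ofPred_eq, Subring.coe_add, add_mul]
          exact add_mem ha hb
        smul_mem' := by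
          intro a b hb
          simp only [Set.mem_ofPred_eq, smul_eq_mul, Subring.coe_mul, mul_assoc]
          exact mul_mem a.2 hb }
    by_contra hne
    have hJ : J ≠ ⊤ := by
      intro h
      have : (1 : A) ∈ J := h ▸ Submodule.mem_top
      change ((1 : A) : X.residueField η) * φ ∈ A at this
      rw [Subring.coe_one, one_mul] at this
      exact hne this
    obtain ⟨m, hm, hJm⟩ := Ideal.exists_le_maximal J hJ
    have hprime : (m.comap ρ).IsPrime := Ideal.comap_isPrime ρ m
    let p : X := L.affine.fromSpec ⟨m.comap ρ, hprime⟩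
    have hpV : p ∈ V := by
      have : p ∈ Set.range L.affine.fromSpec := ⟨_, rfl⟩
      rwa [L.affine.range_fromSpec] at this
    have hpD : ∀ d : Γ(X, V), p ∈ X.basicOpen d ↔ ρ d ∉ m := by
      intro d
      have h1 := L.affine.fromSpec_preimage_basicOpen d
      change (⟨m.comap ρ, hprime⟩ : PrimeSpectrum _) ∈ (L.affine.fromSpec ⁻¹ᵁ X.basicOpen d) ↔ _
      rw [h1]
      rfl
    have hpE : p ∈ E := by
      by_contra hpE
      have hcl : IsClosed E := hE ▸ isClosed_closure
      obtain ⟨d, hd, hpd⟩ := L.affine.exists_basicOpen_le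
        (V := ⟨Eᶜ, hcl.isOpen_compl⟩) ⟨p, hpE⟩ hpV
      rw [hpD] at hpd
      apply hpd
      have h0 : VanishesOn E d := by
        rw [VanishesOn, Set.disjoint_left]
        exact fun q hq hq' => hd hq' hq
      rw [vanishesOn_iff_valueAt hE hη] at h0
      have : ρ d = 0 := Subtype.ext h0
      rw [this]
      exact zero_mem m
    obtain ⟨W, hpW, hηW, h, r, h1, h2, h3⟩ := hφ p hpE
    obtain ⟨d, h', n, hpd, hh', e⟩ := exists_denominator hE L.affine hpE hpV hpW hη hηW h1
    obtain ⟨q, rfl⟩ := (L.generates h').1 hh'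
    rw [hpD] at hpd
    have e2 : X.presheaf.germ V η hη d ^ n * r = X.presheaf.germ V η hη q := by
      apply mul_left_cancel₀ hf
      rw [← map_mul, ← e, h2]
      ring
    have e3 : valueAt η hη d ^ n * φ = valueAt η hη q := by
      have := congrArg (X.residue η) e2
      rw [map_mul, map_pow, h3] at this
      exact this
    have h4 : ρ d ^ n ∈ J := by
      change ((ρ d ^ n : A) : X.residueField η) * φ ∈ A
      rw [Subring.coe_pow]
      change valueAt η hη d ^ n * φ ∈ A
      rw [e3]
      exact ⟨q, rfl⟩
    exact hpd (hm.isPrime.mem_of_pow_mem n (hJm h4))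
  obtain ⟨h, rfl⟩ := hrange
  obtain ⟨P, hP, -⟩ := L.coordinate h
  refine ⟨P, ?_⟩
  rw [vanishesOn_iff_valueAt hE hη, map_sub, sub_eq_zero, Polynomial.hom_eval₂,
    valueAt_scalars] at hP
  exact hP

lemma IsAffineLine.eval₂_injective {s : X ⟶ Spec (CommRingCat.of K)} {E : Set X} {η : X}
    (hE : E = closure {η}) {V : X.Opens} {x f : Γ(X, V)} (L : IsAffineLine s E x f) (hη : η ∈ V) :
    Function.Injective
      (fun P : Polynomial K => P.eval₂ (scalarsAt s η) (valueAt η hη x)) := by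
  intro P Q h
  obtain ⟨R, hR, hu⟩ := L.coordinate (P.eval₂ (scalars s V) x)
  have hv : ∀ Q : Polynomial K, valueAt η hη (Q.eval₂ (scalars s V) x) =
      Q.eval₂ (scalarsAt s η) (valueAt η hη x) := fun Q => by
    rw [Polynomial.hom_eval₂, valueAt_scalars]
  rw [hu P, hu Q]
  · simp only [vanishesOn_iff_valueAt hE hη, map_sub, sub_eq_zero, hv]
    exact h
  · simp only [vanishesOn_iff_valueAt hE hη, sub_self, map_zero]

/-- The equation of an affine line also generates, in the local ring of the generic point, the ideal
of functions from other charts. -/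
lemma IsAffineLine.germ_dvd {s : X ⟶ Spec (CommRingCat.of K)} {E : Set X} {η : X}
    (hE : E = closure {η}) {V W : X.Opens} {x f : Γ(X, V)} (L : IsAffineLine s E x f) (hη : η ∈ V)
    (hηW : η ∈ W) {h : Γ(X, W)} (hh : VanishesOn E h) :
    X.presheaf.germ V η hη f ∣ X.presheaf.germ W η hηW h := by
  have hηE : η ∈ E := hE ▸ subset_closure rfl
  obtain ⟨d, h', n, hpd, hh', e⟩ := exists_denominator hE L.affine hηE hη hηW hη hηW hh
  obtain ⟨q, rfl⟩ := (L.generates h').1 hh'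
  have hu : IsUnit (X.presheaf.germ V η hη d ^ n) :=
    ((X.mem_basicOpen d η hη).1 hpd).pow n
  rw [← hu.dvd_mul_left, e, map_mul]
  exact dvd_mul_right _ _

/-- A presentation of a curve `E` with generic point `η` as a projective line with conormal bundle
`𝒪(a)`: two affine lines with coordinates `x₀` and `x₁ = x₀⁻¹` and generators `f₀` and
`f₁ = x₀ ^ a f₀` of the ideal of `E`, where the last equation holds modulo the square of the
ideal. -/
structure ConormalPresentation (s : X ⟶ Spec (CommRingCat.of K)) (E : Set X) (η : X) (a : ℤ)
    {V₀ V₁ : X.Opens} (x₀ f₀ : Γ(X, V₀)) (x₁ f₁ : Γ(X, V₁)) : Prop where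
  cover : E ⊆ (V₀ : Set X) ∪ V₁
  line₀ : IsAffineLine s E x₀ f₀
  line₁ : IsAffineLine s E x₁ f₁
  mem₀ : η ∈ V₀
  mem₁ : η ∈ V₁
  mul_eq_one : valueAt η mem₀ x₀ * valueAt η mem₁ x₁ = 1
  transition : ∃ T : X.presheaf.stalk η, X.presheaf.germ V₁ η mem₁ f₁ =
    T * X.presheaf.germ V₀ η mem₀ f₀ ∧ X.residue η T = valueAt η mem₀ x₀ ^ a

/-- The global sections of `𝒪(a)` on the projective line are the polynomials of degree at most
`a`. -/
lemma ConormalPresentation.mem_conormalSections_iff {s : X ⟶ Spec (CommRingCat.of K)} {E : Set X}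
    {η : X} (hE : E = closure {η}) [IsDomain (X.presheaf.stalk η)] {a : ℤ} {V₀ V₁ : X.Opens}
    {x₀ f₀ : Γ(X, V₀)} {x₁ f₁ : Γ(X, V₁)} (C : ConormalPresentation s E η a x₀ f₀ x₁ f₁)
    (hf : X.presheaf.germ V₀ η C.mem₀ f₀ ≠ 0) (φ : X.residueField η) :
    φ ∈ conormalSections E η (X.presheaf.germ V₀ η C.mem₀ f₀) ↔
      ∃ P ∈ Polynomial.degreeLT K (a + 1).toNat,
        φ = P.eval₂ (scalarsAt s η) (valueAt η C.mem₀ x₀) := by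
  obtain ⟨T, hT, hTa⟩ := C.transition
  have hcl : IsClosed E := hE ▸ isClosed_closure
  have hx0 : valueAt η C.mem₀ x₀ ≠ 0 := left_ne_zero_of_mul_eq_one C.mul_eq_one
  have hx1 : valueAt η C.mem₁ x₁ = (valueAt η C.mem₀ x₀)⁻¹ :=
    eq_inv_of_mul_eq_one_right C.mul_eq_one
  have hTu : X.residue η T ≠ 0 := hTa ▸ zpow_ne_zero _ hx0
  have hTunit : IsUnit T := by
    by_contra h
    exact hTu ((IsLocalRing.residue_eq_zero_iff T).2 h)
  have hf1 : X.presheaf.germ V₁ η C.mem₁ f₁ ≠ 0 := hT ▸ mul_ne_zero hTunit.ne_zero hf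
  constructor
  · intro hφ
    obtain ⟨P, hP⟩ := C.line₀.exists_eval₂ hE C.mem₀ hf hφ
    refine ⟨P, ?_, hP⟩
    obtain ⟨T', hT'⟩ := hTunit.exists_left_inv
    have e : X.presheaf.germ V₀ η C.mem₀ f₀ = T' * X.presheaf.germ V₁ η C.mem₁ f₁ := by
      rw [hT, ← mul_assoc, hT', one_mul]
    have hres : X.residue η T' = (valueAt η C.mem₀ x₀ ^ a)⁻¹ := by
      rw [← hTa]
      apply eq_inv_of_mul_eq_one_left
      rw [← map_mul, hT', map_one]
    rw [e] at hφ
    obtain ⟨Q, hQ⟩ := C.line₁.exists_eval₂ hE C.mem₁ hf1 (mul_mem_conormalSections hφ)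
    rw [hres, hx1, hP] at hQ
    refine mem_degreeLT_of_eval₂_eq (scalarsAt s η) hx0 (C.line₀.eval₂_injective hE C.mem₀)
      (Q := Q) ?_
    rw [← hQ, mul_comm, mul_assoc, inv_mul_cancel₀ (zpow_ne_zero _ hx0), mul_one]
  · rintro ⟨P, hP, rfl⟩ p hp
    rcases C.cover hp with hp0 | hp1
    · refine ⟨V₀, hp0, C.mem₀, P.eval₂ (scalars s V₀) x₀ * f₀,
        X.presheaf.germ V₀ η C.mem₀ (P.eval₂ (scalars s V₀) x₀),
        (C.line₀.generates _).2 (dvd_mul_left _ _), map_mul _ _ _, ?_⟩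
      change valueAt η C.mem₀ _ = _
      rw [Polynomial.hom_eval₂, valueAt_scalars]
    · rcases Int.lt_or_le a 0 with ha | ha
      · have hP0 : P = 0 := by
          rw [Int.toNat_of_nonpos (by omega), Polynomial.mem_degreeLT] at hP
          exact Polynomial.degree_eq_bot.1 (by simpa using hP)
        refine ⟨V₁, hp1, C.mem₁, 0, 0, (C.line₁.generates _).2 (dvd_zero _), ?_, ?_⟩
        · rw [map_zero, zero_mul]
        · rw [hP0, Polynomial.eval₂_zero, map_zero]
      · obtain ⟨n, rfl⟩ := Int.eq_ofNat_of_zero_le ha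
        have hPn : P.natDegree ≤ n := by
          rw [show ((n : ℤ) + 1).toNat = n + 1 by omega, Polynomial.mem_degreeLT] at hP
          rw [Polynomial.natDegree_le_iff_coeff_eq_zero]
          exact fun k hk => (Polynomial.degree_lt_iff_coeff_zero _ _).1 hP k hk
        refine ⟨V₁, hp1, C.mem₁, (P.reflect n).eval₂ (scalars s V₁) x₁ * f₁,
          X.presheaf.germ V₁ η C.mem₁ ((P.reflect n).eval₂ (scalars s V₁) x₁) * T,
          (C.line₁.generates _).2 (dvd_mul_left _ _), ?_, ?_⟩
        · rw [map_mul, hT, mul_assoc]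
        · rw [map_mul, hTa]
          change valueAt η C.mem₁ _ * _ = _
          rw [Polynomial.hom_eval₂, valueAt_scalars, hx1,
            eval₂_reflect_eq _ (inv_ne_zero hx0) hPn, inv_inv, zpow_natCast, mul_assoc, ← mul_pow,
            inv_mul_cancel₀ hx0, one_pow, mul_one]

/-- The degree of the conormal bundle does not depend on the presentation. -/
lemma ConormalPresentation.degree_eq_one {s : X ⟶ Spec (CommRingCat.of K)} {E : Set X}
    {η : X} (hE : E = closure {η}) [IsDomain (X.presheaf.stalk η)] {a : ℤ} {V₀ V₁ V₀' V₁' : X.Opens}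
    {x₀ f₀ : Γ(X, V₀)} {x₁ f₁ : Γ(X, V₁)} (C : ConormalPresentation s E η a x₀ f₀ x₁ f₁)
    (hf : X.presheaf.germ V₀ η C.mem₀ f₀ ≠ 0)
    {x₀' f₀' : Γ(X, V₀')} {x₁' f₁' : Γ(X, V₁')}
    (C' : ConormalPresentation s E η 1 x₀' f₀' x₁' f₁') : a = 1 := by
  let : Algebra K (X.residueField η) := (scalarsAt s η).toAlgebra
  have h₀ : VanishesOn E f₀ := (C.line₀.generates _).2 dvd_rfl
  have h₀' : VanishesOn E f₀' := (C'.line₀.generates _).2 dvd_rfl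
  have hassoc := associated_of_dvd_dvd (C.line₀.germ_dvd hE C.mem₀ C'.mem₀ h₀')
    (C'.line₀.germ_dvd hE C'.mem₀ C.mem₀ h₀)
  have hf' := hassoc.ne_zero_iff.1 hf
  obtain ⟨w, hw⟩ := hassoc
  have hw0 : X.residue η (w : X.presheaf.stalk η) ≠ 0 := (w.isUnit.map (X.residue η).hom).ne_zero
  have hwi : X.residue η ((w⁻¹ : (X.presheaf.stalk η)ˣ) : X.presheaf.stalk η) *
      X.residue η (w : X.presheaf.stalk η) = 1 := by
    rw [← map_mul, Units.inv_mul, map_one]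
  have key := eq_of_polynomial_spaces_eq (K := K) (x := valueAt η C.mem₀ x₀)
    (y := valueAt η C'.mem₀ x₀') (C.line₀.eval₂_injective hE C.mem₀)
    (C'.line₀.eval₂_injective hE C'.mem₀) (inv_ne_zero hw0) (m := (a + 1).toNat)
    (n := ((1 : ℤ) + 1).toNat) ?_
  · simp at key
    omega
  · intro φ
    refine (C.mem_conormalSections_iff hE hf φ).symm.trans
      (Iff.trans ?_ (C'.mem_conormalSections_iff hE hf' _))
    constructor
    · intro hφ
      have : X.presheaf.germ V₀ η C.mem₀ f₀ =
          (w⁻¹ : (X.presheaf.stalk η)ˣ) * X.presheaf.germ V₀' η C'.mem₀ f₀' := by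
        rw [← hw, mul_comm, mul_assoc, Units.mul_inv, mul_one]
      rw [this] at hφ
      rw [← eq_inv_of_mul_eq_one_left hwi]
      exact mul_mem_conormalSections hφ
    · intro hφ
      rw [← hw, mul_comm] at hφ
      have := mul_mem_conormalSections hφ
      rwa [mul_assoc, inv_mul_cancel₀ hw0, mul_one] at this

end ConormalDegree

/-! ### The coordinate rings of the charts -/

section ChartAlgebra

variable (K : Type u) [Field K]

instance chartRing_isDomain (σ : Finset Lattice) : IsDomain (chartRing K σ) := by
  have : NoZeroDivisors (AddMonoidAlgebra K Lattice) := inferInstance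
  have : NoZeroDivisors (chartRing K σ) :=
    (AddMonoidAlgebra.mapDomain_injective (R := K)
      (Subtype.val_injective : Function.Injective (dualMonoid σ).subtype)).noZeroDivisors
      (AddMonoidAlgebra.mapDomainRingHom K (dualMonoid σ).subtype) (map_zero _) (map_mul _)
  exact NoZeroDivisors.to_isDomain _

variable {K} {σ : Finset Lattice}

/-- The restriction of functions on the chart of `σ` to the torus orbit of a face `τ`, which
kills the characters that do not vanish on `τ`. -/
noncomputable def faceRestriction (K : Type u) [Field K] {τ : Finset Lattice} (h : τ ⊆ σ) :
    chartRing K σ →ₐ[K] AddMonoidAlgebra K Lattice :=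
  AddMonoidAlgebra.lift K _ _
    { toFun := fun m => if ∀ v ∈ τ, m.toAdd.1 ⬝ᵥ v = 0 then
        AddMonoidAlgebra.single m.toAdd.1 1 else 0
      map_one' := by
        simp [AddMonoidAlgebra.one_def]
      map_mul' := by
        intro a b
        have key : (∀ v ∈ τ, (a * b).toAdd.1 ⬝ᵥ v = 0) ↔
            (∀ v ∈ τ, a.toAdd.1 ⬝ᵥ v = 0) ∧ ∀ v ∈ τ, b.toAdd.1 ⬝ᵥ v = 0 := by
          simp only [toAdd_mul, AddSubmonoid.coe_add, add_dotProduct]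
          refine ⟨fun H => ⟨fun v hv => ?_, fun v hv => ?_⟩, fun H v hv => ?_⟩
          · have ha := a.toAdd.2 v (h hv)
            have hb := b.toAdd.2 v (h hv)
            have := H v hv
            omega
          · have ha := a.toAdd.2 v (h hv)
            have hb := b.toAdd.2 v (h hv)
            have := H v hv
            omega
          · rw [H.1 v hv, H.2 v hv, add_zero]
        simp only [key]
        by_cases h1 : ∀ v ∈ τ, a.toAdd.1 ⬝ᵥ v = 0
        · by_cases h2 : ∀ v ∈ τ, b.toAdd.1 ⬝ᵥ v = 0
          · rw [if_pos ⟨h1, h2⟩, if_pos h1, if_pos h2, AddMonoidAlgebra.single_mul_single, one_mul]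
            rfl
          · rw [if_neg (fun H => h2 H.2), if_neg h2, mul_zero]
        · rw [if_neg (fun H => h1 H.1), if_neg h1, zero_mul] }

lemma faceRestriction_single {τ : Finset Lattice} (h : τ ⊆ σ) (m : dualMonoid σ) (r : K) :
    faceRestriction K h (AddMonoidAlgebra.single m r) =
      if ∀ v ∈ τ, m.1 ⬝ᵥ v = 0 then AddMonoidAlgebra.single m.1 r else 0 := by
  rw [faceRestriction, AddMonoidAlgebra.lift_single]
  change r • (if ∀ v ∈ τ, m.1 ⬝ᵥ v = 0 then AddMonoidAlgebra.single m.1 (1 : K) else 0) = _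
  split_ifs <;> simp

lemma coeff_faceRestriction {τ : Finset Lattice} (h : τ ⊆ σ) (f : chartRing K σ)
    (m : dualMonoid σ) : (faceRestriction K h f).coeff m.1 =
      if ∀ v ∈ τ, m.1 ⬝ᵥ v = 0 then f.coeff m else 0 := by
  induction f using AddMonoidAlgebra.induction_linear with
  | zero => simp
  | add f g hf hg =>
    rw [map_add, AddMonoidAlgebra.coeff_add, AddMonoidAlgebra.coeff_add, Finsupp.add_apply,
      Finsupp.add_apply, hf, hg]
    split_ifs <;> simp
  | single w r =>
    rw [faceRestriction_single]
    by_cases hwm : w = m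
    · subst hwm
      split_ifs <;> simp
    · have : w.1 ≠ m.1 := fun h => hwm (Subtype.ext h)
      split_ifs <;> simp [hwm, this]

/-- The generic point of the torus orbit of a face `τ` of `σ`, in the chart of `σ`. -/
noncomputable def orbitPoint (K : Type u) [Field K] {σ τ : Finset Lattice} (h : τ ⊆ σ) :
    Spec (CommRingCat.of (chartRing K σ)) :=
  (⟨RingHom.ker (faceRestriction K h), RingHom.ker_isPrime _⟩ : PrimeSpectrum (chartRing K σ))

lemma mem_orbitPoint {τ : Finset Lattice} (h : τ ⊆ σ) (f : chartRing K σ) :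
    f ∈ PrimeSpectrum.asIdeal (orbitPoint K h) ↔
      ∀ m : dualMonoid σ, (∀ v ∈ τ, m.1 ⬝ᵥ v = 0) → f.coeff m = 0 := by
  change faceRestriction K h f = 0 ↔ _
  constructor
  · intro h0 m hm
    have := coeff_faceRestriction h f m
    rw [h0, if_pos hm] at this
    simpa using this.symm
  · intro h0
    have : f = f.coeff.sum AddMonoidAlgebra.single := (AddMonoidAlgebra.sum_coeff_single f).symm
    rw [this, Finsupp.sum, map_sum]
    refine Finset.sum_eq_zero fun m hm => ?_
    rw [faceRestriction_single, if_neg]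
    exact fun h1 => (Finsupp.mem_support_iff.1 hm) (h0 m h1)

lemma orbitPoint_anti {τ τ' : Finset Lattice} (h : τ ⊆ σ) (h' : τ' ⊆ τ) :
    PrimeSpectrum.asIdeal (orbitPoint K (h'.trans h)) ≤ PrimeSpectrum.asIdeal (orbitPoint K h) := by
  intro f hf
  rw [mem_orbitPoint] at hf ⊢
  exact fun m hm => hf m fun v hv => hm v (h' hv)

lemma comap_orbitPoint {ρ τ : Finset Lattice} (h : τ ⊆ σ) (h' : ρ ⊆ τ) :
    Spec.map (CommRingCat.ofHom (chartRingMap K h).toRingHom) (orbitPoint K h') =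
      orbitPoint K (h'.trans h) := by
  have key : (faceRestriction K h').comp (chartRingMap K h) = faceRestriction K (h'.trans h) := by
    refine AddMonoidAlgebra.algHom_ext (fun m => ?_) (Subsingleton.elim _ _)
    rw [AlgHom.comp_apply, chartRingMap_single, faceRestriction_single, faceRestriction_single]
    rfl
  apply PrimeSpectrum.ext
  ext f
  change faceRestriction K h' (chartRingMap K h f) = 0 ↔ faceRestriction K (h'.trans h) f = 0
  rw [← key]
  rfl

/-- The generic point of the torus invariant curve of `v` in the chart of `σ ∋ v`. -/
noncomputable abbrev facePoint (K : Type u) [Field K] {σ : Finset Lattice} {v : Lattice}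
    (hv : v ∈ σ) : Spec (CommRingCat.of (chartRing K σ)) :=
  orbitPoint K (Finset.singleton_subset_iff.2 hv)

/-- The prime ideal of the torus invariant curve of `v` in the chart of `σ ∋ v`. -/
noncomputable abbrev facePrime (K : Type u) [Field K] {σ : Finset Lattice} {v : Lattice}
    (hv : v ∈ σ) : Ideal (chartRing K σ) :=
  PrimeSpectrum.asIdeal (facePoint K hv)

lemma mem_facePrime {v : Lattice} (hv : v ∈ σ) (f : chartRing K σ) :
    f ∈ facePrime K hv ↔ ∀ m : dualMonoid σ, m.1 ⬝ᵥ v = 0 → f.coeff m = 0 := by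
  rw [facePrime, mem_orbitPoint]
  simp only [Finset.mem_singleton, forall_eq]

lemma single_mem_facePrime {v : Lattice} (hv : v ∈ σ) (m : dualMonoid σ) :
    AddMonoidAlgebra.single m (1 : K) ∈ facePrime K hv ↔ m.1 ⬝ᵥ v ≠ 0 := by
  rw [mem_facePrime]
  constructor
  · intro h h0
    simpa using h m h0
  · intro h n hn
    have : m ≠ n := by rintro rfl; exact h hn
    simp [this]

/-- The prime ideal of the invariant curve of `v` is principal: it is generated by any character of
order `1` along `v` and order `0` along the other ray of the chart. -/
lemma mem_facePrime_iff_dvd {v : Lattice} (hv : v ∈ σ) (m : dualMonoid σ) (h1 : m.1 ⬝ᵥ v = 1)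
    (h0 : ∀ w ∈ σ, w ≠ v → m.1 ⬝ᵥ w = 0) (f : chartRing K σ) :
    f ∈ facePrime K hv ↔ AddMonoidAlgebra.single m (1 : K) ∣ f := by
  constructor
  · intro hf
    rw [mem_facePrime] at hf
    have : f = f.coeff.sum AddMonoidAlgebra.single := (AddMonoidAlgebra.sum_coeff_single f).symm
    rw [this, Finsupp.sum]
    refine Finset.dvd_sum fun n hn => ?_
    have hnv : n.1 ⬝ᵥ v ≠ 0 := fun h => (Finsupp.mem_support_iff.1 hn) (hf n h)
    have hmem : n.1 - m.1 ∈ dualMonoid σ := by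
      intro w hw
      rw [sub_dotProduct]
      have := n.2 w hw
      by_cases hwv : w = v
      · subst hwv
        omega
      · rw [h0 w hw hwv]
        omega
    refine ⟨AddMonoidAlgebra.single ⟨_, hmem⟩ (f.coeff n), ?_⟩
    rw [AddMonoidAlgebra.single_mul_single, one_mul]
    congr 1
    ext1
    simp
  · rintro ⟨g, rfl⟩
    refine Ideal.mul_mem_right _ _ ((single_mem_facePrime hv m).2 ?_)
    rw [h1]
    exact one_ne_zero

lemma coeff_eval₂_single (m : dualMonoid σ) (hm : Function.Injective fun k : ℕ => k • m)
    (p : Polynomial K) (k : ℕ) :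
    (p.eval₂ (algebraMap K (chartRing K σ)) (AddMonoidAlgebra.single m 1)).coeff (k • m) =
      p.coeff k := by
  induction p using Polynomial.induction_on' with
  | add p q hp hq => simp [Polynomial.eval₂_add, hp, hq]
  | monomial n a =>
    rw [Polynomial.eval₂_monomial, AddMonoidAlgebra.single_pow, one_pow, ← Algebra.smul_def,
      Polynomial.coeff_monomial]
    by_cases h : n = k
    · simp [h]
    · have : n • m ≠ k • m := fun e => h (hm e)
      simp [h, this]

/-- The functions on the invariant curve of `v` in a two-dimensional chart are the polynomials in
the coordinate character `m`. -/
lemma existsUnique_polynomial {v : Lattice} (hv : v ∈ σ) (m : dualMonoid σ) (hm0 : m ≠ 0)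
    (h0 : m.1 ⬝ᵥ v = 0) (hgen : ∀ n : dualMonoid σ, n.1 ⬝ᵥ v = 0 → ∃ k : ℕ, n = k • m)
    (f : chartRing K σ) :
    ∃! p : Polynomial K, f - p.eval₂ (algebraMap K (chartRing K σ))
      (AddMonoidAlgebra.single m 1) ∈ facePrime K hv := by
  have hinj : Function.Injective fun k : ℕ => k • m := by
    intro k l hkl
    have h1 : (k : ℤ) • m.1 = (l : ℤ) • m.1 := by
      simpa using congrArg Subtype.val hkl
    have := smul_left_injective ℤ (fun e => hm0 (Subtype.ext e) : m.1 ≠ 0) h1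
    exact_mod_cast this
  have key : ∀ p : Polynomial K, f - p.eval₂ (algebraMap K (chartRing K σ))
      (AddMonoidAlgebra.single m 1) ∈ facePrime K hv ↔
        ∀ k : ℕ, f.coeff (k • m) = p.coeff k := by
    intro p
    rw [mem_facePrime]
    constructor
    · intro h k
      have := h (k • m) (by
        change (k • m.1) ⬝ᵥ v = 0
        rw [smul_dotProduct, h0, smul_zero])
      rw [AddMonoidAlgebra.coeff_sub, Finsupp.sub_apply, sub_eq_zero,
        coeff_eval₂_single m hinj] at this
      exact this
    · intro h n hn
      obtain ⟨k, rfl⟩ := hgen n hn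
      rw [AddMonoidAlgebra.coeff_sub, Finsupp.sub_apply, sub_eq_zero,
        coeff_eval₂_single m hinj, h]
  simp only [key]
  refine ⟨⟨.ofCoeff (f.coeff.comapDomain (fun k : ℕ => k • m) hinj.injOn)⟩, fun k => rfl, ?_⟩
  intro q hq
  ext k
  rw [← hq k]
  rfl

end ChartAlgebra

/-! ### Functions on an affine chart of a scheme -/

section AffineChart

variable {X : Scheme.{u}} {R : CommRingCat.{u}} (j : Spec R ⟶ X) [IsOpenImmersion j]

/-- The function on the image of the open immersion `j : Spec R ⟶ X` given by an element of `R`. -/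
noncomputable def chartFunction : R →+* Γ(X, j ''ᵁ ⊤) :=
  ((Scheme.ΓSpecIso R).inv ≫ (j.appIso ⊤).inv).hom

lemma chartFunction_bijective : Function.Bijective (chartFunction j) :=
  ConcreteCategory.bijective_of_isIso ((Scheme.ΓSpecIso R).inv ≫ (j.appIso ⊤).inv)

lemma mem_chartOpen {p : X} : p ∈ j ''ᵁ ⊤ ↔ ∃ y, j y = p := by
  rw [Scheme.Hom.image_top_eq_opensRange]
  exact Scheme.Hom.mem_opensRange

lemma basicOpen_chartFunction (r : R) :
    X.basicOpen (chartFunction j r) = j ''ᵁ PrimeSpectrum.basicOpen r := by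
  have h := Scheme.image_basicOpen j (U := ⊤) ((Scheme.ΓSpecIso R).inv r)
  rw [basicOpen_eq_of_affine'] at h
  simpa [chartFunction] using h.symm

lemma mem_basicOpen_chartFunction (r : R) (y : Spec R) :
    j y ∈ X.basicOpen (chartFunction j r) ↔ r ∉ PrimeSpectrum.asIdeal y := by
  rw [basicOpen_chartFunction]
  constructor
  · rintro ⟨z, hz, e⟩
    have : z = y := j.isOpenEmbedding.injective e
    exact this ▸ hz
  · exact fun h => ⟨y, h, rfl⟩

lemma chartFunction_restrict {R' : CommRingCat.{u}} (i : Spec R' ⟶ X) [IsOpenImmersion i]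
    (ψ : R ⟶ R') (h : Spec.map ψ ≫ j = i) (hle : i ''ᵁ ⊤ ≤ j ''ᵁ ⊤) (r : R) :
    X.presheaf.map (homOfLE hle).op (chartFunction j r) = chartFunction i (ψ r) := by
  subst h
  have hb : Function.Injective (((Spec.map ψ ≫ j).appIso ⊤).hom ≫ (Scheme.ΓSpecIso R').hom) :=
    (ConcreteCategory.bijective_of_isIso _).1
  apply hb
  have e1 : (chartFunction j r : Γ(X, j ''ᵁ ⊤)) =
      ((Scheme.ΓSpecIso R).inv ≫ (j.appIso ⊤).inv) r := rfl
  have e2 : chartFunction (Spec.map ψ ≫ j) (ψ r) =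
      ((Scheme.ΓSpecIso R').inv ≫ ((Spec.map ψ ≫ j).appIso ⊤).inv) (ψ r) := rfl
  rw [e1, e2, ← CommRingCat.comp_apply, ← CommRingCat.comp_apply, ← CommRingCat.comp_apply,
    ← CommRingCat.comp_apply]
  congr 2
  simp only [Category.assoc, Iso.inv_hom_id_assoc, Iso.inv_hom_id, Category.comp_id]
  rw [Scheme.Hom.appIso_hom', Scheme.Hom.map_appLE_assoc,
    ← Scheme.Hom.appLE_comp_appLE (Spec.map ψ) j (j ''ᵁ ⊤) ⊤ ⊤ (j.preimage_image_eq ⊤).ge le_top,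
    Category.assoc, Scheme.Hom.appIso_inv_appLE_assoc]
  have h1 : (Spec.map ψ).appLE ⊤ ⊤ le_top = (Spec.map ψ).appTop :=
    (congrArg ((Spec.map ψ).app ⊤ ≫ ·) ((Spec R').presheaf.map_id _)).trans (Category.comp_id _)
  have h2 : ∀ i : (⊤ : (Spec R).Opens) ⟶ ⊤, (Spec R).presheaf.map i.op = 𝟙 _ := fun i =>
    (Spec R).presheaf.map_id _
  rw [h1, h2, Category.id_comp, ← Scheme.ΓSpecIso_inv_naturality_assoc, Iso.inv_hom_id,
    Category.comp_id]

lemma chartFunction_scalars {K : Type u} [Field K] (s : X ⟶ Spec (CommRingCat.of K))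
    (φ : CommRingCat.of K ⟶ R) (h : j ≫ s = Spec.map φ) (k : K) :
    scalars s (j ''ᵁ ⊤) k = chartFunction j (φ k) := by
  have hb : Function.Injective ((j.appIso ⊤).hom ≫ (Scheme.ΓSpecIso R).hom) :=
    (ConcreteCategory.bijective_of_isIso _).1
  apply hb
  change (((Scheme.ΓSpecIso (CommRingCat.of K)).inv ≫ s.appTop ≫ X.presheaf.map (homOfLE le_top).op)
    ≫ ((j.appIso ⊤).hom ≫ (Scheme.ΓSpecIso R).hom)) k =
    (φ ≫ ((Scheme.ΓSpecIso R).inv ≫ (j.appIso ⊤).inv) ≫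
      ((j.appIso ⊤).hom ≫ (Scheme.ΓSpecIso R).hom)) k
  congr 2
  simp only [Category.assoc, Iso.inv_hom_id_assoc, Iso.inv_hom_id, Category.comp_id]
  rw [Scheme.Hom.appIso_hom', Scheme.Hom.map_appLE_assoc]
  have h1 : j.appLE ⊤ ⊤ le_top = j.appTop :=
    (congrArg (j.app ⊤ ≫ ·) ((Spec R).presheaf.map_id _)).trans (Category.comp_id _)
  rw [h1, ← Scheme.Hom.comp_appTop_assoc, h, ← Scheme.ΓSpecIso_inv_naturality_assoc,
    Iso.inv_hom_id, Category.comp_id]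

lemma isDomain_stalk_of_chart [IsDomain R] (y : Spec R) :
    IsDomain (X.presheaf.stalk (j y)) := by
  have : IsIntegral (Spec R) := inferInstance
  let e := asIso (j.stalkMap y)
  exact e.commRingCatIsoToRingEquiv.toMulEquiv.isDomain _

lemma germ_chartFunction_ne_zero [IsDomain R] {x : X} (h : x ∈ j ''ᵁ ⊤) {r : R}
    (hr : r ≠ 0) : X.presheaf.germ _ x h (chartFunction j r) ≠ 0 := by
  obtain ⟨y, rfl⟩ := (mem_chartOpen j).1 h
  have : IsIntegral (Spec R) := inferInstance
  intro h0
  have h1 := j.germ_stalkMap_apply (j ''ᵁ ⊤) y h (chartFunction j r)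
  rw [h0, map_zero] at h1
  have h2 := germ_injective_of_isIntegral (Spec R) y h (h1.symm.trans (map_zero _).symm)
  apply hr
  have hb : Function.Injective ((Scheme.ΓSpecIso R).inv ≫ (j.appIso ⊤).inv ≫ j.app (j ''ᵁ ⊤)) := by
    rw [Scheme.Hom.appIso_inv_app]
    exact (ConcreteCategory.bijective_of_isIso _).1
  apply hb
  rw [map_zero]
  exact h2

end AffineChart

/-! ### Charts and invariant curves of a toric surface -/

namespace Fan

variable (K : Type u) [Field K] {Δ : Fan}

instance chart_isOpenImmersion {σ : Finset Lattice} (hσ : σ ∈ Δ.cones) :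
    IsOpenImmersion (chart K hσ) :=
  inferInstanceAs (IsOpenImmersion (colimit.ι (Δ.chartDiagram K) ⟨σ, hσ⟩))

lemma exists_chart (x : Δ.surface K) :
    ∃ (σ : Finset Lattice) (hσ : σ ∈ Δ.cones) (y : Spec (CommRingCat.of (chartRing K σ))),
      chart K hσ y = x := by
  obtain ⟨σ, y, h⟩ := Scheme.IsLocallyDirected.ι_jointly_surjective (Δ.chartDiagram K) x
  exact ⟨σ.1, σ.2, y, h⟩

lemma chart_str {σ : Finset Lattice} (hσ : σ ∈ Δ.cones) :
    chart K hσ ≫ Δ.str K = Spec.map (CommRingCat.ofHom (algebraMap K (chartRing K σ))) :=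
  colimit.ι_desc _ _

lemma chart_apply {σ τ : Finset Lattice} (hσ : σ ∈ Δ.cones) (hτ : τ ∈ Δ.cones) (h : τ ⊆ σ)
    (y : Spec (CommRingCat.of (chartRing K τ))) :
    chart K hσ (Spec.map (CommRingCat.ofHom (chartRingMap K h).toRingHom) y) = chart K hτ y := by
  rw [← chart_comp K hσ hτ h]
  rfl

lemma range_chart_mono {σ τ : Finset Lattice} (hσ : σ ∈ Δ.cones) (hτ : τ ∈ Δ.cones) (h : τ ⊆ σ) :
    Set.range (chart K hτ) ⊆ Set.range (chart K hσ) := by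
  rintro _ ⟨y, rfl⟩
  exact ⟨_, chart_apply K hσ hτ h y⟩

/-- The charts of two cones are glued along the chart of the common face, hence meet only there. -/
lemma range_chart_inter {σ τ : Finset Lattice} (hσ : σ ∈ Δ.cones) (hτ : τ ∈ Δ.cones)
    (hκ : σ ∩ τ ∈ Δ.cones) :
    Set.range (chart K hσ) ∩ Set.range (chart K hτ) = Set.range (chart K hκ) := by
  apply subset_antisymm
  · rintro x ⟨⟨y, rfl⟩, ⟨z, hz⟩⟩
    obtain ⟨κ, f, g, w, h1, h2⟩ :=
      (Scheme.IsLocallyDirected.ι_eq_ι_iff (Δ.chartDiagram K) (i := ⟨τ, hτ⟩) (j := ⟨σ, hσ⟩)).1 hz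
    refine range_chart_mono K hκ κ.2 (Finset.subset_inter (leOfHom g) (leOfHom f)) ⟨w, ?_⟩
    rw [← chart_apply K hσ κ.2 (leOfHom g) w]
    exact congrArg _ h2
  · exact Set.subset_inter (range_chart_mono K hσ hκ Finset.inter_subset_left)
      (range_chart_mono K hτ hκ Finset.inter_subset_right)

/-- The chart of a face `τ` of `σ` is the non-vanishing locus, in the chart of `σ`, of any character
that cuts out the face `τ`. -/
lemma mem_range_chart_iff {σ τ : Finset Lattice} (hσ : σ ∈ Δ.cones) (hτ : τ ∈ Δ.cones) (h : τ ⊆ σ)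
    (m : dualMonoid σ) (h0 : ∀ v ∈ τ, m.1 ⬝ᵥ v = 0) (h1 : ∀ v ∈ σ, v ∉ τ → 0 < m.1 ⬝ᵥ v)
    (y : Spec (CommRingCat.of (chartRing K σ))) :
    chart K hσ y ∈ Set.range (chart K hτ) ↔
      AddMonoidAlgebra.single m (1 : K) ∉ PrimeSpectrum.asIdeal y := by
  have hr := Δ.chartDiagram_range K
    (homOfLE h : (⟨τ, hτ⟩ : {ρ // ρ ∈ Δ.cones}) ⟶ ⟨σ, hσ⟩) m h0 h1
  have : y ∈ Set.range ((Δ.chartDiagram K).map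
      (homOfLE h : (⟨τ, hτ⟩ : {ρ // ρ ∈ Δ.cones}) ⟶ ⟨σ, hσ⟩)) ↔
      AddMonoidAlgebra.single m (1 : K) ∉ PrimeSpectrum.asIdeal y := by
    rw [hr]
    rfl
  rw [← this]
  constructor
  · rintro ⟨z, hz⟩
    refine ⟨z, (chart K hσ).isOpenEmbedding.injective ?_⟩
    exact (chart_apply K hσ hτ h z).trans hz
  · rintro ⟨z, rfl⟩
    exact ⟨z, (chart_apply K hσ hτ h z).symm⟩

/-- The generic point of the torus invariant curve of a ray. -/
noncomputable def rayPoint {v : Lattice} (hv : {v} ∈ Δ.cones) : Δ.surface K :=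
  chart K hv (facePoint K (Finset.mem_singleton_self v))

lemma chart_facePoint {σ : Finset Lattice} (hσ : σ ∈ Δ.cones) {v : Lattice} (hvσ : v ∈ σ)
    (hv : {v} ∈ Δ.cones) : chart K hσ (facePoint K hvσ) = rayPoint K hv := by
  have h : {v} ⊆ σ := Finset.singleton_subset_iff.2 hvσ
  rw [rayPoint, ← chart_apply K hσ hv h, comap_orbitPoint]

/-- The generator of a ray is primitive, so some character has order `1` along it. -/
lemma exists_dualMonoid_eq_one {v : Lattice} (hv : {v} ∈ Δ.cones) :
    ∃ m : dualMonoid {v}, m.1 ⬝ᵥ v = 1 := by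
  obtain ⟨b, hb⟩ := Δ.smooth _ hv
  obtain ⟨i, hi⟩ := hb (Finset.mem_coe.2 (Finset.mem_singleton_self v))
  have key : (fun k => b.coord i (Pi.single k 1)) ⬝ᵥ v = b.coord i v := by
    have hv : v = ∑ k, v k • (Pi.single k 1 : Lattice) := by
      ext j
      simp [Finset.sum_apply, Pi.single_apply]
    conv_rhs => rw [hv, map_sum]
    simp only [map_smul, dotProduct, smul_eq_mul, mul_comm]
  have h1 : b.coord i v = 1 := by
    rw [← hi]
    simp
  refine ⟨⟨fun k => b.coord i (Pi.single k 1), ?_⟩, key.trans h1⟩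
  intro w hw
  rw [Finset.mem_singleton.1 hw, key, h1]
  exact zero_le_one

lemma mem_range_torus_iff {v : Lattice} (hv : {v} ∈ Δ.cones) (m : dualMonoid {v})
    (hm : m.1 ⬝ᵥ v = 1) (y : Spec (CommRingCat.of (chartRing K {v}))) :
    chart K hv y ∈ Set.range (Δ.torus K) ↔
      AddMonoidAlgebra.single m (1 : K) ∉ PrimeSpectrum.asIdeal y := by
  refine mem_range_chart_iff K hv Δ.empty_mem (Finset.empty_subset _) m
    (fun v hv => absurd hv (Finset.notMem_empty v)) ?_ y
  intro w hw _
  rw [Finset.mem_singleton.1 hw, hm]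
  exact one_pos

lemma rayPoint_notMem_torus {v : Lattice} (hv : {v} ∈ Δ.cones) :
    rayPoint K hv ∉ Set.range (Δ.torus K) := by
  obtain ⟨m, hm⟩ := exists_dualMonoid_eq_one hv
  rw [rayPoint, mem_range_torus_iff K hv m hm, not_not]
  refine (single_mem_facePrime _ m).2 ?_
  rw [hm]
  exact one_ne_zero

lemma rayPoint_mem_range_iff {σ : Finset Lattice} (hσ : σ ∈ Δ.cones) {v : Lattice}
    (hv : {v} ∈ Δ.cones) : rayPoint K hv ∈ Set.range (chart K hσ) ↔ v ∈ σ := by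
  constructor
  · intro h
    by_contra hvσ
    have he : {v} ∩ σ = ∅ := Finset.singleton_inter_of_notMem hvσ
    have hκ : {v} ∩ σ ∈ Δ.cones := he ▸ Δ.empty_mem
    have h1 : rayPoint K hv ∈ Set.range (chart K hκ) := by
      rw [← range_chart_inter K hv hσ hκ]
      exact ⟨⟨_, rfl⟩, h⟩
    exact rayPoint_notMem_torus K hv
      (range_chart_mono K Δ.empty_mem hκ he.subset h1)
  · intro h
    exact ⟨_, chart_facePoint K hσ h hv⟩

lemma specializes_chart_iff {σ : Finset Lattice} (hσ : σ ∈ Δ.cones) {v : Lattice} (hvσ : v ∈ σ)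
    (hv : {v} ∈ Δ.cones) (y : Spec (CommRingCat.of (chartRing K σ))) :
    rayPoint K hv ⤳ chart K hσ y ↔ facePrime K hvσ ≤ PrimeSpectrum.asIdeal y := by
  rw [← chart_facePoint K hσ hvσ hv,
    (chart K hσ).isOpenEmbedding.isInducing.specializes_iff]
  exact (PrimeSpectrum.le_iff_specializes (facePoint K hvσ) y).symm

/-- The invariant curve of `v` is irreducible with generic point `rayPoint`: in the chart of the
ray, the complement of the torus is the zero locus of a character that generates a prime ideal. -/
lemma rayCurve_eq_closure {v : Lattice} (hv : {v} ∈ Δ.cones) :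
    Δ.rayCurve K hv = closure {rayPoint K hv} := by
  apply subset_antisymm
  · refine closure_minimal ?_ isClosed_closure
    rintro _ ⟨⟨y, rfl⟩, hy⟩
    obtain ⟨m, hm⟩ := exists_dualMonoid_eq_one hv
    rw [mem_range_torus_iff K hv m hm, not_not] at hy
    rw [← specializes_iff_mem_closure,
      specializes_chart_iff K hv (Finset.mem_singleton_self v) hv]
    intro f hf
    rw [mem_facePrime_iff_dvd _ m hm (fun w hw h => absurd (Finset.mem_singleton.1 hw) h)] at hf
    exact Ideal.mem_of_dvd _ hf hy
  · refine closure_mono (Set.singleton_subset_iff.2 ⟨⟨_, rfl⟩, rayPoint_notMem_torus K hv⟩)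

lemma mem_rayCurve_iff {v : Lattice} (hv : {v} ∈ Δ.cones) (x : Δ.surface K) :
    x ∈ Δ.rayCurve K hv ↔ rayPoint K hv ⤳ x := by
  rw [rayCurve_eq_closure, specializes_iff_mem_closure]

lemma mem_of_chart_mem_rayCurve {σ : Finset Lattice} (hσ : σ ∈ Δ.cones) {v : Lattice}
    (hv : {v} ∈ Δ.cones) {y : Spec (CommRingCat.of (chartRing K σ))}
    (h : chart K hσ y ∈ Δ.rayCurve K hv) : v ∈ σ := by
  rw [mem_rayCurve_iff] at h
  exact (rayPoint_mem_range_iff K hσ hv).1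
    (h.mem_open (chart K hσ).isOpenEmbedding.isOpen_range ⟨y, rfl⟩)

lemma rayPoint_mem_rayCurve {v : Lattice} (hv : {v} ∈ Δ.cones) :
    rayPoint K hv ∈ Δ.rayCurve K hv :=
  (mem_rayCurve_iff K hv _).2 specializes_rfl

lemma rayCurve_injective {v w : Lattice} (hv : {v} ∈ Δ.cones) (hw : {w} ∈ Δ.cones)
    (h : Δ.rayCurve K hv = Δ.rayCurve K hw) : v = w := by
  have h1 : rayPoint K hv ∈ Δ.rayCurve K hw := h ▸ rayPoint_mem_rayCurve K hv
  exact (Finset.mem_singleton.1 (mem_of_chart_mem_rayCurve K hv hw h1)).symm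

/-- Two invariant curves meet if and only if their rays span a cone; they then meet in the closed
orbit of its chart. -/
lemma disjoint_rayCurve_iff {v w : Lattice} (hv : {v} ∈ Δ.cones) (hw : {w} ∈ Δ.cones) :
    Disjoint (Δ.rayCurve K hv) (Δ.rayCurve K hw) ↔ {v, w} ∉ Δ.cones := by
  constructor
  · intro hd hσ
    have hvσ : v ∈ ({v, w} : Finset Lattice) := by simp
    have hwσ : w ∈ ({v, w} : Finset Lattice) := by simp
    have h1 : chart K hσ (orbitPoint K subset_rfl) ∈ Δ.rayCurve K hv := by
      rw [mem_rayCurve_iff, specializes_chart_iff K hσ hvσ]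
      exact orbitPoint_anti subset_rfl (Finset.singleton_subset_iff.2 hvσ)
    have h2 : chart K hσ (orbitPoint K subset_rfl) ∈ Δ.rayCurve K hw := by
      rw [mem_rayCurve_iff, specializes_chart_iff K hσ hwσ]
      exact orbitPoint_anti subset_rfl (Finset.singleton_subset_iff.2 hwσ)
    exact Set.disjoint_left.1 hd h1 h2
  · intro h
    rw [Set.disjoint_left]
    intro x hx hx'
    obtain ⟨σ, hσ, y, rfl⟩ := exists_chart K x
    have h1 := mem_of_chart_mem_rayCurve K hσ hv hx
    have h2 := mem_of_chart_mem_rayCurve K hσ hw hx'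
    exact h (Δ.face_mem σ hσ _ (Finset.insert_subset h1 (Finset.singleton_subset_iff.2 h2)))

end Fan

/-! ### The conormal bundle of an invariant curve -/

lemma detPair_self (v : Lattice) : detPair v v = 0 := by
  simp [detPair]; ring

lemma detPair_swap (u v : Lattice) : detPair v u = -detPair u v := by
  simp [detPair]; ring

lemma detPair_add_left (u v w : Lattice) : detPair (u + v) w = detPair u w + detPair v w := by
  simp [detPair]; ring

lemma detPair_add_right (u v w : Lattice) : detPair w (u + v) = detPair w u + detPair w v := by
  simp [detPair]; ring

lemma detPair_smul_left (k : ℤ) (u w : Lattice) : detPair (k • u) w = k * detPair u w := by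
  simp [detPair]; ring

lemma detPair_smul_right (k : ℤ) (u w : Lattice) : detPair w (k • u) = k * detPair w u := by
  simp [detPair]; ring

lemma detPair_neg_left (u w : Lattice) : detPair (-u) w = -detPair u w := by
  simp [detPair]; ring

lemma detPair_neg_right (u w : Lattice) : detPair w (-u) = -detPair w u := by
  simp [detPair]; ring

/-- The character `x ↦ det (x, v)`. -/
def detChar (v : Lattice) : Lattice := ![v 1, -v 0]

lemma detChar_dotProduct (v x : Lattice) : detChar v ⬝ᵥ x = detPair x v := by
  simp [detChar, detPair, dotProduct, Fin.sum_univ_two]; ring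

/-- Cramer's rule. -/
lemma eq_of_dotProduct_eq {u v : Lattice} (h : detPair u v = 1) {m n : Lattice}
    (hu : m ⬝ᵥ u = n ⬝ᵥ u) (hv : m ⬝ᵥ v = n ⬝ᵥ v) : m = n := by
  simp only [dotProduct, Fin.sum_univ_two, detPair] at h hu hv
  ext i
  fin_cases i
  · simp only [Fin.zero_eta]
    linear_combination (m 0 - n 0) * (-h) + v 1 * hu - u 1 * hv
  · simp only [Fin.mk_one]
    linear_combination (m 1 - n 1) * (-h) - v 0 * hu + u 0 * hv

namespace Fan

variable (K : Type u) [Field K] {Δ : Fan}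

/-- The affine chart of a cone as an open subset of the surface. -/
noncomputable abbrev chartOpen {σ : Finset Lattice} (hσ : σ ∈ Δ.cones) : (Δ.surface K).Opens :=
  chart K hσ ''ᵁ ⊤

/-- A character as a function on an affine chart. -/
noncomputable def charFunction {σ : Finset Lattice} (hσ : σ ∈ Δ.cones) (m : dualMonoid σ) :
    Γ(Δ.surface K, chartOpen K hσ) :=
  chartFunction (chart K hσ) (AddMonoidAlgebra.single m (1 : K))

lemma mem_chartOpen_iff {σ : Finset Lattice} (hσ : σ ∈ Δ.cones) {x : Δ.surface K} :
    x ∈ chartOpen K hσ ↔ x ∈ Set.range (chart K hσ) :=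
  mem_chartOpen _

lemma chartOpen_mono {σ τ : Finset Lattice} (hσ : σ ∈ Δ.cones) (hτ : τ ∈ Δ.cones) (h : τ ⊆ σ) :
    chartOpen K hτ ≤ chartOpen K hσ := by
  intro x hx
  exact (mem_chartOpen_iff K hσ).2 (range_chart_mono K hσ hτ h ((mem_chartOpen_iff K hτ).1 hx))

lemma chartOpen_inf {σ τ κ : Finset Lattice} (hσ : σ ∈ Δ.cones) (hτ : τ ∈ Δ.cones)
    (hκ : κ ∈ Δ.cones) (h : σ ∩ τ = κ) :
    chartOpen K hσ ⊓ chartOpen K hτ = chartOpen K hκ := by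
  subst h
  ext x
  have := range_chart_inter K hσ hτ hκ
  exact ((mem_chartOpen_iff K hσ).and (mem_chartOpen_iff K hτ)).trans
    ((Set.ext_iff.1 this x).trans (mem_chartOpen_iff K hκ).symm)

lemma charFunction_restrict {σ τ : Finset Lattice} (hσ : σ ∈ Δ.cones) (hτ : τ ∈ Δ.cones)
    (h : τ ⊆ σ) (m : dualMonoid σ) :
    (Δ.surface K).presheaf.map (homOfLE (chartOpen_mono K hσ hτ h)).op (charFunction K hσ m) =
      charFunction K hτ ⟨m.1, dualMonoid_anti h m.2⟩ := by
  have := chartFunction_restrict (chart K hσ) (chart K hτ) _ (chart_comp K hσ hτ h)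
    (chartOpen_mono K hσ hτ h) (AddMonoidAlgebra.single m (1 : K))
  refine this.trans ?_
  rw [charFunction]
  congr 1
  exact chartRingMap_single K h m 1

lemma charFunction_add {σ : Finset Lattice} (hσ : σ ∈ Δ.cones) (m n : dualMonoid σ) :
    charFunction K hσ (m + n) = charFunction K hσ m * charFunction K hσ n := by
  rw [charFunction, charFunction, charFunction, ← map_mul, AddMonoidAlgebra.single_mul_single,
    one_mul]

lemma charFunction_zero {σ : Finset Lattice} (hσ : σ ∈ Δ.cones) :
    charFunction K hσ 0 = 1 := by
  rw [charFunction, ← AddMonoidAlgebra.one_def, map_one]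

lemma vanishesOn_chartFunction_iff {σ : Finset Lattice} (hσ : σ ∈ Δ.cones) {v : Lattice}
    (hv : {v} ∈ Δ.cones) (hvσ : v ∈ σ) (f : chartRing K σ) :
    VanishesOn (Δ.rayCurve K hv) (chartFunction (chart K hσ) f) ↔ f ∈ facePrime K hvσ := by
  rw [vanishesOn_iff_notMem (rayCurve_eq_closure K hv), ← chart_facePoint K hσ hvσ hv,
    mem_basicOpen_chartFunction, not_not]

lemma basicOpen_charFunction {σ τ : Finset Lattice} (hσ : σ ∈ Δ.cones) (hτ : τ ∈ Δ.cones)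
    (h : τ ⊆ σ) (m : dualMonoid σ) (h0 : ∀ v ∈ τ, m.1 ⬝ᵥ v = 0)
    (h1 : ∀ v ∈ σ, v ∉ τ → 0 < m.1 ⬝ᵥ v) :
    (Δ.surface K).basicOpen (charFunction K hσ m) = chartOpen K hτ := by
  ext x
  change x ∈ (Δ.surface K).basicOpen (charFunction K hσ m) ↔ x ∈ chartOpen K hτ
  have key : ∀ y, chart K hσ y ∈ (Δ.surface K).basicOpen (charFunction K hσ m) ↔
      chart K hσ y ∈ chartOpen K hτ := by
    intro y
    rw [mem_chartOpen_iff, mem_range_chart_iff K hσ hτ h m h0 h1]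
    exact mem_basicOpen_chartFunction (chart K hσ) (AddMonoidAlgebra.single m (1 : K)) y
  constructor
  · intro hx
    obtain ⟨y, rfl⟩ := (mem_chartOpen_iff K hσ).1 ((Δ.surface K).basicOpen_le _ hx)
    exact (key y).1 hx
  · intro hx
    obtain ⟨y, rfl⟩ := (mem_chartOpen_iff K hσ).1 (chartOpen_mono K hσ hτ h hx)
    exact (key y).2 hx

/-- The part of the invariant curve of `v` in the chart of the cone generated by `u` and `v` is
an affine line. -/
lemma isAffineLine_chart {σ : Finset Lattice} (hσ : σ ∈ Δ.cones) {u v : Lattice}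
    (huσ : u ∈ σ) (hvσ : v ∈ σ) (hσuv : σ ⊆ {u, v}) (hv : {v} ∈ Δ.cones)
    (hdet : detPair u v = 1 ∨ detPair v u = 1)
    (m n : dualMonoid σ) (hmu : m.1 ⬝ᵥ u = 1) (hmv : m.1 ⬝ᵥ v = 0) (hnu : n.1 ⬝ᵥ u = 0)
    (hnv : n.1 ⬝ᵥ v = 1) :
    IsAffineLine (Δ.str K) (Δ.rayCurve K hv) (charFunction K hσ m) (charFunction K hσ n) where
  affine := by
    rw [chartOpen, Scheme.Hom.image_top_eq_opensRange]
    exact isAffineOpen_opensRange _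
  generates := by
    intro h
    obtain ⟨f, rfl⟩ := (chartFunction_bijective (chart K hσ)).2 h
    rw [vanishesOn_chartFunction_iff K hσ hv hvσ, mem_facePrime_iff_dvd hvσ n hnv]
    · constructor
      · rintro ⟨g, rfl⟩
        rw [map_mul]
        exact dvd_mul_right _ _
      · rintro ⟨g, hg⟩
        obtain ⟨g, rfl⟩ := (chartFunction_bijective (chart K hσ)).2 g
        refine ⟨g, (chartFunction_bijective (chart K hσ)).1 ?_⟩
        rw [hg, map_mul]
        rfl
    · intro w hw hwv
      have := hσuv hw
      simp only [Finset.mem_insert, Finset.mem_singleton, hwv, or_false] at this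
      rw [this, hnu]
  coordinate := by
    intro h
    obtain ⟨f, rfl⟩ := (chartFunction_bijective (chart K hσ)).2 h
    have key : ∀ p : Polynomial K, chartFunction (chart K hσ) f -
        p.eval₂ (scalars (Δ.str K) (chartOpen K hσ)) (charFunction K hσ m) =
        chartFunction (chart K hσ) (f - p.eval₂ (algebraMap K (chartRing K σ))
          (AddMonoidAlgebra.single m 1)) := by
      intro p
      rw [map_sub, Polynomial.hom_eval₂]
      congr 2
      ext k
      exact chartFunction_scalars (chart K hσ) (Δ.str K) _ (chart_str K hσ) k
    simp only [key, vanishesOn_chartFunction_iff K hσ hv hvσ]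
    have hm0 : m ≠ 0 := by
      rintro rfl
      simp at hmu
    refine existsUnique_polynomial hvσ m hm0 hmv ?_ f
    intro l hl
    have hlu := l.2 u huσ
    refine ⟨(l.1 ⬝ᵥ u).toNat, Subtype.ext ?_⟩
    have h1 : l.1 ⬝ᵥ u = ((l.1 ⬝ᵥ u).toNat • m.1) ⬝ᵥ u := by
      rw [smul_dotProduct, hmu, nsmul_eq_mul, mul_one, Int.toNat_of_nonneg hlu]
    have h2 : l.1 ⬝ᵥ v = ((l.1 ⬝ᵥ u).toNat • m.1) ⬝ᵥ v := by
      rw [smul_dotProduct, hmv, hl, smul_zero]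
    rcases hdet with h | h
    · exact eq_of_dotProduct_eq h h1 h2
    · exact eq_of_dotProduct_eq h h2 h1

end Fan

/-! ### The self-intersection number of an invariant curve -/

namespace Fan

/-- The neighbours `u` and `w` of a ray `v` of the fan, where `u`, `v`, `w` are in counterclockwise
order, and the number `a` with `u + w = a v`; the self-intersection number of the curve of `v` is
`-a`. -/
structure Star (Δ : Fan) (u v w : Lattice) (a : ℤ) : Prop where
  left_mem : {u, v} ∈ Δ.cones
  right_mem : {v, w} ∈ Δ.cones
  det_left : detPair u v = 1
  det_right : detPair v w = 1
  add_eq : u + w = a • v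
  /-- no other cone of the fan contains `v` -/
  subset : ∀ σ ∈ Δ.cones, v ∈ σ → σ ⊆ {u, v} ∨ σ ⊆ {v, w}

namespace Star

variable (K : Type u) [Field K] {Δ : Fan} {u v w : Lattice} {a : ℤ}

lemma mem (S : Δ.Star u v w a) : {v} ∈ Δ.cones :=
  Δ.face_mem _ S.left_mem _ (by simp)

lemma eq_sub (S : Δ.Star u v w a) : w = a • v - u := by
  rw [← S.add_eq]; abel

lemma det_eq (S : Δ.Star u v w a) : detPair u w = a := by
  rw [S.eq_sub, sub_eq_add_neg, detPair_add_right, detPair_smul_right, detPair_neg_right,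
    detPair_self, S.det_left]
  ring

lemma detChar_eq (S : Δ.Star u v w a) : detChar w = a • detChar v + -detChar u := by
  rw [S.eq_sub]
  ext i
  fin_cases i <;> simp [detChar] <;> ring

/-- The coordinate on the invariant curve in the chart of `u` and `v`. -/
def coordLeft (S : Δ.Star u v w a) : dualMonoid {u, v} :=
  ⟨detChar v, by
    intro x hx
    rw [detChar_dotProduct]
    rcases Finset.mem_insert.1 hx with rfl | hx
    · rw [S.det_left]; exact zero_le_one
    · rw [Finset.mem_singleton.1 hx, detPair_self]⟩

/-- The equation of the invariant curve in the chart of `u` and `v`. -/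
def equationLeft (S : Δ.Star u v w a) : dualMonoid {u, v} :=
  ⟨-detChar u, by
    intro x hx
    rw [neg_dotProduct, detChar_dotProduct, detPair_swap, neg_neg]
    rcases Finset.mem_insert.1 hx with rfl | hx
    · rw [detPair_self]
    · rw [Finset.mem_singleton.1 hx, S.det_left]; exact zero_le_one⟩

/-- The coordinate on the invariant curve in the chart of `v` and `w`. -/
def coordRight (S : Δ.Star u v w a) : dualMonoid {v, w} :=
  ⟨-detChar v, by
    intro x hx
    rw [neg_dotProduct, detChar_dotProduct, detPair_swap, neg_neg]
    rcases Finset.mem_insert.1 hx with rfl | hx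
    · rw [detPair_self]
    · rw [Finset.mem_singleton.1 hx, S.det_right]; exact zero_le_one⟩

/-- The equation of the invariant curve in the chart of `v` and `w`. -/
def equationRight (S : Δ.Star u v w a) : dualMonoid {v, w} :=
  ⟨detChar w, by
    intro x hx
    rw [detChar_dotProduct]
    rcases Finset.mem_insert.1 hx with rfl | hx
    · rw [S.det_right]; exact zero_le_one
    · rw [Finset.mem_singleton.1 hx, detPair_self]⟩

/-- A power of the coordinate on the invariant curve, as a function on the chart of `v`. -/
def coordPow (v : Lattice) (k : ℤ) : dualMonoid {v} :=
  ⟨k • detChar v, by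
    intro x hx
    rw [Finset.mem_singleton.1 hx, smul_dotProduct, detChar_dotProduct, detPair_self, smul_zero]⟩

lemma isAffineLine_left (S : Δ.Star u v w a) :
    IsAffineLine (Δ.str K) (Δ.rayCurve K S.mem) (charFunction K S.left_mem S.coordLeft)
      (charFunction K S.left_mem S.equationLeft) :=
  isAffineLine_chart K S.left_mem (u := u) (by simp) (by simp) subset_rfl S.mem (.inl S.det_left)
    _ _ ((detChar_dotProduct _ _).trans S.det_left)
    ((detChar_dotProduct _ _).trans (detPair_self v))
    (by simp only [equationLeft, neg_dotProduct, detChar_dotProduct, detPair_self, neg_zero])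
    (by simp only [equationLeft, neg_dotProduct, detChar_dotProduct, detPair_swap u v, neg_neg,
      S.det_left])

lemma isAffineLine_right (S : Δ.Star u v w a) :
    IsAffineLine (Δ.str K) (Δ.rayCurve K S.mem) (charFunction K S.right_mem S.coordRight)
      (charFunction K S.right_mem S.equationRight) :=
  isAffineLine_chart K S.right_mem (u := w) (by simp) (by simp) (Finset.pair_comm v w).subset
    S.mem (.inr S.det_right) _ _
    (by simp only [coordRight, neg_dotProduct, detChar_dotProduct, detPair_swap v w, neg_neg,
      S.det_right])
    (by simp only [coordRight, neg_dotProduct, detChar_dotProduct, detPair_self, neg_zero])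
    ((detChar_dotProduct _ _).trans (detPair_self w))
    ((detChar_dotProduct _ _).trans S.det_right)

lemma singleton_subset_left : ({v} : Finset Lattice) ⊆ {u, v} := by simp

lemma singleton_subset_right : ({v} : Finset Lattice) ⊆ {v, w} := by simp

lemma restrict_coordLeft (S : Δ.Star u v w a) :
    (Δ.surface K).presheaf.map
      (homOfLE (chartOpen_mono K S.left_mem S.mem singleton_subset_left)).op
      (charFunction K S.left_mem S.coordLeft) = charFunction K S.mem (coordPow v 1) := by
  rw [charFunction_restrict K S.left_mem S.mem singleton_subset_left]
  congr 1
  exact Subtype.ext (one_smul ℤ _).symm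

lemma restrict_coordRight (S : Δ.Star u v w a) :
    (Δ.surface K).presheaf.map
      (homOfLE (chartOpen_mono K S.right_mem S.mem singleton_subset_right)).op
      (charFunction K S.right_mem S.coordRight) = charFunction K S.mem (coordPow v (-1)) := by
  rw [charFunction_restrict K S.right_mem S.mem singleton_subset_right]
  congr 1
  exact Subtype.ext (neg_one_smul ℤ _).symm

lemma charFunction_coordPow_add (hv : {v} ∈ Δ.cones) (k l : ℤ) :
    charFunction K hv (coordPow v (k + l)) =
      charFunction K hv (coordPow v k) * charFunction K hv (coordPow v l) := by
  rw [← charFunction_add]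
  congr 1
  exact Subtype.ext (add_smul k l _)

lemma charFunction_coordPow_zero (hv : {v} ∈ Δ.cones) :
    charFunction K hv (coordPow v 0) = 1 := by
  rw [← charFunction_zero]
  congr 1
  exact Subtype.ext (zero_smul ℤ _)

/-- The transition function of the conormal bundle is `x ^ a`. -/
lemma restrict_equation (S : Δ.Star u v w a) :
    (Δ.surface K).presheaf.map
      (homOfLE (chartOpen_mono K S.right_mem S.mem singleton_subset_right)).op
      (charFunction K S.right_mem S.equationRight) =
    charFunction K S.mem (coordPow v a) * (Δ.surface K).presheaf.map
      (homOfLE (chartOpen_mono K S.left_mem S.mem singleton_subset_left)).op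
      (charFunction K S.left_mem S.equationLeft) := by
  rw [charFunction_restrict K S.right_mem S.mem singleton_subset_right,
    charFunction_restrict K S.left_mem S.mem singleton_subset_left, ← charFunction_add]
  congr 1
  exact Subtype.ext S.detChar_eq

lemma cover (S : Δ.Star u v w a) : Δ.rayCurve K S.mem ⊆
    (chartOpen K S.left_mem : Set (Δ.surface K)) ∪ chartOpen K S.right_mem := by
  intro x hx
  obtain ⟨σ, hσ, y, rfl⟩ := exists_chart K x
  have hvσ := mem_of_chart_mem_rayCurve K hσ S.mem hx
  rcases S.subset σ hσ hvσ with h | h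
  · exact Or.inl ((mem_chartOpen_iff K _).2 (range_chart_mono K S.left_mem hσ h ⟨y, rfl⟩))
  · exact Or.inr ((mem_chartOpen_iff K _).2 (range_chart_mono K S.right_mem hσ h ⟨y, rfl⟩))

lemma pair_inter (S : Δ.Star u v w a) : ({u, v} : Finset Lattice) ∩ {v, w} = {v} := by
  have huv : u ≠ v := by
    rintro rfl
    have := S.det_left
    rw [detPair_self] at this
    exact zero_ne_one this
  have huw : u = w → False := by
    rintro rfl
    have h1 := S.det_right
    rw [detPair_swap, S.det_left] at h1
    norm_num at h1
  ext x
  simp only [Finset.mem_inter, Finset.mem_insert, Finset.mem_singleton]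
  constructor
  · rintro ⟨rfl | rfl, h⟩
    · rcases h with h | h
      · exact h
      · exact (huw h).elim
    · rfl
  · rintro rfl
    exact ⟨.inr rfl, .inl rfl⟩

lemma chartOpen_inf_eq (S : Δ.Star u v w a) :
    chartOpen K S.left_mem ⊓ chartOpen K S.right_mem = chartOpen K S.mem :=
  chartOpen_inf K _ _ _ S.pair_inter

lemma basicOpen_coordLeft (S : Δ.Star u v w a) :
    (Δ.surface K).basicOpen (charFunction K S.left_mem S.coordLeft) = chartOpen K S.mem := by
  refine basicOpen_charFunction K _ _ singleton_subset_left _ ?_ ?_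
  · intro x hx
    rw [Finset.mem_singleton.1 hx]
    exact (detChar_dotProduct _ _).trans (detPair_self v)
  · intro x hx hxv
    rcases Finset.mem_insert.1 hx with rfl | hx
    · refine lt_of_lt_of_eq one_pos ((detChar_dotProduct _ _).trans S.det_left).symm
    · exact absurd hx hxv

lemma basicOpen_coordRight (S : Δ.Star u v w a) :
    (Δ.surface K).basicOpen (charFunction K S.right_mem S.coordRight) = chartOpen K S.mem := by
  refine basicOpen_charFunction K _ _ singleton_subset_right _ ?_ ?_
  · intro x hx
    rw [Finset.mem_singleton.1 hx]
    simp only [coordRight, neg_dotProduct, detChar_dotProduct, detPair_self, neg_zero]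
  · intro x hx hxv
    rcases Finset.mem_insert.1 hx with rfl | hx
    · exact absurd (Finset.mem_singleton_self _) hxv
    · rw [Finset.mem_singleton.1 hx]
      simp only [coordRight, neg_dotProduct, detChar_dotProduct, detPair_swap v w, neg_neg,
        S.det_right]
      exact one_pos

lemma isNegOneCurve (S : Δ.Star u v w 1) : IsNegOneCurve (Δ.str K) (Δ.rayCurve K S.mem) := by
  have hle : chartOpen K S.left_mem ⊓ chartOpen K S.right_mem ≤ chartOpen K S.mem :=
    (S.chartOpen_inf_eq K).le
  let res : Γ(Δ.surface K, chartOpen K S.mem) ⟶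
      Γ(Δ.surface K, chartOpen K S.left_mem ⊓ chartOpen K S.right_mem) :=
    (Δ.surface K).presheaf.map (homOfLE hle).op
  have hl : ∀ f : Γ(Δ.surface K, chartOpen K S.left_mem),
      f |_ (chartOpen K S.left_mem ⊓ chartOpen K S.right_mem) = res
        ((Δ.surface K).presheaf.map
        (homOfLE (chartOpen_mono K S.left_mem S.mem singleton_subset_left)).op f) := by
    intro f
    rw [← CommRingCat.comp_apply, ← Functor.map_comp]
    rfl
  have hr : ∀ f : Γ(Δ.surface K, chartOpen K S.right_mem),
      f |_ (chartOpen K S.left_mem ⊓ chartOpen K S.right_mem) = res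
        ((Δ.surface K).presheaf.map
        (homOfLE (chartOpen_mono K S.right_mem S.mem singleton_subset_right)).op f) := by
    intro f
    rw [← CommRingCat.comp_apply, ← Functor.map_comp]
    rfl
  have h0 : ∀ {V : (Δ.surface K).Opens},
      VanishesOn (Δ.rayCurve K S.mem) (0 : Γ(Δ.surface K, V)) := by
    intro V
    rw [VanishesOn, Scheme.basicOpen_zero]
    exact Set.disjoint_empty _
  refine ⟨isClosed_closure, chartOpen K S.left_mem, chartOpen K S.right_mem,
    charFunction K S.left_mem S.coordLeft, charFunction K S.left_mem S.equationLeft,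
    charFunction K S.right_mem S.coordRight, charFunction K S.right_mem S.equationRight,
    res (charFunction K S.mem (coordPow v 1)), S.cover K, S.isAffineLine_left K,
    S.isAffineLine_right K, ?_, ?_, ?_, ?_, ?_⟩
  · rw [S.basicOpen_coordLeft K, S.chartOpen_inf_eq K]
  · rw [S.basicOpen_coordRight K, S.chartOpen_inf_eq K]
  · rw [hl, hr, S.restrict_coordLeft K, S.restrict_coordRight K, ← map_mul,
      ← charFunction_coordPow_add, add_neg_cancel, charFunction_coordPow_zero, map_one, sub_self]
    exact h0
  · rw [hl, hr, S.restrict_equation K, map_mul]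
  · rw [hl, S.restrict_coordLeft K, sub_self]
    exact h0

/-- The conormal bundle of the invariant curve of `v` has degree `a`, where `u + w = a v`: the two
equations of the curve are characters which differ by the `a`-th power of the coordinate. -/
lemma conormalPresentation (S : Δ.Star u v w a) :
    ConormalPresentation (Δ.str K) (Δ.rayCurve K S.mem) (rayPoint K S.mem) a
      (charFunction K S.left_mem S.coordLeft) (charFunction K S.left_mem S.equationLeft)
      (charFunction K S.right_mem S.coordRight) (charFunction K S.right_mem S.equationRight) := by
  have hE := rayCurve_eq_closure K S.mem
  have h0 := (S.isAffineLine_left K).generic_mem hE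
  have h1 := (S.isAffineLine_right K).generic_mem hE
  have hη : rayPoint K S.mem ∈ chartOpen K S.mem :=
    (mem_chartOpen_iff K S.mem).2 ⟨_, rfl⟩
  have gl : ∀ f : Γ(Δ.surface K, chartOpen K S.left_mem),
      (Δ.surface K).presheaf.germ _ _ h0 f = (Δ.surface K).presheaf.germ _ _ hη
        ((Δ.surface K).presheaf.map
        (homOfLE (chartOpen_mono K S.left_mem S.mem singleton_subset_left)).op f) := fun f =>
    ((Δ.surface K).presheaf.germ_res_apply _ _ hη f).symm
  have gr : ∀ f : Γ(Δ.surface K, chartOpen K S.right_mem),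
      (Δ.surface K).presheaf.germ _ _ h1 f = (Δ.surface K).presheaf.germ _ _ hη
        ((Δ.surface K).presheaf.map
        (homOfLE (chartOpen_mono K S.right_mem S.mem singleton_subset_right)).op f) := fun f =>
    ((Δ.surface K).presheaf.germ_res_apply _ _ hη f).symm
  let χ : ℤ → (Δ.surface K).residueField (rayPoint K S.mem) := fun k =>
    valueAt _ hη (charFunction K S.mem (coordPow v k))
  have hχ0 : χ 0 = 1 := by
    simp only [χ]
    rw [charFunction_coordPow_zero, map_one]
  have hχa : ∀ k l, χ (k + l) = χ k * χ l := by
    intro k l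
    simp only [χ]
    rw [charFunction_coordPow_add, map_mul]
  have hx0 : valueAt _ h0 (charFunction K S.left_mem S.coordLeft) = χ 1 := by
    change (Δ.surface K).residue _ ((Δ.surface K).presheaf.germ _ _ h0 _) = _
    rw [gl, S.restrict_coordLeft K]
    rfl
  have hx1 : valueAt _ h1 (charFunction K S.right_mem S.coordRight) = χ (-1) := by
    change (Δ.surface K).residue _ ((Δ.surface K).presheaf.germ _ _ h1 _) = _
    rw [gr, S.restrict_coordRight K]
    rfl
  have hχn : ∀ n : ℕ, χ n = χ 1 ^ n := by
    intro n
    induction n with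
    | zero => simpa using hχ0
    | succ n ih => rw [Nat.cast_succ, hχa, ih, pow_succ]
  have hχz : ∀ k : ℤ, χ k = χ 1 ^ k := by
    intro k
    obtain ⟨n, rfl | rfl⟩ := k.eq_nat_or_neg
    · rw [hχn, zpow_natCast]
    · rw [zpow_neg, zpow_natCast, ← hχn]
      exact eq_inv_of_mul_eq_one_left (by rw [← hχa, neg_add_cancel, hχ0])
  refine ⟨S.cover K, S.isAffineLine_left K, S.isAffineLine_right K, h0, h1, ?_, ?_⟩
  · rw [hx0, hx1, ← hχa, add_neg_cancel, hχ0]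
  · refine ⟨(Δ.surface K).presheaf.germ _ _ hη (charFunction K S.mem (coordPow v a)), ?_, ?_⟩
    · rw [gr, gl, S.restrict_equation K, map_mul]
    · rw [hx0, ← hχz]
      rfl

/-- The invariant curve of `v` is a `(-1)`-curve if and only if `v` is the sum of its neighbours.
Any presentation as a `(-1)`-curve is compared with the presentation by characters. -/
lemma isNegOneCurve_iff (S : Δ.Star u v w a) :
    IsNegOneCurve (Δ.str K) (Δ.rayCurve K S.mem) ↔ a = 1 := by
  constructor
  · rintro ⟨-, V₀, V₁, x₀, f₀, x₁, f₁, t, hcov, L₀, L₁, -, -, hx, hf, ht⟩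
    have hE := rayCurve_eq_closure K S.mem
    have h0 := L₀.generic_mem hE
    have h1 := L₁.generic_mem hE
    have hη : rayPoint K S.mem ∈ V₀ ⊓ V₁ := ⟨h0, h1⟩
    have : IsDomain ((Δ.surface K).presheaf.stalk (rayPoint K S.mem)) :=
      isDomain_stalk_of_chart (chart K S.mem) _
    have gl : ∀ f : Γ(Δ.surface K, V₀), (Δ.surface K).presheaf.germ _ _ hη (f |_ (V₀ ⊓ V₁)) =
        (Δ.surface K).presheaf.germ _ _ h0 f := fun f =>
      (Δ.surface K).presheaf.germ_res_apply _ _ hη f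
    have gr : ∀ f : Γ(Δ.surface K, V₁), (Δ.surface K).presheaf.germ _ _ hη (f |_ (V₀ ⊓ V₁)) =
        (Δ.surface K).presheaf.germ _ _ h1 f := fun f =>
      (Δ.surface K).presheaf.germ_res_apply _ _ hη f
    have C' : ConormalPresentation (Δ.str K) (Δ.rayCurve K S.mem) (rayPoint K S.mem) 1
        x₀ f₀ x₁ f₁ := by
      refine ⟨hcov, L₀, L₁, h0, h1, ?_, (Δ.surface K).presheaf.germ _ _ hη t, ?_, ?_⟩
      · rw [vanishesOn_iff_valueAt hE hη, map_sub, map_mul, map_one, sub_eq_zero] at hx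
        rw [← hx]
        change (Δ.surface K).residue _ _ * (Δ.surface K).residue _ _ =
          (Δ.surface K).residue _ ((Δ.surface K).presheaf.germ _ _ hη (x₀ |_ (V₀ ⊓ V₁))) *
          (Δ.surface K).residue _ ((Δ.surface K).presheaf.germ _ _ hη (x₁ |_ (V₀ ⊓ V₁)))
        rw [gl, gr]
      · rw [← gl, ← gr, hf, map_mul]
      · rw [vanishesOn_iff_valueAt hE hη, map_sub, sub_eq_zero] at ht
        rw [zpow_one]
        refine ht.trans ?_
        change (Δ.surface K).residue _ ((Δ.surface K).presheaf.germ _ _ hη (x₀ |_ (V₀ ⊓ V₁))) = _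
        rw [gl]
        rfl
    have C := S.conormalPresentation K
    refine C.degree_eq_one hE ?_ C'
    exact germ_chartFunction_ne_zero (R := CommRingCat.of (chartRing K {u, v}))
      (chart K S.left_mem) C.mem₀ (AddMonoidAlgebra.single_ne_zero.2 one_ne_zero)
  · rintro rfl
    exact S.isNegOneCurve K

end Star

end Fan

/-! ### Toric morphisms -/

lemma mulVec_inv_mulVec (g : GL2Z) (v : Lattice) : g.1.mulVec (g⁻¹.1.mulVec v) = v := by
  rw [Matrix.mulVec_mulVec, ← Units.val_mul, mul_inv_cancel, Units.val_one, Matrix.one_mulVec]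

lemma inv_mulVec_mulVec (g : GL2Z) (v : Lattice) : g⁻¹.1.mulVec (g.1.mulVec v) = v := by
  rw [Matrix.mulVec_mulVec, ← Units.val_mul, inv_mul_cancel, Units.val_one, Matrix.one_mulVec]

lemma mulVec_injective (g : GL2Z) : Function.Injective fun v : Lattice => g.1.mulVec v :=
  Function.LeftInverse.injective (g := fun v => g⁻¹.1.mulVec v) (inv_mulVec_mulVec g)

section ToricMorphisms

variable (K : Type u) [Field K]

lemma chartHom_comp (g h : GL2Z) {σ τ ρ : Finset Lattice} (hσ : ∀ v ∈ σ, g.1.mulVec v ∈ τ)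
    (hτ : ∀ v ∈ τ, h.1.mulVec v ∈ ρ) (hσρ : ∀ v ∈ σ, (h * g).1.mulVec v ∈ ρ) :
    chartHom K g hσ ≫ chartHom K h hτ = chartHom K (h * g) hσρ := by
  rw [chartHom, chartHom, chartHom, ← Spec.map_comp]
  congr 1
  ext1
  refine (AddMonoidAlgebra.mapDomainRingHom_comp (R := K)
    (dualMap g hσ) (dualMap h hτ)).symm.trans ?_
  congr 1
  ext m : 2
  change Matrix.vecMul (Matrix.vecMul m.1 h.1) g.1 = Matrix.vecMul m.1 (h * g).1
  rw [Matrix.vecMul_vecMul]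
  rfl

lemma chartHom_eq_of_eq_one {g : GL2Z} (hg : g = 1) {σ τ : Finset Lattice} (h : τ ⊆ σ)
    (hτ : ∀ v ∈ τ, g.1.mulVec v ∈ σ) :
    chartHom K g hτ = Spec.map (CommRingCat.ofHom (chartRingMap K h).toRingHom) := by
  subst hg
  rw [chartHom]
  congr 2
  have : dualMap 1 hτ = AddSubmonoid.inclusion (dualMonoid_anti h) := by
    ext m : 2
    exact Matrix.vecMul_one m.1
  rw [this]
  rfl

namespace Fan

variable {Δ Δ' : Fan}

/-- The morphism induced by `g` from the chart of `σ` to the surface does not depend on the choice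
of a cone that contains the image of `σ`. -/
lemma chartHom_chart_eq (g : GL2Z) {σ τ τ' : Finset Lattice} (h : ∀ v ∈ σ, g.1.mulVec v ∈ τ)
    (h' : ∀ v ∈ σ, g.1.mulVec v ∈ τ') (hτ : τ ∈ Δ.cones) (hτ' : τ' ∈ Δ.cones) :
    chartHom K g h ≫ chart K hτ = chartHom K g h' ≫ chart K hτ' := by
  have key : ∀ {τ₁ τ₂ : Finset Lattice} (h₁ : ∀ v ∈ σ, g.1.mulVec v ∈ τ₁)
      (h₂ : ∀ v ∈ σ, g.1.mulVec v ∈ τ₂) (H₁ : τ₁ ∈ Δ.cones) (H₂ : τ₂ ∈ Δ.cones), τ₁ ⊆ τ₂ →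
      chartHom K g h₂ ≫ chart K H₂ = chartHom K g h₁ ≫ chart K H₁ := by
    intro τ₁ τ₂ h₁ h₂ H₁ H₂ hs
    rw [← chart_comp K H₂ H₁ hs, ← Category.assoc, ← chartHom_naturality K g h₂ h₁ subset_rfl hs]
    rw [← chartHom_eq_of_eq_one K rfl subset_rfl (fun v hv => by simpa using hv),
      chartHom_comp K _ _ _ _ (by simpa using h₂)]
    simp only [mul_one]
  have hκ : τ ∩ τ' ∈ Δ.cones := Δ.face_mem τ hτ _ Finset.inter_subset_left
  have hh : ∀ v ∈ σ, g.1.mulVec v ∈ τ ∩ τ' := fun v hv => Finset.mem_inter.2 ⟨h v hv, h' v hv⟩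
  rw [key hh h hκ hτ Finset.inter_subset_left, key hh h' hκ hτ' Finset.inter_subset_right]

lemma chart_toricHom {g : GL2Z} (hg : MapsTo g Δ Δ') {σ τ : Finset Lattice} (hσ : σ ∈ Δ.cones)
    (hτ : τ ∈ Δ'.cones) (h : ∀ v ∈ σ, g.1.mulVec v ∈ τ) :
    chart K hσ ≫ toricHom K hg = chartHom K g h ≫ chart K hτ := by
  have : chart K hσ ≫ toricHom K hg =
      chartHom K g (fun _ hv => Finset.mem_image_of_mem _ hv) ≫ chart K (hg σ hσ) :=
    colimit.ι_desc _ _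
  rw [this]
  exact chartHom_chart_eq K g _ _ _ _

lemma surface_hom_ext {Z : Scheme.{u}} {f g : Δ.surface K ⟶ Z}
    (h : ∀ (σ : Finset Lattice) (hσ : σ ∈ Δ.cones), chart K hσ ≫ f = chart K hσ ≫ g) : f = g :=
  colimit.hom_ext fun σ => h σ.1 σ.2

lemma toricHom_comp_eq_id {g h : GL2Z} (hg : MapsTo g Δ Δ') (hh : MapsTo h Δ' Δ)
    (e : h * g = 1) : toricHom K hg ≫ toricHom K hh = 𝟙 _ := by
  refine surface_hom_ext K fun σ hσ => ?_
  have h1 : ∀ v ∈ σ, g.1.mulVec v ∈ σ.image (fun v => g.1.mulVec v) :=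
    fun v hv => Finset.mem_image_of_mem _ hv
  have h2 : ∀ v ∈ σ.image (fun v => g.1.mulVec v), h.1.mulVec v ∈ σ := by
    intro v hv
    obtain ⟨w, hw, rfl⟩ := Finset.mem_image.1 hv
    rw [Matrix.mulVec_mulVec, ← Units.val_mul, e, Units.val_one, Matrix.one_mulVec]
    exact hw
  have h3 : ∀ v ∈ σ, (h * g).1.mulVec v ∈ σ := by
    intro v hv
    rw [e, Units.val_one, Matrix.one_mulVec]
    exact hv
  rw [← Category.assoc, chart_toricHom K hg hσ (hg σ hσ) h1, Category.assoc,
    chart_toricHom K hh (hg σ hσ) hσ h2, ← Category.assoc, chartHom_comp K g h h1 h2 h3,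
    chartHom_eq_of_eq_one K e subset_rfl, chart_comp, Category.comp_id]

/-- The isomorphism of surfaces induced by an isomorphism of fans. -/
noncomputable def surfaceIso {g : GL2Z} (hg : MapsTo g Δ Δ') (hg' : MapsTo g⁻¹ Δ' Δ) :
    Δ.surface K ≅ Δ'.surface K where
  hom := toricHom K hg
  inv := toricHom K hg'
  hom_inv_id := toricHom_comp_eq_id K hg hg' (inv_mul_cancel g)
  inv_hom_id := toricHom_comp_eq_id K hg' hg (mul_inv_cancel g)

lemma toricHom_str {g : GL2Z} (hg : MapsTo g Δ Δ') :
    toricHom K hg ≫ Δ'.str K = Δ.str K := by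
  refine surface_hom_ext K fun σ hσ => ?_
  rw [← Category.assoc, chart_toricHom K hg hσ (hg σ hσ) (fun v hv => Finset.mem_image_of_mem _ hv),
    Category.assoc, chart_str, chart_str, chartHom, ← Spec.map_comp]
  congr 1
  ext k : 2
  change AddMonoidAlgebra.mapDomain _ (algebraMap K _ k) = algebraMap K _ k
  simp [AddMonoidAlgebra.coe_algebraMap]

lemma toricIso_of_mapsTo {g : GL2Z} (hg : MapsTo g Δ Δ') (hg' : MapsTo g⁻¹ Δ' Δ) :
    ToricIso K Δ Δ' :=
  ⟨surfaceIso K hg hg', g, toricHom_str K hg, chart_toricHom K hg Δ.empty_mem Δ'.empty_mem _⟩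

lemma toricHom_image_range {g : GL2Z} (hg : MapsTo g Δ Δ') (hg' : MapsTo g⁻¹ Δ' Δ)
    {σ τ : Finset Lattice} (hσ : σ ∈ Δ.cones) (hτ : τ ∈ Δ'.cones)
    (h : σ.image (fun v => g.1.mulVec v) = τ) :
    toricHom K hg '' Set.range (chart K hσ) = Set.range (chart K hτ) := by
  subst h
  have h1 : ∀ v ∈ σ, g.1.mulVec v ∈ σ.image (fun v => g.1.mulVec v) :=
    fun v hv => Finset.mem_image_of_mem _ hv
  have h2 : ∀ v ∈ σ.image (fun v => g.1.mulVec v), g⁻¹.1.mulVec v ∈ σ := by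
    intro v hv
    obtain ⟨w, hw, rfl⟩ := Finset.mem_image.1 hv
    rwa [inv_mulVec_mulVec]
  apply subset_antisymm
  · rintro _ ⟨_, ⟨y, rfl⟩, rfl⟩
    exact ⟨_, (congrArg (fun f : Spec (CommRingCat.of (chartRing K σ)) ⟶ Δ'.surface K => f y)
      (chart_toricHom K hg hσ hτ h1)).symm⟩
  · rintro _ ⟨y, rfl⟩
    refine ⟨toricHom K hg' (chart K hτ y), ⟨chartHom K g⁻¹ h2 y, ?_⟩, ?_⟩
    · exact (congrArg (fun f : Spec (CommRingCat.of (chartRing K _)) ⟶ Δ.surface K => f y)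
        (chart_toricHom K hg' hτ hσ h2)).symm
    · exact congrArg (fun f : Δ'.surface K ⟶ Δ'.surface K => f (chart K hτ y))
        (surfaceIso K hg hg').inv_hom_id

lemma toricHom_image_rayCurve {g : GL2Z} (hg : MapsTo g Δ Δ') (hg' : MapsTo g⁻¹ Δ' Δ)
    {v : Lattice} (hv : {v} ∈ Δ.cones) (hgv : {g.1.mulVec v} ∈ Δ'.cones) :
    toricHom K hg '' Δ.rayCurve K hv = Δ'.rayCurve K hgv := by
  have h := (Scheme.homeoOfIso (surfaceIso K hg hg')).image_closure
    (Set.range (chart K hv) \ Set.range (Δ.torus K))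
  refine h.trans ?_
  rw [rayCurve, Set.image_sdiff (Scheme.homeoOfIso (surfaceIso K hg hg')).injective]
  congr 2
  · exact toricHom_image_range K hg hg' hv hgv (by simp)
  · exact toricHom_image_range K hg hg' Δ.empty_mem Δ'.empty_mem (by simp)

end Fan

end ToricMorphisms

/-! ### Cones and neighbours of rays -/

lemma eq_smul_add_smul {p q : Lattice} (h : detPair p q = 1) (x : Lattice) :
    x = detPair x q • p + detPair p x • q := by
  simp only [detPair] at h ⊢
  ext i
  fin_cases i <;> simp
  · linear_combination (-x 0) * h
  · linear_combination (-x 1) * h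

/-- Membership in a cone in terms of the coordinates with respect to a basis `p`, `q` that contains
its generators: the coordinates are `detPair x q` and `detPair p x`. -/
lemma mem_conePoints_iff {p q : Lattice} (h : detPair p q = 1) {σ : Finset Lattice}
    (hσ : σ ⊆ {p, q}) {x : Lattice} : x ∈ conePoints σ ↔
      0 ≤ detPair x q ∧ 0 ≤ detPair p x ∧ (p ∉ σ → detPair x q = 0) ∧
        (q ∉ σ → detPair p x = 0) := by
  constructor
  · intro hx
    induction hx using AddSubmonoid.closure_induction with
    | mem v hv =>
      have hv' := hσ hv
      simp only [Finset.mem_insert, Finset.mem_singleton] at hv'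
      rcases hv' with rfl | rfl
      · rw [h, detPair_self]
        exact ⟨zero_le_one, le_rfl, fun h => absurd hv h, fun _ => rfl⟩
      · rw [h, detPair_self]
        exact ⟨le_rfl, zero_le_one, fun _ => rfl, fun h => absurd hv h⟩
    | zero => simp [detPair]
    | add y z _ _ hy hz =>
      rw [detPair_add_left, detPair_add_right]
      obtain ⟨h1, h2, h3, h4⟩ := hy
      obtain ⟨h1', h2', h3', h4'⟩ := hz
      exact ⟨add_nonneg h1 h1', add_nonneg h2 h2', fun hp => by rw [h3 hp, h3' hp, add_zero],
        fun hq => by rw [h4 hq, h4' hq, add_zero]⟩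
  · rintro ⟨h1, h2, h3, h4⟩
    rw [eq_smul_add_smul h x]
    obtain ⟨m, hm⟩ := Int.eq_ofNat_of_zero_le h1
    obtain ⟨n, hn⟩ := Int.eq_ofNat_of_zero_le h2
    rw [hm, hn]
    refine add_mem ?_ ?_
    · by_cases hp : p ∈ σ
      · rw [natCast_zsmul]
        exact nsmul_mem (AddSubmonoid.subset_closure hp) m
      · rw [← hm, h3 hp, zero_smul]
        exact zero_mem _
    · by_cases hq : q ∈ σ
      · rw [natCast_zsmul]
        exact nsmul_mem (AddSubmonoid.subset_closure hq) n
      · rw [← hn, h4 hq, zero_smul]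
        exact zero_mem _

lemma detPair_basis (b : Module.Basis (Fin 2) ℤ Lattice) :
    detPair (b 0) (b 1) = 1 ∨ detPair (b 0) (b 1) = -1 := by
  have h := (Pi.basisFun ℤ (Fin 2)).isUnit_det b
  rw [Module.Basis.det_apply, Matrix.det_fin_two] at h
  simp only [Module.Basis.toMatrix_apply, Pi.basisFun_repr] at h
  rw [Int.isUnit_iff] at h
  simp only [detPair]
  rcases h with h | h
  · left; linarith
  · right; linarith

namespace Fan

variable {Δ : Fan} {σ : Finset Lattice}

lemma exists_pair (hσ : σ ∈ Δ.cones) : ∃ p q, detPair p q = 1 ∧ σ ⊆ {p, q} := by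
  obtain ⟨b, hb⟩ := Δ.smooth σ hσ
  have h0 : ∀ x ∈ σ, x = b 0 ∨ x = b 1 := by
    intro x hx
    obtain ⟨i, rfl⟩ := hb hx
    fin_cases i
    · exact .inl rfl
    · exact .inr rfl
  rcases detPair_basis b with h | h
  · exact ⟨b 0, b 1, h, fun x hx => by simpa using h0 x hx⟩
  · refine ⟨b 1, b 0, by rw [detPair_swap, h, neg_neg], fun x hx => by simpa using (h0 x hx).symm⟩

lemma ray_mem {w : Lattice} (hw : {w} ∈ Δ.cones) (hσ : σ ∈ Δ.cones) (h : w ∈ conePoints σ) :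
    w ∈ σ := by
  by_contra hwσ
  have h1 := Δ.inter {w} hw σ hσ ⟨AddSubmonoid.subset_closure (by simp), h⟩
  rw [Finset.singleton_inter_of_notMem hwσ] at h1
  simp only [conePoints, Finset.coe_empty, AddSubmonoid.closure_empty, AddSubmonoid.mem_bot] at h1
  subst h1
  obtain ⟨p, q, hpq, hs⟩ := exists_pair hw
  have := hs (Finset.mem_singleton_self _)
  simp only [Finset.mem_insert, Finset.mem_singleton] at this
  rcases this with rfl | rfl <;> simp [detPair] at hpq

lemma singleton_mem (hσ : σ ∈ Δ.cones) {v : Lattice} (hv : v ∈ σ) : {v} ∈ Δ.cones :=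
  Δ.face_mem σ hσ _ (Finset.singleton_subset_iff.2 hv)

/-- In a complete fan each ray `v` has a neighbour on either side: the points `N v + w` with `N`
large lie in a cone that contains `v`. -/
lemma exists_neighbour {v : Lattice} (hv : {v} ∈ Δ.cones) {ε : ℤ} (hε : ε = 1 ∨ ε = -1) :
    ∃ w, {v, w} ∈ Δ.cones ∧ detPair v w = ε := by
  obtain ⟨w₀, hw₀⟩ : ∃ w₀, detPair v w₀ = ε := by
    obtain ⟨p, q, hpq, hs⟩ := exists_pair hv
    have := hs (Finset.mem_singleton_self _)
    simp only [Finset.mem_insert, Finset.mem_singleton] at this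
    rcases this with rfl | rfl
    · exact ⟨ε • q, by rw [detPair_smul_right, hpq, mul_one]⟩
    · exact ⟨-ε • p, by rw [detPair_smul_right, detPair_swap, hpq]; ring⟩
  choose f hf hxf using fun N : ℕ => Δ.complete ((N : ℤ) • v + w₀)
  obtain ⟨⟨σ, hσ⟩, hinf⟩ := Finite.exists_infinite_fiber
    (fun N : ℕ => (⟨f N, hf N⟩ : {σ // σ ∈ Δ.cones}))
  have hinf' := Set.infinite_coe_iff.1 hinf
  have hx : ∀ N ∈ (fun N : ℕ => (⟨f N, hf N⟩ : {σ // σ ∈ Δ.cones})) ⁻¹' {⟨σ, hσ⟩},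
      (N : ℤ) • v + w₀ ∈ conePoints σ := by
    intro N hN
    have : f N = σ := congrArg Subtype.val hN
    exact this ▸ hxf N
  obtain ⟨p, q, hpq, hs⟩ := exists_pair hσ
  simp only [mem_conePoints_iff hpq hs, detPair_add_left, detPair_add_right, detPair_smul_left,
    detPair_smul_right] at hx
  have nonneg : ∀ r s : ℤ, (∀ N ∈ (fun N : ℕ => (⟨f N, hf N⟩ : {σ // σ ∈ Δ.cones})) ⁻¹' {⟨σ, hσ⟩},
      0 ≤ (N : ℤ) * r + s) → 0 ≤ r := by
    intro r s h
    by_contra! hr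
    obtain ⟨N, hN, hlt⟩ := hinf'.exists_gt s.natAbs
    have := h N hN
    have h2 : (N : ℤ) * r ≤ N * (-1) := mul_le_mul_of_nonneg_left (by omega) (by omega)
    omega
  have zero : ∀ r s : ℤ, (∀ N ∈ (fun N : ℕ => (⟨f N, hf N⟩ : {σ // σ ∈ Δ.cones})) ⁻¹' {⟨σ, hσ⟩},
      (N : ℤ) * r + s = 0) → r = 0 := by
    intro r s h
    have h1 := nonneg r s fun N hN => (h N hN).ge
    have h2 := nonneg (-r) (-s) fun N hN => by rw [mul_neg, ← neg_add, h N hN, neg_zero]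
    omega
  have hvσ : v ∈ σ := by
    refine ray_mem hv hσ ((mem_conePoints_iff hpq hs).2 ⟨?_, ?_, fun hp => ?_, fun hq => ?_⟩)
    · exact nonneg _ _ fun N hN => (hx N hN).1
    · exact nonneg _ _ fun N hN => (hx N hN).2.1
    · exact zero _ _ fun N hN => (hx N hN).2.2.1 hp
    · exact zero _ _ fun N hN => (hx N hN).2.2.2 hq
  obtain ⟨N, hN⟩ := hinf'.nonempty
  obtain ⟨h1, h2, h3, h4⟩ := hx N hN
  have hvpq := hs hvσ
  simp only [Finset.mem_insert, Finset.mem_singleton] at hvpq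
  rcases hvpq with rfl | rfl
  · rw [detPair_self, mul_zero, zero_add, hw₀] at h2 h4
    have hq : q ∈ σ := by
      by_contra hq
      have := h4 hq
      omega
    refine ⟨q, Δ.face_mem σ hσ _ (Finset.insert_subset hvσ (Finset.singleton_subset_iff.2 hq)), ?_⟩
    omega
  · rw [detPair_self, mul_zero, zero_add, detPair_swap, hw₀] at h1 h3
    have hp : p ∈ σ := by
      by_contra hp
      have := h3 hp
      omega
    refine ⟨p, Δ.face_mem σ hσ _ (Finset.insert_subset hvσ (Finset.singleton_subset_iff.2 hp)), ?_⟩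
    rw [detPair_swap]
    omega

/-- A ray has only one neighbour on a given side: of two candidates, which differ by a multiple of
`v`, one would lie in the cone spanned by `v` and the other. -/
lemma neighbour_unique {v w w' : Lattice} (hw : {v, w} ∈ Δ.cones) (hw' : {v, w'} ∈ Δ.cones)
    (h : detPair v w = detPair v w') (hε : detPair v w = 1 ∨ detPair v w = -1) : w = w' := by
  -- the difference of `w` and `w'` is a multiple of `v`
  have main : ∀ {w w' : Lattice} {k : ℕ}, {v, w} ∈ Δ.cones → {v, w'} ∈ Δ.cones →
      w' = w + k • v → detPair v w ≠ 0 → w = w' := by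
    intro w w' k hw hw' hk h0
    have h1 : w' ∈ conePoints {v, w} := by
      rw [hk]
      exact add_mem (AddSubmonoid.subset_closure (by simp))
        (nsmul_mem (AddSubmonoid.subset_closure (by simp)) k)
    have h2 := ray_mem (Δ.singleton_mem hw' (by simp)) hw h1
    simp only [Finset.mem_insert, Finset.mem_singleton] at h2
    rcases h2 with h2 | h2
    · exfalso
      apply h0
      have : detPair v w' = detPair v w := by
        rw [hk, ← natCast_zsmul, detPair_add_right, detPair_smul_right, detPair_self]
        ring
      rw [← this, h2, detPair_self]
    · exact h2.symm
  have hk : ∃ k : ℤ, w' = w + k • v := by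
    rcases hε with h1 | h1
    · refine ⟨detPair w' w, ?_⟩
      have := eq_smul_add_smul h1 w'
      rw [← h, h1, one_smul] at this
      rw [add_comm]
      exact this
    · have h1' : detPair w v = 1 := by rw [detPair_swap, h1, neg_neg]
      refine ⟨detPair w w', ?_⟩
      have := eq_smul_add_smul h1' w'
      rw [detPair_swap v w', ← h, h1, neg_neg, one_smul] at this
      exact this
  have h0 : detPair v w ≠ 0 := by rcases hε with h | h <;> rw [h] <;> norm_num
  obtain ⟨k, hk⟩ := hk
  obtain ⟨n, rfl | rfl⟩ := k.eq_nat_or_neg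
  · exact main hw hw' (by rw [hk, natCast_zsmul]) h0
  · exact (main hw' hw (k := n) (by rw [hk, neg_smul, natCast_zsmul]; abel) (h ▸ h0)).symm

lemma exists_star {v : Lattice} (hv : {v} ∈ Δ.cones) : ∃ u w a, Δ.Star u v w a := by
  obtain ⟨w, hw, hvw⟩ := exists_neighbour hv (.inl rfl)
  obtain ⟨u, hu, hvu⟩ := exists_neighbour hv (.inr rfl)
  have huv : detPair u v = 1 := by rw [detPair_swap, hvu, neg_neg]
  refine ⟨u, w, detPair u w, Finset.pair_comm u v ▸ hu, hw, huv, hvw, ?_, ?_⟩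
  · have := eq_smul_add_smul huv w
    rw [detPair_swap v w, hvw] at this
    nth_rw 1 [this]
    simp
  · intro σ hσ hvσ
    obtain ⟨p, q, hpq, hs⟩ := exists_pair hσ
    have hvpq := hs hvσ
    simp only [Finset.mem_insert, Finset.mem_singleton] at hvpq
    have key : ∀ x ∈ σ, detPair v x = 1 ∨ detPair v x = -1 → x = u ∨ x = w := by
      intro x hx h
      have hvx : {v, x} ∈ Δ.cones :=
        Δ.face_mem σ hσ _ (Finset.insert_subset hvσ (Finset.singleton_subset_iff.2 hx))
      rcases h with h | h
      · exact .inr (neighbour_unique hvx hw (h.trans hvw.symm) (.inl h))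
      · exact .inl (neighbour_unique hvx hu (h.trans hvu.symm) (.inr h))
    rcases hvpq with rfl | rfl
    · by_cases hq : q ∈ σ
      · rcases key q hq (.inl hpq) with rfl | rfl
        · left; rwa [Finset.pair_comm]
        · right; exact hs
      · right
        intro x hx
        have := hs hx
        simp only [Finset.mem_insert, Finset.mem_singleton] at this ⊢
        rcases this with h | rfl
        · exact .inl h
        · exact absurd hx hq
    · by_cases hp : p ∈ σ
      · rcases key p hp (.inr (by rw [detPair_swap, hpq])) with rfl | rfl
        · left; exact hs
        · right; rwa [Finset.pair_comm]
      · right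
        intro x hx
        have := hs hx
        simp only [Finset.mem_insert, Finset.mem_singleton] at this ⊢
        rcases this with rfl | h
        · exact absurd hx hp
        · exact .inl h

lemma exists_ray (Δ : Fan) : ∃ v, {v} ∈ Δ.cones := by
  obtain ⟨σ, hσ, h⟩ := Δ.complete ![1, 0]
  rcases σ.eq_empty_or_nonempty with rfl | ⟨v, hv⟩
  · simp [conePoints] at h
  · exact ⟨v, Δ.singleton_mem hσ hv⟩

/-- Every cone of a complete fan is a face of a two-dimensional one. -/
lemma exists_maximal (hσ : σ ∈ Δ.cones) :
    ∃ p q, {p, q} ∈ Δ.cones ∧ detPair p q = 1 ∧ σ ⊆ {p, q} := by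
  rcases σ.eq_empty_or_nonempty with rfl | ⟨v, hv⟩
  · obtain ⟨v, hv⟩ := Δ.exists_ray
    obtain ⟨u, w, a, S⟩ := exists_star hv
    exact ⟨u, v, S.left_mem, S.det_left, Finset.empty_subset _⟩
  · obtain ⟨u, w, a, S⟩ := exists_star (Δ.singleton_mem hσ hv)
    rcases S.subset σ hσ hv with h | h
    · exact ⟨u, v, S.left_mem, S.det_left, h⟩
    · exact ⟨v, w, S.right_mem, S.det_right, h⟩

lemma map_conePoints (g : GL2Z) {x : Lattice} (hx : x ∈ conePoints σ) :
    g.1.mulVec x ∈ conePoints (σ.image fun v => g.1.mulVec v) := by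
  induction hx using AddSubmonoid.closure_induction with
  | mem v hv => exact AddSubmonoid.subset_closure (by exact_mod_cast Finset.mem_image_of_mem _ hv)
  | zero => rw [Matrix.mulVec_zero]; exact zero_mem _
  | add y z _ _ hy hz => rw [Matrix.mulVec_add]; exact add_mem hy hz

/-- As the fans are complete, a lattice automorphism that maps the cones of one to cones of the
other is an isomorphism of fans. -/
lemma MapsTo.inv {Δ' : Fan} {g : GL2Z} (hg : MapsTo g Δ Δ') : MapsTo g⁻¹ Δ' Δ := by
  intro σ hσ
  obtain ⟨p, q, hpq, hdet, hs⟩ := exists_maximal hσ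
  obtain ⟨τ, hτ, hx⟩ := Δ.complete (g⁻¹.1.mulVec (p + q))
  have h1 := map_conePoints g hx
  rw [mulVec_inv_mulVec] at h1
  have h2 : p + q ∈ conePoints {p, q} :=
    add_mem (AddSubmonoid.subset_closure (by simp)) (AddSubmonoid.subset_closure (by simp))
  have h3 := Δ'.inter _ hpq _ (hg τ hτ) ⟨h2, h1⟩
  rw [mem_conePoints_iff hdet Finset.inter_subset_left, detPair_add_left, detPair_add_right,
    detPair_self, detPair_self, hdet] at h3
  obtain ⟨-, -, h3, h4⟩ := h3
  refine Δ.face_mem τ hτ _ ?_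
  intro x hx
  obtain ⟨y, hy, rfl⟩ := Finset.mem_image.1 hx
  have hy' : y ∈ τ.image fun v => g.1.mulVec v := by
    have := hs hy
    simp only [Finset.mem_insert, Finset.mem_singleton] at this
    rcases this with rfl | rfl
    · by_contra h
      exact absurd (h3 fun h' => h (Finset.mem_inter.1 h').2) (by norm_num)
    · by_contra h
      exact absurd (h4 fun h' => h (Finset.mem_inter.1 h').2) (by norm_num)
  obtain ⟨z, hz, rfl⟩ := Finset.mem_image.1 hy'
  rwa [inv_mulVec_mulVec]

/-- A cone of a smooth fan is the dual of its dual cone. -/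
lemma mem_conePoints_of_dual {τ : Finset Lattice} (hτ : τ ∈ Δ.cones) {x : Lattice}
    (h : ∀ m ∈ dualMonoid τ, 0 ≤ m ⬝ᵥ x) : x ∈ conePoints τ := by
  obtain ⟨p, q, hpq, hs⟩ := exists_pair hτ
  have h1 : ∀ v ∈ τ, 0 ≤ detPair v q ∧ 0 ≤ detPair p v ∧ (p ∉ τ → detPair v q = 0) ∧
      (q ∉ τ → detPair p v = 0) := fun v hv =>
    (mem_conePoints_iff hpq hs).1 (AddSubmonoid.subset_closure hv)
  have key : ∀ y : Lattice, (-detChar p) ⬝ᵥ y = detPair p y := fun y => by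
    rw [neg_dotProduct, detChar_dotProduct, detPair_swap, neg_neg]
  rw [mem_conePoints_iff hpq hs]
  have a1 := h (detChar q) fun v hv => by rw [detChar_dotProduct]; exact (h1 v hv).1
  have a2 := h (-detChar p) fun v hv => by rw [key]; exact (h1 v hv).2.1
  rw [detChar_dotProduct] at a1
  rw [key] at a2
  refine ⟨a1, a2, fun hp => ?_, fun hq => ?_⟩
  · have := h (-detChar q) fun v hv => by
      rw [neg_dotProduct, detChar_dotProduct, (h1 v hv).2.2.1 hp, neg_zero]
    rw [neg_dotProduct, detChar_dotProduct] at this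
    omega
  · have := h (detChar p) fun v hv => by
      rw [← neg_neg (detChar p), neg_dotProduct, key, (h1 v hv).2.2.2 hq, neg_zero]
    rw [← neg_neg (detChar p), neg_dotProduct, key] at this
    omega

/-- Two fans that refine each other, up to a lattice automorphism, are isomorphic. -/
lemma mapsTo_of_refines {Δ' : Fan} {g : GL2Z}
    (h : ∀ σ ∈ Δ.cones, ∃ τ ∈ Δ'.cones, ∀ v ∈ σ, g.1.mulVec v ∈ conePoints τ)
    (h' : ∀ τ ∈ Δ'.cones, ∃ σ ∈ Δ.cones, ∀ v ∈ τ, g⁻¹.1.mulVec v ∈ conePoints σ) :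
    MapsTo g Δ Δ' := by
  intro ρ hρ
  obtain ⟨p, q, hpq, hdet, hs⟩ := exists_maximal hρ
  obtain ⟨τ, hτ, hστ⟩ := h _ hpq
  obtain ⟨σ', hσ', hτσ⟩ := h' _ hτ
  -- `σ'` contains the cone of `p` and `q`, hence is equal to it
  have hback : ∀ x ∈ conePoints τ, g⁻¹.1.mulVec x ∈ conePoints σ' := by
    intro x hx
    induction hx using AddSubmonoid.closure_induction with
    | mem v hv => exact hτσ v hv
    | zero => rw [Matrix.mulVec_zero]; exact zero_mem _
    | add y z _ _ hy hz => rw [Matrix.mulVec_add]; exact add_mem hy hz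
  have hsub : ∀ v ∈ ({p, q} : Finset Lattice), v ∈ σ' := by
    intro v hv
    refine ray_mem (Δ.singleton_mem hpq hv) hσ' ?_
    have := hback _ (hστ v hv)
    rwa [inv_mulVec_mulVec] at this
  have hσ'le : σ' ⊆ {p, q} := by
    obtain ⟨p', q', -, hs'⟩ := exists_pair hσ'
    have hc : ({p, q} : Finset Lattice).card = 2 := by
      apply Finset.card_pair
      rintro rfl
      rw [detPair_self] at hdet
      exact zero_ne_one hdet
    have := Finset.eq_of_subset_of_card_le (s := {p, q}) (t := σ') hsub
      ((Finset.card_le_card hs').trans (by rw [hc]; exact Finset.card_le_two))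
    exact this.symm.subset
  refine Δ'.face_mem τ hτ _ ?_
  -- a generator of a cone is not the sum of two other points of the cone
  have key : ∀ v ∈ ({p, q} : Finset Lattice), g.1.mulVec v ∈ τ := by
    have main : ∀ x ∈ conePoints τ, ∀ v ∈ ({p, q} : Finset Lattice), g⁻¹.1.mulVec x = v → x ∈ τ := by
      intro x hx
      induction hx using AddSubmonoid.closure_induction with
      | mem v hv => exact fun _ _ _ => hv
      | zero =>
        rintro v hv rfl
        rw [Matrix.mulVec_zero] at hv
        simp only [Finset.mem_insert, Finset.mem_singleton] at hv
        rcases hv with rfl | rfl <;> simp [detPair] at hdet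
      | add y z hy hz ihy ihz =>
        intro v hv e
        rw [Matrix.mulVec_add] at e
        have hy' := (mem_conePoints_iff hdet hσ'le).1 (hback y hy)
        have hz' := (mem_conePoints_iff hdet hσ'le).1 (hback z hz)
        have ey := eq_smul_add_smul hdet (g⁻¹.1.mulVec y)
        have ez := eq_smul_add_smul hdet (g⁻¹.1.mulVec z)
        have e1 : detPair (g⁻¹.1.mulVec y) q + detPair (g⁻¹.1.mulVec z) q = detPair v q := by
          rw [← detPair_add_left, e]
        have e2 : detPair p (g⁻¹.1.mulVec y) + detPair p (g⁻¹.1.mulVec z) = detPair p v := by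
          rw [← detPair_add_right, e]
        have hzero : ∀ x : Lattice, g⁻¹.1.mulVec x = 0 → x = 0 := by
          intro x hx
          rw [← mulVec_inv_mulVec g x, hx, Matrix.mulVec_zero]
        have hor : g⁻¹.1.mulVec y = 0 ∨ g⁻¹.1.mulVec z = 0 := by
          have hv' := hv
          simp only [Finset.mem_insert, Finset.mem_singleton] at hv'
          rcases hv' with rfl | rfl
          · rw [hdet] at e1
            rw [detPair_self] at e2
            have : detPair (g⁻¹.1.mulVec y) q = 0 ∨ detPair (g⁻¹.1.mulVec z) q = 0 := by omega
            rcases this with h0 | h0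
            · left
              rw [ey, h0, show detPair v (g⁻¹.1.mulVec y) = 0 by omega]
              simp
            · right
              rw [ez, h0, show detPair v (g⁻¹.1.mulVec z) = 0 by omega]
              simp
          · rw [hdet] at e2
            rw [detPair_self] at e1
            have : detPair p (g⁻¹.1.mulVec y) = 0 ∨ detPair p (g⁻¹.1.mulVec z) = 0 := by omega
            rcases this with h0 | h0
            · left
              rw [ey, h0, show detPair (g⁻¹.1.mulVec y) v = 0 by omega]
              simp
            · right
              rw [ez, h0, show detPair (g⁻¹.1.mulVec z) v = 0 by omega]
              simp
        rcases hor with h0 | h0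
        · rw [hzero y h0, zero_add]
          exact ihz v hv (by rw [← e, h0, zero_add])
        · rw [hzero z h0, add_zero]
          exact ihy v hv (by rw [← e, h0, add_zero])
    intro v hv
    exact main _ (hστ v hv) v hv (inv_mulVec_mulVec g v)
  intro x hx
  obtain ⟨v, hv, rfl⟩ := Finset.mem_image.1 hx
  exact key v (hs hv)

end Fan

/-! ### Isomorphisms of toric surfaces come from isomorphisms of fans -/

section Refinement

variable {K : Type u} [Field K]

/-- If a character times a function that does not vanish at the closed orbit is regular on the
chart of `σ`, then the character is regular on the chart of `σ`. -/
lemma mem_dualMonoid_of_mul_eq {σ : Finset Lattice} {c b : chartRing K σ}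
    (hc : c ∉ PrimeSpectrum.asIdeal (orbitPoint K (subset_refl σ))) (n : dualMonoid ∅)
    (h : AddMonoidAlgebra.single n 1 * chartRingMap K (Finset.empty_subset σ) c =
      chartRingMap K (Finset.empty_subset σ) b) : n.1 ∈ dualMonoid σ := by
  rw [mem_orbitPoint] at hc
  push Not at hc
  obtain ⟨m, hm, hcm⟩ := hc
  let m' : dualMonoid ∅ := AddSubmonoid.inclusion (dualMonoid_anti (Finset.empty_subset σ)) m
  have hinj : Function.Injective
      (AddSubmonoid.inclusion (dualMonoid_anti (Finset.empty_subset σ))) :=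
    AddSubmonoid.inclusion_injective _
  have h1 : (AddMonoidAlgebra.single n 1 * chartRingMap K (Finset.empty_subset σ) c).coeff
      (n + m') = c.coeff m := by
    rw [AddMonoidAlgebra.coeff_single_mul_eq_mul_coeff m', one_mul]
    · exact Finsupp.mapDomain_apply hinj c.coeff m
    · intro m'' _
      constructor
      · intro e
        ext1
        have := congrArg Subtype.val e
        exact add_left_cancel this
      · rintro rfl
        rfl
  by_contra hn
  rw [h] at h1
  apply hcm
  rw [← h1]
  refine Finsupp.mapDomain_of_notMem_range _ _ ?_
  rintro ⟨l, hl⟩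
  apply hn
  intro v hv
  have := congrArg Subtype.val hl
  have hl' : l.1 = n.1 + m.1 := this
  have h2 := l.2 v hv
  rw [hl', add_dotProduct, hm v hv, add_zero] at h2
  exact h2

namespace Fan

/-- An equivariant morphism maps cones into cones: a chart `U_τ` that contains the image of the
closed orbit of `U_σ` is the target of a neighbourhood of this orbit, so every character in `S_τ`
pulls back to a character that is regular there, hence belongs to `S_σ`. -/
lemma exists_cone_of_hom {Δ Δ' : Fan} (f : Δ.surface K ⟶ Δ'.surface K) (g : GL2Z)
    (hf : Δ.torus K ≫ f = torusHom K g ≫ Δ'.torus K) {σ : Finset Lattice} (hσ : σ ∈ Δ.cones) :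
    ∃ τ ∈ Δ'.cones, ∀ v ∈ σ, g.1.mulVec v ∈ conePoints τ := by
  let y : Spec (CommRingCat.of (chartRing K σ)) := orbitPoint K (subset_refl σ)
  obtain ⟨τ, hτ, z, hz⟩ := exists_chart K (f (chart K hσ y))
  refine ⟨τ, hτ, ?_⟩
  let F : Spec (CommRingCat.of (chartRing K σ)) ⟶ Δ'.surface K := chart K hσ ≫ f
  -- a function `a` that does not vanish at the closed orbit such that `D(a)` maps to a chart
  obtain ⟨a, hya, ha⟩ : ∃ a : chartRing K σ, a ∉ PrimeSpectrum.asIdeal y ∧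
      ∀ x : Spec (CommRingCat.of (chartRing K σ)), a ∉ PrimeSpectrum.asIdeal x →
        F x ∈ Set.range (chart K hτ) := by
    have hopen : IsOpen (F ⁻¹' Set.range (chart K hτ)) :=
      (chart K hτ).isOpenEmbedding.isOpen_range.preimage F.continuous
    obtain ⟨_, ⟨a, rfl⟩, h1, h2⟩ :=
      (PrimeSpectrum.isTopologicalBasis_basic_opens (R := chartRing K σ)).exists_subset_of_mem_open
        (show y ∈ F ⁻¹' Set.range (chart K hτ) from ⟨z, hz⟩) hopen
    exact ⟨a, h1, fun x hx => h2 hx⟩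
  let L := Localization.Away a
  let i : Spec (CommRingCat.of L) ⟶ Spec (CommRingCat.of (chartRing K σ)) :=
    Spec.map (CommRingCat.ofHom (algebraMap (chartRing K σ) L))
  have hrange : Set.range (i ≫ F) ⊆ Set.range (chart K hτ) := by
    rintro _ ⟨x, rfl⟩
    refine ha (i x) ?_
    have : i x ∈ Set.range (PrimeSpectrum.comap (algebraMap (chartRing K σ) L)) := ⟨x, rfl⟩
    rw [PrimeSpectrum.localization_away_comap_range L a] at this
    exact this
  let ℓ := IsOpenImmersion.lift (chart K hτ) (i ≫ F) hrange
  have hℓ : ℓ ≫ chart K hτ = i ≫ F := IsOpenImmersion.lift_fac _ _ _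
  let ψ := Spec.preimage ℓ
  have hψ : Spec.map ψ = ℓ := Spec.map_preimage ℓ
  -- compare with the torus, over the function field `Q`
  let Q := FractionRing (chartRing K (∅ : Finset Lattice))
  let ι := algebraMap (chartRing K (∅ : Finset Lattice)) Q
  have hιinj : Function.Injective ι := IsFractionRing.injective _ _
  let r := chartRingMap K (Finset.empty_subset σ)
  have ha0 : a ≠ 0 := by
    rintro rfl
    exact hya (zero_mem _)
  have hu : IsUnit ((ι.comp r.toRingHom) a) := by
    refine IsUnit.mk0 _ fun h0 => ha0 ?_
    exact chartRingMap_injective K (Finset.empty_subset σ)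
      (hιinj (a₁ := r a) (a₂ := r 0) (h0.trans (by simp)))
  let lam : L →+* Q := IsLocalization.Away.lift a hu
  have hlam : ∀ x, lam (algebraMap _ L x) = ι (r x) := fun x => IsLocalization.Away.lift_eq a hu x
  have hempty : ∀ v ∈ (∅ : Finset Lattice), g.1.mulVec v ∈ (∅ : Finset Lattice) :=
    fun v hv => absurd hv (Finset.notMem_empty v)
  have hcomp : Spec.map (ψ ≫ CommRingCat.ofHom lam) =
      Spec.map (CommRingCat.ofHom (chartRingMap K (Finset.empty_subset τ)).toRingHom ≫
        CommRingCat.ofHom (AddMonoidAlgebra.mapDomainRingHom K (dualMap g hempty)) ≫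
        CommRingCat.ofHom ι) := by
    rw [← cancel_mono (chart K hτ), Spec.map_comp, Spec.map_comp, Spec.map_comp, hψ,
      Category.assoc, hℓ, Category.assoc, Category.assoc,
      chart_comp K hτ Δ'.empty_mem (Finset.empty_subset τ)]
    have e1 : Spec.map (CommRingCat.ofHom lam) ≫ i =
        Spec.map (CommRingCat.ofHom ι) ≫ Spec.map (CommRingCat.ofHom r.toRingHom) := by
      rw [← Spec.map_comp, ← Spec.map_comp]
      congr 1
      exact CommRingCat.hom_ext (RingHom.ext hlam)
    have e2 : Spec.map (CommRingCat.ofHom r.toRingHom) ≫ F = Δ.torus K ≫ f := by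
      rw [← Category.assoc, chart_comp K hσ Δ.empty_mem (Finset.empty_subset σ)]
      rfl
    rw [← Category.assoc, e1, Category.assoc, e2, hf]
    rfl
  have hring := Spec.map_injective hcomp
  intro v hv
  refine mem_conePoints_of_dual hτ fun m hm => ?_
  have hm1 : lam (ψ (AddMonoidAlgebra.single ⟨m, hm⟩ 1)) =
      ι (AddMonoidAlgebra.single (dualMap g hempty (AddSubmonoid.inclusion
        (dualMonoid_anti (Finset.empty_subset τ)) ⟨m, hm⟩)) 1) := by
    have h1 := congrArg (fun φ : CommRingCat.of (chartRing K τ) ⟶ CommRingCat.of Q =>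
      φ (AddMonoidAlgebra.single ⟨m, hm⟩ 1)) hring
    refine h1.trans ?_
    change ι (AddMonoidAlgebra.mapDomain _
      (chartRingMap K (Finset.empty_subset τ) (AddMonoidAlgebra.single _ 1))) = _
    rw [chartRingMap_single, AddMonoidAlgebra.mapDomain_single]
  obtain ⟨n, b, hb⟩ := IsLocalization.Away.surj a (ψ (AddMonoidAlgebra.single ⟨m, hm⟩ 1) : L)
  have hb' := congrArg lam hb
  rw [map_mul, ← map_pow, hlam, hlam, hm1, ← map_mul] at hb'
  have hmem := mem_dualMonoid_of_mul_eq (c := a ^ n) (b := b)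
    (fun h => hya (Ideal.IsPrime.mem_of_pow_mem (PrimeSpectrum.isPrime y) n h)) _ (hιinj hb')
  have := hmem v hv
  change 0 ≤ Matrix.vecMul m g.1 ⬝ᵥ v at this
  rwa [← Matrix.dotProduct_mulVec] at this

lemma torusHom_comp (g h : GL2Z) : torusHom K g ≫ torusHom K h = torusHom K (h * g) :=
  chartHom_comp K _ _ _ _ _

lemma torusHom_one : torusHom K 1 = 𝟙 _ := by
  rw [torusHom, chartHom_eq_of_eq_one K rfl subset_rfl, ← Spec.map_id]
  congr 1
  ext1
  exact congrArg AlgHom.toRingHom (AddMonoidAlgebra.mapDomainAlgHom_id (R := K) (A := K)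
    (M := dualMonoid (∅ : Finset Lattice)))

lemma exists_mapsTo_of_toricIso {Δ Δ' : Fan} (h : ToricIso K Δ Δ') : ∃ g, MapsTo g Δ Δ' := by
  obtain ⟨e, g, -, hg⟩ := h
  refine ⟨g, mapsTo_of_refines (fun σ hσ => exists_cone_of_hom e.hom g hg hσ)
    fun τ hτ => exists_cone_of_hom e.inv g⁻¹ ?_ hτ⟩
  rw [← cancel_mono e.hom, Category.assoc, e.inv_hom_id, Category.comp_id, Category.assoc, hg,
    ← Category.assoc, torusHom_comp, mul_inv_cancel, torusHom_one, Category.id_comp]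

/-- Toric surfaces are isomorphic if and only if their fans are. -/
lemma toricIso_iff {Δ Δ' : Fan} : ToricIso K Δ Δ' ↔ ∃ g, MapsTo g Δ Δ' :=
  ⟨exists_mapsTo_of_toricIso, fun ⟨_, hg⟩ => toricIso_of_mapsTo K hg hg.inv⟩

end Fan

end Refinement

/-! ### Minimality in terms of the fan -/

namespace Fan

/-- The rays of `Δ` that are the sum of their two neighbours: the rays of the torus invariant
`(-1)`-curves. -/
def IsNegOneRay (Δ : Fan) (v : Lattice) : Prop := ∃ u w, Δ.Star u v w 1

/-- Minimality of a fan with the action of `G`: the combinatorial form of `IsMinimal`, which says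
that there is no non-empty `G`-invariant set of `(-1)`-rays no two of which span a cone. -/
def IsRayMinimal (Δ : Fan) (G : Subgroup GL2Z) : Prop :=
  ¬ ∃ S : Set Lattice, S.Nonempty ∧ (∀ v ∈ S, Δ.IsNegOneRay v) ∧
    (∀ v ∈ S, ∀ w ∈ S, v ≠ w → {v, w} ∉ Δ.cones) ∧ ∀ g ∈ G, ∀ v ∈ S, g.1.mulVec v ∈ S

variable {Δ : Fan}

lemma IsNegOneRay.mem {v : Lattice} (h : Δ.IsNegOneRay v) : {v} ∈ Δ.cones := by
  obtain ⟨u, w, S⟩ := h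
  exact S.mem

lemma isNegOneCurve_rayCurve_iff (K : Type u) [Field K] {v : Lattice} (hv : {v} ∈ Δ.cones) :
    IsNegOneCurve (Δ.str K) (Δ.rayCurve K hv) ↔ Δ.IsNegOneRay v := by
  constructor
  · intro h
    obtain ⟨u, w, a, S⟩ := exists_star hv
    obtain rfl := (S.isNegOneCurve_iff K).1 h
    exact ⟨u, w, S⟩
  · rintro ⟨u, w, S⟩
    exact (S.isNegOneCurve_iff K).2 rfl

lemma MapsTo.ray {Δ' : Fan} {g : GL2Z} (hg : MapsTo g Δ Δ') {v : Lattice} (hv : {v} ∈ Δ.cones) :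
    {g.1.mulVec v} ∈ Δ'.cones := by
  simpa using hg _ hv

/-- Minimality of the surface is minimality of the fan: a set of invariant curves corresponds to a
set of rays. -/
lemma isMinimal_iff (K : Type u) [Field K] {G : Subgroup GL2Z} (hG : ∀ g ∈ G, MapsTo g Δ Δ) :
    Δ.IsMinimal K G hG ↔ Δ.IsRayMinimal G := by
  rw [IsMinimal, IsRayMinimal, not_iff_not]
  constructor
  · rintro ⟨C, ⟨E, hE⟩, h1, h2, h3⟩
    refine ⟨{v | ∃ hv : {v} ∈ Δ.cones, Δ.rayCurve K hv ∈ C}, ?_, ?_, ?_, ?_⟩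
    · obtain ⟨⟨v, hv, rfl⟩, -⟩ := h1 E hE
      exact ⟨v, hv, hE⟩
    · rintro v ⟨hv, hvC⟩
      exact (isNegOneCurve_rayCurve_iff K hv).1 (h1 _ hvC).2
    · rintro v ⟨hv, hvC⟩ w ⟨hw, hwC⟩ hne
      exact (disjoint_rayCurve_iff K hv hw).1
        (h2 _ hvC _ hwC fun h => hne (rayCurve_injective K hv hw h))
    · rintro g hg v ⟨hv, hvC⟩
      refine ⟨(hG g hg).ray hv, ?_⟩
      rw [← toricHom_image_rayCurve K (hG g hg) (hG g hg).inv hv]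
      exact h3 g hg _ hvC
  · rintro ⟨S, ⟨v, hv⟩, h1, h2, h3⟩
    refine ⟨{E | ∃ v ∈ S, ∃ hv : {v} ∈ Δ.cones, E = Δ.rayCurve K hv},
      ⟨_, v, hv, (h1 v hv).mem, rfl⟩, ?_, ?_, ?_⟩
    · rintro _ ⟨v, hvS, hv, rfl⟩
      exact ⟨⟨v, hv, rfl⟩, (isNegOneCurve_rayCurve_iff K hv).2 (h1 v hvS)⟩
    · rintro _ ⟨v, hvS, hv, rfl⟩ _ ⟨w, hwS, hw, rfl⟩ hne
      refine (disjoint_rayCurve_iff K hv hw).2 (h2 v hvS w hwS ?_)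
      rintro rfl
      exact hne rfl
    · rintro g hg _ ⟨v, hvS, hv, rfl⟩
      exact ⟨_, h3 g hg v hvS, (hG g hg).ray hv,
        toricHom_image_rayCurve K (hG g hg) (hG g hg).inv hv _⟩

end Fan

/-! ### Invariant forms and stars -/

/-- A positive definite symmetric bilinear form on the lattice that is invariant under `G`. -/
structure InvariantForm (G : Subgroup GL2Z) where
  form : Lattice → Lattice → ℤ
  add_left : ∀ x y z, form (x + y) z = form x z + form y z
  smul_left : ∀ (a : ℤ) x y, form (a • x) y = a * form x y
  symm : ∀ x y, form x y = form y x
  pos : ∀ x, x ≠ 0 → 0 < form x x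
  invariant : ∀ g ∈ G, ∀ x y, form (g.1.mulVec x) (g.1.mulVec y) = form x y

/-- The standard form, summed over a finite group, is an invariant form. -/
lemma exists_invariantForm {G : Subgroup GL2Z} (hG : (G : Set GL2Z).Finite) :
    Nonempty (InvariantForm G) := by
  have : Fintype G := hG.fintype
  refine ⟨⟨fun x y => ∑ g : G, g.1.1.mulVec x ⬝ᵥ g.1.1.mulVec y, ?_, ?_, ?_, ?_, ?_⟩⟩
  · intro x y z
    simp only [Matrix.mulVec_add, add_dotProduct, Finset.sum_add_distrib]
  · intro a x y
    simp only [Matrix.mulVec_smul, smul_dotProduct, Finset.mul_sum, smul_eq_mul]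
  · intro x y
    exact Finset.sum_congr rfl fun g _ => dotProduct_comm _ _
  · intro x hx
    refine Finset.sum_pos (fun g _ => ?_) ⟨1, Finset.mem_univ _⟩
    have h0 : g.1.1.mulVec x ≠ 0 := fun h => hx (by
      rw [← inv_mulVec_mulVec g.1 x, h, Matrix.mulVec_zero])
    have h1 : 0 ≤ g.1.1.mulVec x ⬝ᵥ g.1.1.mulVec x := by
      rw [dotProduct]
      exact Finset.sum_nonneg fun i _ => mul_self_nonneg _
    exact lt_of_le_of_ne h1 fun h => h0 (dotProduct_self_eq_zero.1 h.symm)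
  · intro g hg x y
    refine Fintype.sum_equiv (Equiv.mulRight (⟨g, hg⟩ : G)) _ _ fun k => ?_
    simp only [Equiv.coe_mulRight, Subgroup.coe_mul, Units.val_mul, Matrix.mulVec_mulVec]

namespace InvariantForm

variable {G : Subgroup GL2Z} (B : InvariantForm G)

/-- The quadratic form of `B` in terms of two vectors. -/
lemma form_smul_add_smul (a b : ℤ) (x y : Lattice) :
    B.form (a • x + b • y) (a • x + b • y) =
      a ^ 2 * B.form x x + 2 * a * b * B.form x y + b ^ 2 * B.form y y := by
  rw [B.add_left, B.smul_left, B.smul_left, B.symm x, B.symm y, B.add_left, B.add_left,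
    B.smul_left, B.smul_left, B.smul_left, B.smul_left, B.symm y x]
  ring

lemma form_neg (x : Lattice) : B.form (-x) (-x) = B.form x x := by
  have := B.form_smul_add_smul (-1) 0 x 0
  simpa using this

end InvariantForm

lemma detPair_mulVec (g : GL2Z) (x y : Lattice) :
    detPair (g.1.mulVec x) (g.1.mulVec y) = g.1.det * detPair x y := by
  simp only [detPair, Matrix.mulVec, dotProduct, Fin.sum_univ_two, Matrix.det_fin_two]
  ring

lemma det_eq_one_or (g : GL2Z) : g.1.det = 1 ∨ g.1.det = -1 :=
  Int.isUnit_iff.1 ((Matrix.isUnit_iff_isUnit_det _).1 g.isUnit)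

lemma ne_zero_of_detPair_left {x y : Lattice} (h : detPair x y = 1) : x ≠ 0 := by
  rintro rfl
  simp [detPair] at h

lemma ne_zero_of_detPair_right {x y : Lattice} (h : detPair x y = 1) : y ≠ 0 := by
  rintro rfl
  simp [detPair] at h

namespace Fan

variable {Δ : Fan} {u v w u' w' : Lattice} {a a' : ℤ}

lemma MapsTo.pair {Δ' : Fan} {g : GL2Z} (hg : MapsTo g Δ Δ') (h : {v, w} ∈ Δ.cones) :
    {g.1.mulVec v, g.1.mulVec w} ∈ Δ'.cones := by
  have := hg _ h
  rwa [Finset.image_insert, Finset.image_singleton] at this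

lemma eq_of_pair (h : {u, v} ∈ Δ.cones) (h' : {u', v} ∈ Δ.cones) (hd : detPair u v = 1)
    (hd' : detPair u' v = 1) : u = u' := by
  rw [Finset.pair_comm] at h h'
  refine neighbour_unique h h' ?_ (.inr ?_)
  · rw [detPair_swap, detPair_swap u', hd, hd']
  · rw [detPair_swap, hd]

lemma eq_of_pair' (h : {v, w} ∈ Δ.cones) (h' : {v, w'} ∈ Δ.cones) (hd : detPair v w = 1)
    (hd' : detPair v w' = 1) : w = w' :=
  neighbour_unique h h' (hd.trans hd'.symm) (.inl hd)

lemma Star.ne_zero (S : Δ.Star u v w a) : v ≠ 0 := ne_zero_of_detPair_right S.det_left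

lemma Star.unique (S : Δ.Star u v w a) (S' : Δ.Star u' v w' a') : u = u' ∧ w = w' ∧ a = a' := by
  obtain rfl := eq_of_pair S.left_mem S'.left_mem S.det_left S'.det_left
  obtain rfl := eq_of_pair' S.right_mem S'.right_mem S.det_right S'.det_right
  exact ⟨rfl, rfl, S.det_eq.symm.trans S'.det_eq⟩

/-- Neighbours are unique, so two cones on either side of `v` determine the star of `v`. -/
lemma Star.of_pairs (hu : {u, v} ∈ Δ.cones) (hw : {v, w} ∈ Δ.cones) (hdu : detPair u v = 1)
    (hdw : detPair v w = 1) (h : u + w = a • v) : Δ.Star u v w a := by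
  obtain ⟨u₁, w₁, a₁, S⟩ := exists_star (Δ.singleton_mem hu (v := v) (by simp))
  obtain rfl := eq_of_pair hu S.left_mem hdu S.det_left
  obtain rfl := eq_of_pair' hw S.right_mem hdw S.det_right
  have ha : a₁ = a := by
    rw [← S.det_eq, eq_sub_of_add_eq' h, sub_eq_add_neg, detPair_add_right, detPair_smul_right,
      detPair_neg_right, detPair_self, hdu]
    ring
  exact ha ▸ S

/-- A fan automorphism maps the star of a ray to that of its image, and reverses the order of the
neighbours if it reverses the orientation. -/
lemma Star.map {Δ' : Fan} (S : Δ.Star u v w a) {g : GL2Z} (hg : MapsTo g Δ Δ') :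
    Δ'.Star (g.1.mulVec u) (g.1.mulVec v) (g.1.mulVec w) a ∨
      Δ'.Star (g.1.mulVec w) (g.1.mulVec v) (g.1.mulVec u) a := by
  have hadd : g.1.mulVec u + g.1.mulVec w = a • g.1.mulVec v := by
    rw [← Matrix.mulVec_add, S.add_eq, Matrix.mulVec_smul]
  rcases det_eq_one_or g with h | h
  · left
    refine Star.of_pairs (hg.pair S.left_mem) (hg.pair S.right_mem) ?_ ?_ hadd
    · rw [detPair_mulVec, h, S.det_left, mul_one]
    · rw [detPair_mulVec, h, S.det_right, mul_one]
  · right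
    refine Star.of_pairs (by rw [Finset.pair_comm]; exact hg.pair S.right_mem)
      (by rw [Finset.pair_comm]; exact hg.pair S.left_mem) ?_ ?_ (by rw [add_comm, hadd])
    · rw [detPair_mulVec, h, detPair_swap, S.det_right]; rfl
    · rw [detPair_mulVec, h, detPair_swap, S.det_left]; rfl

lemma IsNegOneRay.map {Δ' : Fan} (h : Δ.IsNegOneRay v) {g : GL2Z} (hg : MapsTo g Δ Δ') :
    Δ'.IsNegOneRay (g.1.mulVec v) := by
  obtain ⟨u, w, S⟩ := h
  rcases S.map hg with S' | S'
  · exact ⟨_, _, S'⟩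
  · exact ⟨_, _, S'⟩

/-- A ray that is a combination of two rays of a cone with non-negative coefficients is one of these
two. -/
lemma eq_or_eq_of_ray {x : Lattice} (hx : {x} ∈ Δ.cones) (hvw : {v, w} ∈ Δ.cones) {s t : ℤ}
    (hs : 0 ≤ s) (ht : 0 ≤ t) (h : x = s • v + t • w) : x = v ∨ x = w := by
  have : x ∈ conePoints {v, w} := by
    lift s to ℕ using hs
    lift t to ℕ using ht
    rw [h, natCast_zsmul, natCast_zsmul]
    exact add_mem (nsmul_mem (AddSubmonoid.subset_closure (by simp)) _)
      (nsmul_mem (AddSubmonoid.subset_closure (by simp)) _)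
  simpa using ray_mem hx hvw this

/-- Two rays that form a lattice basis span a cone, unless some ray lies between them. -/
lemma pair_mem_of_forall_notMem (hv : {v} ∈ Δ.cones) (hw : {w} ∈ Δ.cones) (hd : detPair v w = 1)
    (h : ∀ k : ℤ, 1 ≤ k → {k • v + w} ∉ Δ.cones) : {v, w} ∈ Δ.cones := by
  obtain ⟨x, hx, hdx⟩ := exists_neighbour hv (.inl rfl)
  have hxw := eq_smul_add_smul hd x
  rw [hdx, one_smul] at hxw
  rcases lt_trichotomy (detPair x w) 0 with hk | hk | hk
  · -- `w` lies in the cone of `v` and `x`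
    have h1 : w = (-detPair x w) • v + (1 : ℤ) • x := by
      rw [neg_smul, one_smul, neg_add_eq_sub]
      exact eq_sub_of_add_eq' hxw.symm
    rcases eq_or_eq_of_ray hw hx (by omega) zero_le_one h1 with h2 | h2
    · rw [h2, detPair_self] at hd
      exact absurd hd zero_ne_one
    · rwa [h2]
  · rw [hk, zero_smul, zero_add] at hxw
    rwa [← hxw]
  · refine absurd (Δ.singleton_mem hx (v := x) (by simp)) ?_
    rw [hxw]
    exact h _ hk

/-- At a ray of maximal norm for an invariant form, the sum of the neighbours is `0` or `± v`, by
the parallelogram law. -/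
lemma Star.abs_le_one {G : Subgroup GL2Z} (B : InvariantForm G) (S : Δ.Star u v w a)
    (hu : B.form u u ≤ B.form v v) (hw : B.form w w ≤ B.form v v) : a = -1 ∨ a = 0 ∨ a = 1 := by
  have h1 := B.form_smul_add_smul 1 1 u w
  have h2 := B.form_smul_add_smul 1 (-1) u w
  have h3 := B.form_smul_add_smul a 0 v 0
  rw [zero_smul, add_zero, ← S.add_eq] at h3
  rw [one_smul, one_smul] at h1
  have huw : (1 : ℤ) • u + (-1 : ℤ) • w ≠ 0 := by
    intro h
    have h4 : u = w := by
      rw [one_smul, neg_smul, one_smul] at h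
      exact sub_eq_zero.1 (by rw [sub_eq_add_neg]; exact h)
    have h5 := S.det_left
    rw [h4, detPair_swap, S.det_right] at h5
    omega
  have h4 := B.pos _ huw
  have h5 := B.pos _ S.ne_zero
  have h6 : (4 - a ^ 2) * B.form v v > 0 := by nlinarith
  have h7 : 0 < 4 - a ^ 2 := by
    by_contra hlt
    push Not at hlt
    nlinarith
  have h8 : a < 2 := by nlinarith
  have h9 : -2 < a := by nlinarith
  omega

end Fan

/-! ### Minimal fans are standard -/

/-- The automorphism of the lattice that maps the standard basis to the basis `p`, `q`. -/
def ofColumns (p q : Lattice) (h : detPair p q = 1) : GL2Z where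
  val := !![p 0, q 0; p 1, q 1]
  inv := !![q 1, -q 0; -p 1, p 0]
  val_inv := by
    simp only [detPair] at h
    ext i j
    fin_cases i <;> fin_cases j <;> simp [Matrix.mul_apply, Fin.sum_univ_two] <;> linarith
  inv_val := by
    simp only [detPair] at h
    ext i j
    fin_cases i <;> fin_cases j <;> simp [Matrix.mul_apply, Fin.sum_univ_two] <;> linarith

lemma ofColumns_mulVec (p q : Lattice) (h : detPair p q = 1) (x y : ℤ) :
    (ofColumns p q h).1.mulVec ![x, y] = x • p + y • q := by
  ext i
  fin_cases i <;> simp [ofColumns, Matrix.mulVec, dotProduct, Fin.sum_univ_two, mul_comm]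

lemma eq_one_of_mulVec_eq {g : GL2Z} {p q : Lattice} (h : detPair p q = 1)
    (hp : g.1.mulVec p = p) (hq : g.1.mulVec q = q) : g = 1 := by
  refine Units.ext (Matrix.ext_of_mulVec_single fun i => ?_)
  rw [eq_smul_add_smul h (Pi.single i 1), Matrix.mulVec_add, Matrix.mulVec_smul,
    Matrix.mulVec_smul, hp, hq, Units.val_one, Matrix.one_mulVec]

namespace Fan

variable {Δ : Fan} {u v w : Lattice} {a : ℤ}

/-- Only the maximal cones of a fan need to be mapped to cones. -/
lemma mapsTo_ofPairs {P : Finset (Lattice × Lattice)} {h1 h2 h3} {g : GL2Z}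
    (h : ∀ c ∈ P, {g.1.mulVec c.1, g.1.mulVec c.2} ∈ Δ.cones) :
    MapsTo g (ofPairs P h1 h2 h3) Δ := by
  intro σ hσ
  simp only [ofPairs, Finset.mem_biUnion, Finset.mem_powerset] at hσ
  obtain ⟨c, hc, hσ⟩ := hσ
  refine Δ.face_mem _ (h c hc) _ ((Finset.image_subset_image hσ).trans ?_)
  rw [Finset.image_insert, Finset.image_singleton]

/-- A ray of `Δ` whose generator is of maximal norm among the generators of rays. -/
def IsLongest (Δ : Fan) {G : Subgroup GL2Z} (B : InvariantForm G) (v : Lattice) : Prop :=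
  {v} ∈ Δ.cones ∧ ∀ r, {r} ∈ Δ.cones → B.form r r ≤ B.form v v

variable {G : Subgroup GL2Z} {B : InvariantForm G}

lemma exists_isLongest (Δ : Fan) (B : InvariantForm G) : ∃ v, Δ.IsLongest B v := by
  have hfin : {v : Lattice | {v} ∈ Δ.cones}.Finite :=
    Δ.cones.finite_toSet.preimage Finset.singleton_injective.injOn
  obtain ⟨v, hv, h⟩ := Set.exists_max_image _ (fun v => B.form v v) hfin Δ.exists_ray
  exact ⟨v, hv, h⟩

lemma IsLongest.map (hv : Δ.IsLongest B v) {g : GL2Z} (hg : g ∈ G) (hG : MapsTo g Δ Δ) :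
    Δ.IsLongest B (g.1.mulVec v) :=
  ⟨hG.ray hv.1, fun r hr => by rw [B.invariant g hg]; exact hv.2 r hr⟩

lemma IsLongest.neg (hv : Δ.IsLongest B v) (h : {-v} ∈ Δ.cones) : Δ.IsLongest B (-v) :=
  ⟨h, fun r hr => by rw [B.form_neg]; exact hv.2 r hr⟩

lemma Star.ray_left (S : Δ.Star u v w a) : {u} ∈ Δ.cones := Δ.singleton_mem S.left_mem (by simp)

lemma Star.ray_right (S : Δ.Star u v w a) : {w} ∈ Δ.cones := Δ.singleton_mem S.right_mem (by simp)

lemma Star.abs_le_one_of_isLongest (hv : Δ.IsLongest B v) (S : Δ.Star u v w a) :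
    a = -1 ∨ a = 0 ∨ a = 1 :=
  S.abs_le_one B (hv.2 _ S.ray_left) (hv.2 _ S.ray_right)

lemma exists_mapsTo_fanDP6_of_pairs {e v : Lattice} (hd : detPair e v = 1)
    (h1 : {e, v} ∈ Δ.cones) (h2 : {v, v - e} ∈ Δ.cones) (h3 : {v - e, -e} ∈ Δ.cones)
    (h4 : {-e, -v} ∈ Δ.cones) (h5 : {-v, e - v} ∈ Δ.cones) (h6 : {e - v, e} ∈ Δ.cones) :
    ∃ h, MapsTo h fanDP6 Δ := by
  have hd' : detPair e (v - e) = 1 := by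
    rw [sub_eq_add_neg, detPair_add_right, detPair_neg_right, detPair_self, hd]
    rfl
  have hsub : -e + (e - v) = -v := by abel
  refine ⟨ofColumns e (v - e) hd', mapsTo_ofPairs ?_⟩
  simp only [Finset.mem_insert, Finset.mem_singleton]
  rintro c (rfl | rfl | rfl | rfl | rfl | rfl) <;> simp only [ofColumns_mulVec] <;> simpa [hsub]

/-- Two adjacent longest `(-1)`-rays of one orbit: the fan is a hexagon. The norms leave two
possibilities for the next ray on either side; if they do not match, the two rays have
different neighbourhoods. -/
lemma exists_mapsTo_fanDP6_of_adjacent (hv : Δ.IsLongest B v) (hw : Δ.IsLongest B w)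
    (hv1 : Δ.IsNegOneRay v) (hw1 : Δ.IsNegOneRay w) (hvw : {v, w} ∈ Δ.cones)
    (hd : detPair v w = 1) {g : GL2Z} (hg : MapsTo g Δ Δ) (hgv : g.1.mulVec v = w) :
    ∃ h, MapsTo h fanDP6 Δ := by
  obtain ⟨e, w', S⟩ := hv1
  obtain rfl := eq_of_pair' hvw S.right_mem hd S.det_right
  obtain ⟨v', f, S'⟩ := hw1
  obtain rfl := eq_of_pair hvw S'.left_mem hd S'.det_left
  have hwe := S.eq_sub
  rw [one_smul] at hwe
  subst hwe
  have hf := S'.eq_sub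
  rw [one_smul, sub_sub_cancel_left] at hf
  subst hf
  have hev := S.det_left
  obtain ⟨p, y, b, Sf⟩ := exists_star S'.ray_right
  obtain rfl := eq_of_pair S'.right_mem Sf.left_mem S'.det_right Sf.det_left
  obtain ⟨z, q, c, Se⟩ := exists_star S.ray_left
  obtain rfl := eq_of_pair' S.left_mem Se.right_mem S.det_left Se.det_right
  have hy : y = (1 - b) • e + (-1 : ℤ) • v := by
    rw [Sf.eq_sub]
    module
  have hz : z = c • e + (-1 : ℤ) • v := by
    rw [eq_sub_of_add_eq Se.add_eq]
    module
  have he0 : e ≠ 0 := ne_zero_of_detPair_left hev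
  have hE := B.pos e he0
  have hP : B.form e e = 2 * B.form e v := by
    have h1 := B.form_smul_add_smul (-1) 1 e v
    rw [show (-1 : ℤ) • e + (1 : ℤ) • v = v - e by module,
      le_antisymm (hv.2 _ hw.1) (hw.2 _ hv.1)] at h1
    linarith
  have hyn := hv.2 _ Sf.ray_right
  have hzn := hv.2 _ Se.ray_left
  rw [hy, B.form_smul_add_smul] at hyn
  rw [hz, B.form_smul_add_smul] at hzn
  have hquad : ∀ k : ℤ, k ^ 2 * B.form e e ≤ k * B.form e e → k = 0 ∨ k = 1 := by
    intro k hk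
    have h1 : k ^ 2 ≤ k := le_of_mul_le_mul_right hk hE
    have h2 : 0 ≤ k := by nlinarith
    have h3 : k ≤ 1 := by nlinarith
    omega
  have hk := hquad (1 - b) (by rw [hP] at *; linarith)
  have hl := hquad c (by rw [hP] at *; linarith)
  have hb : b = 0 ∨ b = 1 := by omega
  -- the neighbours of `v` are mapped to the neighbours of `w = v - e`
  have hgS := S.map hg
  rw [hgv] at hgS
  have hSe := Se.map hg
  rcases hb with rfl | rfl <;> rcases hl with rfl | rfl
  · -- the ray `-v` would lie in the interior of the cone of `-e` and `e - v`
    exfalso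
    have h1 : z = (1 : ℤ) • (-e) + (1 : ℤ) • y := by rw [hz, hy]; module
    rcases eq_or_eq_of_ray Se.ray_left Sf.right_mem zero_le_one zero_le_one h1 with h | h
    · have := Se.det_left
      rw [h, detPair_neg_left, detPair_self] at this
      omega
    · rw [h, hy] at hz
      apply he0
      have h2 : ((1 - 0 : ℤ) • e + (-1 : ℤ) • v) - ((0 : ℤ) • e + (-1 : ℤ) • v) = 0 :=
        sub_eq_zero.2 hz
      rw [← h2]
      module
  · exfalso
    have hSw := S'.map hg
    have key : ∀ {p q : Lattice}, ¬ Δ.Star p (-e) q 1 := fun T => by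
      have := (T.unique Sf).2.2
      omega
    rcases hgS with T | T
    · obtain ⟨-, h2, -⟩ := T.unique S'
      rw [h2] at hSw
      exact hSw.elim key key
    · obtain ⟨-, h2, -⟩ := T.unique S'
      rw [h2] at hSe
      exact hSe.elim key key
  · exfalso
    have key : ∀ {p q : Lattice}, ¬ Δ.Star p (-e) q 0 := fun T => by
      have := (T.unique Sf).2.2
      omega
    have key' : ∀ {p q : Lattice}, ¬ Δ.Star p v q 0 := fun T => by
      have := (T.unique S).2.2
      omega
    rcases hgS with T | T
    · obtain ⟨h2, -, -⟩ := T.unique S'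
      rw [h2] at hSe
      exact hSe.elim key' key'
    · obtain ⟨-, h2, -⟩ := T.unique S'
      rw [h2] at hSe
      exact hSe.elim key key
  · have hyv : y = -v := by rw [hy]; module
    have hzv : z = e - v := by rw [hz]; module
    subst hyv hzv
    refine exists_mapsTo_fanDP6_of_pairs hev S.left_mem S.right_mem S'.right_mem Sf.right_mem ?_
      Se.left_mem
    obtain ⟨p, q, d, Sv⟩ := exists_star Sf.ray_right
    obtain rfl := eq_of_pair Sf.right_mem Sv.left_mem Sf.det_right Sv.det_left
    have hq := Sv.eq_sub
    rcases Sv.abs_le_one_of_isLongest (hv.neg Sf.ray_right) with rfl | rfl | rfl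
    · exfalso
      have h1 : q = (1 : ℤ) • e + (1 : ℤ) • v := by rw [hq]; module
      rcases eq_or_eq_of_ray Sv.ray_right S.left_mem zero_le_one zero_le_one h1 with h | h
      · rw [h, one_smul, one_smul, left_eq_add] at h1
        exact S.ne_zero h1
      · rw [h, one_smul, one_smul, right_eq_add] at h1
        exact he0 h1
    · exfalso
      have h1 : q = e := by rw [hq]; module
      subst h1
      have := eq_of_pair Sv.right_mem Se.left_mem Sv.det_right Se.det_left
      rw [eq_sub_iff_add_eq, neg_add_cancel] at this
      exact he0 this.symm
    · have h1 : q = e - v := by rw [hq]; module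
      exact h1 ▸ Sv.right_mem

lemma detPair_eq_or_of_pair_mem (h : {v, w} ∈ Δ.cones) (hne : v ≠ w) :
    detPair v w = 1 ∨ detPair v w = -1 := by
  obtain ⟨p, q, hpq, hs⟩ := exists_pair h
  have h1 := hs (show v ∈ ({v, w} : Finset Lattice) by simp)
  have h2 := hs (show w ∈ ({v, w} : Finset Lattice) by simp)
  simp only [Finset.mem_insert, Finset.mem_singleton] at h1 h2
  rcases h1 with rfl | rfl <;> rcases h2 with rfl | rfl
  · exact absurd rfl hne
  · exact .inl hpq
  · exact .inr (by rw [detPair_swap, hpq])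
  · exact absurd rfl hne

/-- The orbit of a longest `(-1)`-ray contains two adjacent rays, by minimality; so the fan is a
hexagon. -/
lemma exists_mapsTo_fanDP6 (hG : ∀ g ∈ G, MapsTo g Δ Δ) (hmin : Δ.IsRayMinimal G)
    (hv : Δ.IsLongest B v) (hv1 : Δ.IsNegOneRay v) : ∃ h, MapsTo h fanDP6 Δ := by
  by_contra hno
  refine hmin ⟨{x | ∃ g ∈ G, x = g.1.mulVec v}, ⟨v, 1, one_mem _, by simp⟩, ?_, ?_, ?_⟩
  · rintro _ ⟨g, hg, rfl⟩
    exact hv1.map (hG g hg)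
  · rintro _ ⟨g, hg, rfl⟩ _ ⟨g', hg', rfl⟩ hne hpair
    apply hno
    rcases detPair_eq_or_of_pair_mem hpair hne with h | h
    · refine exists_mapsTo_fanDP6_of_adjacent (hv.map hg (hG g hg)) (hv.map hg' (hG g' hg'))
        (hv1.map (hG g hg)) (hv1.map (hG g' hg')) hpair h
        (hG (g' * g⁻¹) (mul_mem hg' (inv_mem hg))) ?_
      rw [Units.val_mul, ← Matrix.mulVec_mulVec, inv_mulVec_mulVec]
    · refine exists_mapsTo_fanDP6_of_adjacent (hv.map hg' (hG g' hg')) (hv.map hg (hG g hg))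
        (hv1.map (hG g' hg')) (hv1.map (hG g hg)) (by rwa [Finset.pair_comm])
        (by rw [detPair_swap, h, neg_neg]) (hG (g * g'⁻¹) (mul_mem hg (inv_mem hg'))) ?_
      rw [Units.val_mul, ← Matrix.mulVec_mulVec, inv_mulVec_mulVec]
  · rintro g hg _ ⟨g', hg', rfl⟩
    exact ⟨g * g', mul_mem hg hg', by rw [Units.val_mul, Matrix.mulVec_mulVec]⟩

/-- A longest ray `v` with `u + w = -v`: a ray strictly between `w` and `u` is longer than `v`,
unless it is `w + u = -v`. The latter would be a longest `(-1)`-ray, so `w` and `u` span a cone. -/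
lemma exists_mapsTo_fanP2 (hv : Δ.IsLongest B v) (S : Δ.Star u v w (-1))
    (hno : ∀ r, Δ.IsLongest B r → ¬ Δ.IsNegOneRay r) : ∃ h, MapsTo h fanP2 Δ := by
  have hvuw : w + u = -v := by rw [add_comm, S.add_eq, neg_one_smul]
  have hwu : detPair w u = 1 := by rw [detPair_swap, S.det_eq, neg_neg]
  have hV : B.form v v = B.form w w + 2 * B.form w u + B.form u u := by
    have := B.form_smul_add_smul 1 1 w u
    rw [one_smul, one_smul, hvuw, B.form_neg] at this
    linarith
  -- a ray between `w` and `u` is too long, unless it is `w + u`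
  have key : ∀ s t : ℤ, 1 ≤ s → 1 ≤ t → {s • w + t • u} ∈ Δ.cones → s = 1 ∧ t = 1 := by
    intro s t hs ht h
    have h1 := hv.2 _ h
    rw [B.form_smul_add_smul, show 2 * s * t * B.form w u = s * t * (2 * B.form w u) by ring,
      show 2 * B.form w u = B.form v v - B.form w w - B.form u u by rw [hV]; ring] at h1
    have hV0 := B.pos v S.ne_zero
    have hU0 := B.pos u (ne_zero_of_detPair_left S.det_left)
    have hW0 := B.pos w (ne_zero_of_detPair_left hwu)
    have hU := hv.2 _ S.ray_left
    have hW := hv.2 _ S.ray_right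
    have h2 : (s * t - 1) * B.form v v ≤ (s - t) * (t * B.form u u - s * B.form w w) := by
      linarith
    have h3 : ∀ {s t x y : ℤ}, 1 ≤ t → t < s → x ≤ B.form v v → 0 < y →
        (s * t - 1) * B.form v v ≤ (s - t) * (t * x - s * y) → False := by
      intro s t x y ht hst hx hy h
      have e1 : (s - t) * (t * x - s * y) ≤ (s - t) * (t * B.form v v - s * y) :=
        mul_le_mul_of_nonneg_left (by nlinarith) (by omega)
      have e2 : 0 < (s - t) * (s * y) := mul_pos (by omega) (mul_pos (by omega) hy)
      have e3 : (t * t - 1) * B.form v v < 0 := by linarith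
      have e4 : 0 ≤ (t * t - 1) * B.form v v := mul_nonneg (by nlinarith) hV0.le
      omega
    rcases lt_trichotomy s t with hst | rfl | hst
    · exact (h3 hs hst hW hU0 (by linarith)).elim
    · rw [sub_self, zero_mul] at h2
      have : s * s - 1 ≤ 0 := by
        by_contra hlt
        push Not at hlt
        exact absurd (mul_pos hlt hV0) (not_lt.2 h2)
      have : s = 1 := by nlinarith
      exact ⟨this, this⟩
    · exact (h3 ht hst hU hW0 h2).elim
  have hnot : {w + u} ∉ Δ.cones := by
    intro hr
    have h1 : {w, w + u} ∈ Δ.cones := by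
      refine pair_mem_of_forall_notMem S.ray_right hr
        (by rw [detPair_add_right, detPair_self, hwu]; rfl) fun k hk h => ?_
      have := (key (k + 1) 1 (by omega) le_rfl (by
        rwa [show (k + 1) • w + (1 : ℤ) • u = k • w + (w + u) by module])).1
      omega
    have h2 : {w + u, u} ∈ Δ.cones := by
      refine pair_mem_of_forall_notMem hr S.ray_left
        (by rw [detPair_add_left, detPair_self, hwu]; rfl) fun k hk h => ?_
      have := (key k (k + 1) hk (by omega) (by
        rwa [show k • w + (k + 1) • u = k • (w + u) + u by module])).2
      omega
    refine hno (w + u) ?_ ⟨w, u, Star.of_pairs h1 h2 ?_ ?_ (by rw [one_smul])⟩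
    · rw [hvuw] at hr ⊢
      exact hv.neg hr
    · rw [detPair_add_right, detPair_self, hwu]; rfl
    · rw [detPair_add_left, detPair_self, hwu]; rfl
  have h3 : {w, u} ∈ Δ.cones := by
    refine pair_mem_of_forall_notMem S.ray_right S.ray_left hwu fun k hk h => ?_
    obtain ⟨rfl, -⟩ := key k 1 hk le_rfl (by rwa [one_smul])
    rw [one_smul] at h
    exact hnot h
  refine ⟨ofColumns u v S.det_left, mapsTo_ofPairs ?_⟩
  have h4 := S.left_mem
  have h5 := S.right_mem
  have hw : w = -u + -v := by rw [S.eq_sub]; module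
  rw [hw] at h3 h5
  simp only [Finset.mem_insert, Finset.mem_singleton]
  rintro c (rfl | rfl | rfl) <;> simp only [ofColumns_mulVec] <;> simpa

/-- A fan with the four rays `v`, `u`, `-u` and `x = c u - v` is that of a Hirzebruch surface; the
sign of `c` decides which of `u` and `-u` is the section of negative self-intersection. -/
lemma exists_mapsTo_fanHirzebruch_of_star {x : Lattice} {c : ℤ} (S : Δ.Star u v (-u) 0)
    (Su : Δ.Star x u v c) (hx : {-u, x} ∈ Δ.cones) : ∃ k h, MapsTo h (fanHirzebruch k) Δ := by
  have hv : v = -x + c • u := by rw [← Su.add_eq]; abel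
  have hx' : x = -v + c • u := by rw [hv]; abel
  have h1 := S.left_mem
  have h2 := S.right_mem
  have h3 := Su.left_mem
  rcases le_total 0 c with hc | hc
  · lift c to ℕ using hc
    refine ⟨c, ofColumns x u Su.det_left, mapsTo_ofPairs ?_⟩
    rw [hv] at h1 h2
    simp only [Finset.mem_insert, Finset.mem_singleton]
    rintro c (rfl | rfl | rfl | rfl) <;> simp only [ofColumns_mulVec] <;> simpa
  · obtain ⟨n, rfl⟩ : ∃ n : ℕ, c = -n := ⟨(-c).toNat, by omega⟩
    refine ⟨n, ofColumns v (-u) S.det_right, mapsTo_ofPairs ?_⟩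
    rw [hx'] at hx h3
    rw [neg_smul] at hx h3
    simp only [Finset.mem_insert, Finset.mem_singleton]
    rintro c (rfl | rfl | rfl | rfl) <;> simp only [ofColumns_mulVec] <;> simpa

/-- A longest ray `v` of self-intersection `0`: the rays on the other side of the line of its
neighbours `u` and `-u` reduce to a single one. Otherwise the norms force `u` and `v` not to be
orthogonal, which excludes that `G` fixes `v`, and there is no room for another ray of the
orbit of `v`. -/
lemma exists_mapsTo_fanHirzebruch (hG : ∀ g ∈ G, MapsTo g Δ Δ) (hne : G ≠ ⊥)
    (hv : Δ.IsLongest B v) (S : Δ.Star u v w 0)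
    (hno : ∀ r, Δ.IsLongest B r → ¬ Δ.IsNegOneRay r) :
    ∃ k h, MapsTo h (fanHirzebruch k) Δ := by
  have hw := S.eq_sub
  rw [zero_smul, zero_sub] at hw
  subst hw
  have huv := S.det_left
  obtain ⟨v', x, b, Sw⟩ := exists_star S.ray_right
  obtain rfl := eq_of_pair S.right_mem Sw.left_mem S.det_right Sw.det_left
  obtain ⟨y, v', c, Su⟩ := exists_star S.ray_left
  obtain rfl := eq_of_pair' S.left_mem Su.right_mem S.det_left Su.det_right
  have hx : x = (-b) • u + (-1 : ℤ) • v := by rw [Sw.eq_sub]; module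
  have hy : y = c • u + (-1 : ℤ) • v := by rw [eq_sub_of_add_eq Su.add_eq]; module
  suffices h : c = -b by
    refine exists_mapsTo_fanHirzebruch_of_star S Su ?_
    rw [hy, h, ← hx]
    exact Sw.right_mem
  have hnonpos : ∀ {p r q : Lattice} {a : ℤ}, Δ.IsLongest B r → Δ.Star p r q a → a ≤ 0 := by
    intro p r q a hr T
    rcases T.abs_le_one_of_isLongest hr with rfl | rfl | rfl
    · omega
    · omega
    · exact absurd ⟨p, q, T⟩ (hno r hr)
  rcases lt_trichotomy c (-b) with h | h | h
  · exfalso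
    have h1 : y = (-b - c) • (-u) + (1 : ℤ) • x := by rw [hx, hy]; module
    rcases eq_or_eq_of_ray Su.ray_left Sw.right_mem (by omega) zero_le_one h1 with h2 | h2
    · have := Su.det_left
      rw [h2, detPair_neg_left, detPair_self] at this
      omega
    · have h3 := congrArg (fun z => detPair z v) (hy.symm.trans (h2.trans hx))
      simp only [detPair_add_left, detPair_smul_left, detPair_self, huv] at h3
      omega
  · exact h
  exfalso
  have hU := B.pos u (ne_zero_of_detPair_left huv)
  have hxn := hv.2 _ Sw.ray_right
  have hyn := hv.2 _ Su.ray_left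
  rw [hx, B.form_smul_add_smul] at hxn
  rw [hy, B.form_smul_add_smul] at hyn
  -- some element of `G` moves `v`
  obtain ⟨g, hg, hgv⟩ : ∃ g ∈ G, g.1.mulVec v ≠ v := by
    by_contra! hfix
    obtain ⟨⟨g, hg⟩, hg1⟩ := Subgroup.ne_bot_iff_exists_ne_one.1 hne
    replace hg1 : g ≠ 1 := fun h => hg1 (Subtype.ext h)
    have hgS := S.map (hG _ hg)
    rw [hfix _ hg] at hgS
    rcases hgS with T | T
    · exact hg1 (eq_one_of_mulVec_eq huv (T.unique S).1 (hfix _ hg))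
    · have h1 := B.invariant _ hg u v
      rw [hfix _ hg, (T.unique S).2.1, ← neg_one_smul ℤ u, B.smul_left] at h1
      have hP : B.form u v = 0 := by omega
      rw [hP] at hxn hyn
      have h2 : b ^ 2 * B.form u u ≤ 0 := by linarith
      have h3 : c ^ 2 * B.form u u ≤ 0 := by linarith
      have h4 : b ^ 2 ≤ 0 := by
        by_contra hlt
        push Not at hlt
        exact absurd (mul_pos hlt hU) (not_lt.2 h2)
      have h5 : c ^ 2 ≤ 0 := by
        by_contra hlt
        push Not at hlt
        exact absurd (mul_pos hlt hU) (not_lt.2 h3)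
      have h6 : b = 0 := by nlinarith
      have h7 : c = 0 := by nlinarith
      omega
  obtain ⟨z, hz⟩ : ∃ z, z = g.1.mulVec v := ⟨_, rfl⟩
  have hzl := hv.map hg (hG g hg)
  rw [← hz] at hgv hzl
  obtain ⟨z', T⟩ : ∃ z', Δ.Star z' z (-z') 0 := by
    rw [hz]
    rcases S.map (hG g hg) with T | T
    · exact ⟨g.1.mulVec u, by rwa [Matrix.mulVec_neg] at T⟩
    · exact ⟨g.1.mulVec (-u), by rwa [← Matrix.mulVec_neg, neg_neg]⟩
  -- the only ray above the line of `u` is `v`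
  have hup : ∀ r, {r} ∈ Δ.cones → 0 < detPair u r → r = v := by
    intro r hr hpos
    have h1 := eq_smul_add_smul huv r
    rcases le_total 0 (detPair r v) with hs | hs
    · rcases eq_or_eq_of_ray hr S.left_mem hs hpos.le h1 with h2 | h2
      · rw [h2, detPair_self] at hpos
        exact absurd hpos (lt_irrefl _)
      · exact h2
    · have h2 : r = detPair u r • v + (-detPair r v) • (-u) := by
        nth_rw 1 [h1]
        module
      rcases eq_or_eq_of_ray hr S.right_mem hpos.le (by omega) h2 with h3 | h3
      · exact h3
      · rw [h3, detPair_neg_right, detPair_self] at hpos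
        omega
  have hzuv := eq_smul_add_smul huv z
  rcases lt_trichotomy (detPair u z) 0 with ht | ht | ht
  · -- `z` is below the line: its neighbours are `u` and `-u`
    rcases lt_trichotomy (detPair u z') 0 with ht' | ht' | ht'
    · have h1 := hup (-z') T.ray_right (by rw [detPair_neg_right]; omega)
      have h2 := T.right_mem
      have h3 := T.det_right
      rw [h1] at h2 h3
      rw [← eq_of_pair S.left_mem h2 huv h3, detPair_self] at ht
      omega
    · have h1 := eq_smul_add_smul huv z'
      rw [ht', zero_smul, add_zero] at h1
      have h2 := T.det_left
      rw [h1, detPair_smul_left] at h2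
      rcases Int.mul_eq_one_iff_eq_one_or_neg_one.1 h2 with ⟨-, h3⟩ | ⟨h3, -⟩
      · omega
      · rw [h3, neg_one_smul] at h1
        have h4 := T.left_mem
        have h5 := T.right_mem
        have h6 := T.det_left
        have h7 := T.det_right
        rw [h1] at h4 h5 h6 h7
        rw [neg_neg] at h5 h7
        have h8 := eq_of_pair' Sw.right_mem h4 Sw.det_right h6
        have h9 := eq_of_pair Su.left_mem h5 Su.det_left h7
        have h10 := congrArg (fun z => detPair z v) (hy.symm.trans (h9.trans (h8.symm.trans hx)))
        simp only [detPair_add_left, detPair_smul_left, detPair_self, huv] at h10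
        omega
    · have h1 := hup z' T.ray_left ht'
      have h2 := T.left_mem
      have h3 := T.det_left
      rw [h1] at h2 h3
      rw [← eq_of_pair' S.right_mem h2 S.det_right h3, detPair_neg_right, detPair_self] at ht
      omega
  · rw [ht, zero_smul, add_zero] at hzuv
    have h1 : z = u ∨ z = -u := by
      rcases le_total 0 (detPair z v) with hs | hs
      · have h2 := eq_or_eq_of_ray hzl.1 S.left_mem hs le_rfl
          (hzuv.trans (by rw [zero_smul, add_zero]))
        exact .inl (h2.resolve_right hgv)
      · have h2 := eq_or_eq_of_ray hzl.1 S.right_mem le_rfl (neg_nonneg.2 hs)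
          (hzuv.trans (by module))
        exact .inr (h2.resolve_left hgv)
    rcases h1 with rfl | rfl
    · have h2 := (T.unique Su).2.2
      have h3 := hnonpos (hzl.neg S.ray_right) Sw
      omega
    · have h2 := (T.unique Sw).2.2
      have h3 := hnonpos (by simpa using hzl.neg (by simpa using S.ray_left)) Su
      omega
  · exact hgv (hup z hzl.1 ht)

/-- A minimal fan is isomorphic to the fan of `ℙ²`, of a Hirzebruch surface or of the sextic
del Pezzo surface. -/
theorem IsRayMinimal.exists_mapsTo (hfin : (G : Set GL2Z).Finite) (hne : G ≠ ⊥)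
    (hG : ∀ g ∈ G, MapsTo g Δ Δ) (hmin : Δ.IsRayMinimal G) :
    (∃ h, MapsTo h fanP2 Δ) ∨ (∃ k h, MapsTo h (fanHirzebruch k) Δ) ∨
      ∃ h, MapsTo h fanDP6 Δ := by
  obtain ⟨B⟩ := exists_invariantForm hfin
  by_cases hno : ∀ r, Δ.IsLongest B r → ¬ Δ.IsNegOneRay r
  · obtain ⟨v, hv⟩ := exists_isLongest Δ B
    obtain ⟨u, w, a, S⟩ := exists_star hv.1
    rcases S.abs_le_one_of_isLongest hv with rfl | rfl | rfl
    · exact .inl (exists_mapsTo_fanP2 hv S hno)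
    · exact .inr (.inl (exists_mapsTo_fanHirzebruch hG hne hv S hno))
    · exact absurd ⟨u, w, S⟩ (hno v hv)
  · push Not at hno
    obtain ⟨r, hr, hr1⟩ := hno
    exact .inr (.inr (exists_mapsTo_fanDP6 hG hmin hr hr1))

end Fan

/-! ### The twelve groups are pairwise not conjugate -/

lemma mem_map_conj {G : Subgroup GL2Z} {h x : GL2Z} :
    x ∈ G.map (MulAut.conj h).toMonoidHom ↔ h⁻¹ * x * h ∈ G := by
  rw [Subgroup.mem_map]
  constructor
  · rintro ⟨g, hg, rfl⟩
    simpa [mul_assoc] using hg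
  · intro hx
    exact ⟨_, hx, by simp [mul_assoc]⟩

lemma conj_mem_map_conj {G : Subgroup GL2Z} {g : GL2Z} (h : GL2Z) (hg : g ∈ G) :
    h * g * h⁻¹ ∈ G.map (MulAut.conj h).toMonoidHom :=
  ⟨g, hg, rfl⟩

lemma map_conj_map_conj (G : Subgroup GL2Z) (h k : GL2Z) :
    (G.map (MulAut.conj h).toMonoidHom).map (MulAut.conj k).toMonoidHom =
      G.map (MulAut.conj (k * h)).toMonoidHom := by
  ext x
  simp only [mem_map_conj, mul_inv_rev, mul_assoc]

lemma map_conj_one (G : Subgroup GL2Z) : G.map (MulAut.conj 1).toMonoidHom = G := by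
  ext x
  simp only [mem_map_conj, inv_one, one_mul, mul_one]

namespace GroupClass

lemma contains_subgroup (c : GroupClass) : c.Contains c.subgroup := ⟨1, (map_conj_one _).symm⟩

lemma Contains.map_conj {c : GroupClass} {G : Subgroup GL2Z} (hc : c.Contains G) (h : GL2Z) :
    c.Contains (G.map (MulAut.conj h).toMonoidHom) := by
  obtain ⟨k, rfl⟩ := hc
  exact ⟨h * k, map_conj_map_conj _ _ _⟩

lemma Contains.of_map_conj {c : GroupClass} {G : Subgroup GL2Z} {h : GL2Z}
    (hc : c.Contains (G.map (MulAut.conj h).toMonoidHom)) : c.Contains G := by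
  have := hc.map_conj h⁻¹
  rwa [map_conj_map_conj, inv_mul_cancel, map_conj_one] at this

/-- The elements of the representative of a class. -/
def elements : GroupClass → List GL2Z
  | C2 => [1, -1]
  | C3 => [1, matA ^ 2, (matA ^ 2) ^ 2]
  | C4 => [1, matB, matB ^ 2, matB ^ 3]
  | C6 => [1, matA, matA ^ 2, matA ^ 3, matA ^ 4, matA ^ 5]
  | D2 => [1, matC]
  | D2' => [1, matCprime]
  | D4 => [1, -1, matC, -1 * matC]
  | D4' => [1, -1, matCprime, -1 * matCprime]
  | D6 => [1, matA ^ 2, (matA ^ 2) ^ 2, matC, matA ^ 2 * matC, (matA ^ 2) ^ 2 * matC]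
  | D6' => [1, matA ^ 2, (matA ^ 2) ^ 2, -matC, matA ^ 2 * -matC, (matA ^ 2) ^ 2 * -matC]
  | D8 => [1, matB, matB ^ 2, matB ^ 3, matC, matB * matC, matB ^ 2 * matC, matB ^ 3 * matC]
  | D12 => [1, matA, matA ^ 2, matA ^ 3, matA ^ 4, matA ^ 5, matC, matA * matC, matA ^ 2 * matC,
      matA ^ 3 * matC, matA ^ 4 * matC, matA ^ 5 * matC]

lemma mem_of_mem_closure {S : Set GL2Z} {L : List GL2Z} (h1 : 1 ∈ L)
    (hS : ∀ x ∈ S, ∀ y ∈ L, x * y ∈ L ∧ x⁻¹ * y ∈ L) {g : GL2Z} (hg : g ∈ Subgroup.closure S) :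
    g ∈ L := by
  induction hg using Subgroup.closure_induction_left with
  | one => exact h1
  | mul_left x hx y _ hy => exact (hS x hx y hy).1
  | inv_mul_cancel x hx y _ hy => exact (hS x hx y hy).2

lemma mem_elements {c : GroupClass} {g : GL2Z} (hg : g ∈ c.subgroup) : g ∈ c.elements := by
  cases c <;> refine mem_of_mem_closure (by simp [elements]) ?_ hg
  any_goals
    rintro x rfl
    decide
  all_goals
    rintro x (rfl | rfl) <;> decide

lemma mem_subgroup {c : GroupClass} {g : GL2Z} (hg : g ∈ c.elements) : g ∈ c.subgroup := by
  have one : ∀ {r : GL2Z}, r ∈ Subgroup.closure {r} := Subgroup.subset_closure rfl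
  have left : ∀ {r s : GL2Z}, r ∈ Subgroup.closure {r, s} := Subgroup.subset_closure (.inl rfl)
  have right : ∀ {r s : GL2Z}, s ∈ Subgroup.closure {r, s} := Subgroup.subset_closure (.inr rfl)
  cases c <;> simp only [elements, List.mem_cons, List.not_mem_nil, or_false] at hg
  case C2 | D2 | D2' =>
    rcases hg with rfl | rfl
    exacts [one_mem _, one]
  case C3 =>
    rcases hg with rfl | rfl | rfl
    exacts [one_mem _, one, pow_mem one _]
  case C4 =>
    rcases hg with rfl | rfl | rfl | rfl
    exacts [one_mem _, one, pow_mem one _, pow_mem one _]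
  case C6 =>
    rcases hg with rfl | rfl | rfl | rfl | rfl | rfl
    exacts [one_mem _, one, pow_mem one _, pow_mem one _, pow_mem one _, pow_mem one _]
  case D4 | D4' =>
    rcases hg with rfl | rfl | rfl | rfl
    exacts [one_mem _, left, right, mul_mem left right]
  case D6 | D6' =>
    rcases hg with rfl | rfl | rfl | rfl | rfl | rfl
    exacts [one_mem _, left, pow_mem left _, right, mul_mem left right,
      mul_mem (pow_mem left _) right]
  case D8 =>
    rcases hg with rfl | rfl | rfl | rfl | rfl | rfl | rfl | rfl
    exacts [one_mem _, left, pow_mem left _, pow_mem left _, right, mul_mem left right,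
      mul_mem (pow_mem left _) right, mul_mem (pow_mem left _) right]
  case D12 =>
    rcases hg with rfl | rfl | rfl | rfl | rfl | rfl | rfl | rfl | rfl | rfl | rfl | rfl
    exacts [one_mem _, left, pow_mem left _, pow_mem left _, pow_mem left _, pow_mem left _, right,
      mul_mem left right, mul_mem (pow_mem left _) right, mul_mem (pow_mem left _) right,
      mul_mem (pow_mem left _) right, mul_mem (pow_mem left _) right]

lemma mem_subgroup_iff {c : GroupClass} {g : GL2Z} : g ∈ c.subgroup ↔ g ∈ c.elements :=
  ⟨mem_elements, mem_subgroup⟩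

end GroupClass

/-- `G` has an element of trace `t` and determinant `d`. -/
def HasType (G : Subgroup GL2Z) (t d : ℤ) : Prop := ∃ g ∈ G, g.1.trace = t ∧ g.1.det = d

/-- The vector `v` modulo `n` is fixed by `G`. -/
def IsFixedMod (n : ℕ) (G : Subgroup GL2Z) (v : Fin 2 → ZMod n) : Prop :=
  ∀ g ∈ G, (g.1.map (Int.castRingHom (ZMod n))).mulVec v = v

lemma HasType.map_conj {G : Subgroup GL2Z} {t d : ℤ} (hG : HasType G t d) (h : GL2Z) :
    HasType (G.map (MulAut.conj h).toMonoidHom) t d := by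
  obtain ⟨g, hg, ht, hd⟩ := hG
  refine ⟨_, conj_mem_map_conj h hg, ?_, ?_⟩
  · rw [Units.val_mul, Units.val_mul, Matrix.trace_mul_cycle, ← Units.val_mul, inv_mul_cancel,
      Units.val_one, one_mul, ht]
  · rw [Units.val_mul, Units.val_mul, Matrix.det_mul, Matrix.det_mul, mul_right_comm,
      ← Matrix.det_mul, ← Units.val_mul, mul_inv_cancel, Units.val_one, Matrix.det_one, one_mul, hd]

lemma hasType_map_conj_iff {G : Subgroup GL2Z} {t d : ℤ} {h : GL2Z} :
    HasType (G.map (MulAut.conj h).toMonoidHom) t d ↔ HasType G t d := by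
  refine ⟨fun hG => ?_, fun hG => hG.map_conj h⟩
  have := hG.map_conj h⁻¹
  rwa [map_conj_map_conj, inv_mul_cancel, map_conj_one] at this

lemma map_castRingHom_mul (n : ℕ) (g h : GL2Z) (v : Fin 2 → ZMod n) :
    ((g * h).1.map (Int.castRingHom (ZMod n))).mulVec v =
      (g.1.map (Int.castRingHom (ZMod n))).mulVec
        ((h.1.map (Int.castRingHom (ZMod n))).mulVec v) := by
  rw [Units.val_mul, Matrix.map_mul, Matrix.mulVec_mulVec]

lemma map_castRingHom_one (n : ℕ) (v : Fin 2 → ZMod n) :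
    ((1 : GL2Z).1.map (Int.castRingHom (ZMod n))).mulVec v = v := by
  rw [Units.val_one, Matrix.map_one _ (map_zero _) (map_one _), Matrix.one_mulVec]

lemma IsFixedMod.map_conj {n : ℕ} {G : Subgroup GL2Z} {v : Fin 2 → ZMod n}
    (hG : IsFixedMod n G v) (h : GL2Z) :
    IsFixedMod n (G.map (MulAut.conj h).toMonoidHom)
      ((h.1.map (Int.castRingHom (ZMod n))).mulVec v) := by
  rintro _ ⟨g, hg, rfl⟩
  change (((h * g * h⁻¹).1).map _).mulVec _ = _
  rw [← map_castRingHom_mul, mul_assoc, mul_assoc, inv_mul_cancel, mul_one, map_castRingHom_mul,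
    hG g hg]

lemma exists_isFixedMod_map_conj {n : ℕ} {G : Subgroup GL2Z} (h : GL2Z)
    (hG : ∃ v : Fin 2 → ZMod n, v ≠ 0 ∧ IsFixedMod n G v) :
    ∃ v : Fin 2 → ZMod n, v ≠ 0 ∧ IsFixedMod n (G.map (MulAut.conj h).toMonoidHom) v := by
  obtain ⟨v, hv, hG⟩ := hG
  refine ⟨_, fun h0 => hv ?_, hG.map_conj h⟩
  rw [← map_castRingHom_one n v, ← inv_mul_cancel h, map_castRingHom_mul, h0, Matrix.mulVec_zero]

lemma forall_isFixedMod_map_conj {n : ℕ} {G : Subgroup GL2Z} (h : GL2Z)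
    (hG : ∀ v : Fin 2 → ZMod n, IsFixedMod n G v) (v : Fin 2 → ZMod n) :
    IsFixedMod n (G.map (MulAut.conj h).toMonoidHom) v := by
  have := (hG ((h⁻¹.1.map (Int.castRingHom (ZMod n))).mulVec v)).map_conj h
  rwa [← map_castRingHom_mul, mul_inv_cancel, map_castRingHom_one] at this

/-- Conjugation invariants of a group, which distinguish the classes: the types of its elements, its
action modulo `2`, and whether it has a fixed vector modulo `3`. -/
def SameInvariants (G H : Subgroup GL2Z) : Prop :=
  (∀ t d, HasType G t d ↔ HasType H t d) ∧
  ((∀ v : Fin 2 → ZMod 2, IsFixedMod 2 G v) ↔ ∀ v : Fin 2 → ZMod 2, IsFixedMod 2 H v) ∧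
  ((∃ v : Fin 2 → ZMod 3, v ≠ 0 ∧ IsFixedMod 3 G v) ↔
    ∃ v : Fin 2 → ZMod 3, v ≠ 0 ∧ IsFixedMod 3 H v)

lemma sameInvariants_map_conj (G : Subgroup GL2Z) (h : GL2Z) :
    SameInvariants (G.map (MulAut.conj h).toMonoidHom) G := by
  have e : (G.map (MulAut.conj h).toMonoidHom).map (MulAut.conj h⁻¹).toMonoidHom = G := by
    rw [map_conj_map_conj, inv_mul_cancel, map_conj_one]
  refine ⟨fun t d => hasType_map_conj_iff, ⟨fun hG => ?_, forall_isFixedMod_map_conj h⟩,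
    ⟨fun hG => ?_, exists_isFixedMod_map_conj h⟩⟩
  · have := forall_isFixedMod_map_conj h⁻¹ hG
    rwa [e] at this
  · have := exists_isFixedMod_map_conj h⁻¹ hG
    rwa [e] at this

namespace GroupClass

lemma hasType_subgroup_iff {c : GroupClass} {t d : ℤ} :
    HasType c.subgroup t d ↔ ∃ g ∈ c.elements, g.1.trace = t ∧ g.1.det = d := by
  simp only [HasType, mem_subgroup_iff]

lemma isFixedMod_subgroup_iff {c : GroupClass} {n : ℕ} {v : Fin 2 → ZMod n} :
    IsFixedMod n c.subgroup v ↔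
      ∀ g ∈ c.elements, (g.1.map (Int.castRingHom (ZMod n))).mulVec v = v := by
  simp only [IsFixedMod, mem_subgroup_iff]

/-- The invariants of a class: whether there are elements `-1`, of order `3`, of order `4`,
reflections, whether the action modulo `2` is trivial, and whether there is a fixed vector
modulo `3`. -/
def invariants : GroupClass → List Bool
  | C2 => [true, false, false, false, true, false]
  | C3 => [false, true, false, false, false, true]
  | C4 => [true, false, true, false, false, false]
  | C6 => [true, true, false, false, false, false]
  | D2 => [false, false, false, true, false, true]
  | D2' => [false, false, false, true, true, true]
  | D4 => [true, false, false, true, false, false]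
  | D4' => [true, false, false, true, true, false]
  | D6 => [false, true, false, true, false, false]
  | D6' => [false, true, false, true, false, true]
  | D8 => [true, false, true, true, false, false]
  | D12 => [true, true, false, true, false, false]

lemma invariants_injective {c c' : GroupClass} (h : c.invariants = c'.invariants) : c = c' := by
  cases c <;> cases c' <;> first | rfl | simp [invariants] at h

lemma invariants_eq (c : GroupClass) : c.invariants =
    [decide (∃ g ∈ c.elements, g.1.trace = -2 ∧ g.1.det = 1),
      decide (∃ g ∈ c.elements, g.1.trace = -1 ∧ g.1.det = 1),
      decide (∃ g ∈ c.elements, g.1.trace = 0 ∧ g.1.det = 1),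
      decide (∃ g ∈ c.elements, g.1.trace = 0 ∧ g.1.det = -1),
      decide (∀ v : Fin 2 → ZMod 2, ∀ g ∈ c.elements,
        (g.1.map (Int.castRingHom (ZMod 2))).mulVec v = v),
      decide (∃ v : Fin 2 → ZMod 3, v ≠ 0 ∧ ∀ g ∈ c.elements,
        (g.1.map (Int.castRingHom (ZMod 3))).mulVec v = v)] := by
  cases c <;> decide

/-- The twelve classes are pairwise different, as the invariants tell them apart. -/
lemma Contains.unique {c c' : GroupClass} {G : Subgroup GL2Z} (h : c.Contains G)
    (h' : c'.Contains G) : c = c' := by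
  obtain ⟨k, rfl⟩ := h
  obtain ⟨k', h'⟩ := h'
  have h1 := sameInvariants_map_conj c.subgroup k
  have h2 := sameInvariants_map_conj c'.subgroup k'
  rw [← h'] at h2
  obtain ⟨a1, a2, a3⟩ := h1
  obtain ⟨b1, b2, b3⟩ := h2
  have t1 : ∀ t d, _ := fun t d => (a1 t d).symm.trans (b1 t d)
  have t2 := a2.symm.trans b2
  have t3 := a3.symm.trans b3
  simp only [hasType_subgroup_iff, isFixedMod_subgroup_iff] at t1 t2 t3
  apply invariants_injective
  rw [invariants_eq, invariants_eq]
  simp only [t1, t2, t3]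

end GroupClass

/-! ### Subgroups of the dihedral groups -/

lemma mulVec_inj_of_basis {g g' : GL2Z} {p q : Lattice} (h : detPair p q = 1)
    (hp : g.1.mulVec p = g'.1.mulVec p) (hq : g.1.mulVec q = g'.1.mulVec q) : g = g' := by
  have : g'⁻¹ * g = 1 := by
    refine eq_one_of_mulVec_eq h ?_ ?_
    · rw [Units.val_mul, ← Matrix.mulVec_mulVec, hp, inv_mulVec_mulVec]
    · rw [Units.val_mul, ← Matrix.mulVec_mulVec, hq, inv_mulVec_mulVec]
  rw [← mul_right_inj g'⁻¹, this, inv_mul_cancel]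

/-- An automorphism whose values on a basis are those of a member of `L` is in `L`. -/
lemma mem_of_exists_mulVec_eq {L : List GL2Z} {g : GL2Z} {p q p' q' : Lattice}
    (h : detPair p q = 1) (hp : g.1.mulVec p = p') (hq : g.1.mulVec q = q')
    (hL : ∃ x ∈ L, x.1.mulVec p = p' ∧ x.1.mulVec q = q') : g ∈ L := by
  obtain ⟨x, hx, hxp, hxq⟩ := hL
  rwa [mulVec_inj_of_basis h (hp.trans hxp.symm) (hq.trans hxq.symm)]

namespace GroupClass

variable {c : GroupClass} {G : Subgroup GL2Z}

lemma Contains.of_le (h1 : c.subgroup ≤ G) (h2 : ∀ g ∈ G, g ∈ c.elements) : c.Contains G := by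
  rw [le_antisymm (fun g hg => mem_subgroup (h2 g hg)) h1]
  exact c.contains_subgroup

/-- A group with a single non-trivial element, which is conjugate to the generator `s` of the
representative of `c`. -/
lemma Contains.of_eq_one_or {s h : GL2Z} (hc : c.subgroup = Subgroup.closure {s}) (hne : G ≠ ⊥)
    (hG : ∀ g ∈ G, g = 1 ∨ g = h * s * h⁻¹) : c.Contains G := by
  refine ⟨h, ?_⟩
  obtain ⟨⟨g, hg⟩, hg1⟩ := Subgroup.ne_bot_iff_exists_ne_one.1 hne
  have hgs := (hG g hg).resolve_left fun h => hg1 (Subtype.ext h)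
  rw [hc, MonoidHom.map_closure, Set.image_singleton]
  refine le_antisymm (fun x hx => ?_) ?_
  · rcases hG x hx with rfl | rfl
    · exact one_mem _
    · exact Subgroup.subset_closure rfl
  · rw [Subgroup.closure_le, Set.singleton_subset_iff]
    exact (hgs ▸ hg : h * s * h⁻¹ ∈ G)

/-- The subgroups of the symmetry group of a triangle. -/
lemma contains_of_forall_mem_D6 (hne : G ≠ ⊥) (hG : ∀ g ∈ G, g ∈ D6.elements) :
    C3.Contains G ∨ D2.Contains G ∨ D6.Contains G := by
  by_cases ha : matA ^ 2 ∈ G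
  · by_cases hc : matC ∈ G
    · refine .inr (.inr (.of_le ((Subgroup.closure_le _).2 ?_) hG))
      rintro x (rfl | rfl) <;> assumption
    · refine .inl (.of_le ((Subgroup.closure_le _).2 ?_) fun g hg => ?_)
      · rintro x rfl
        exact ha
      · -- a reflection in `G` and the rotations would give `C`
        have h1 : ∀ g ∈ D6.elements, g ∈ C3.elements ∨
            ∃ i ∈ [0, 1, 2], (matA ^ 2) ^ i * g = matC := by decide
        rcases h1 g (hG g hg) with h | ⟨i, -, h⟩
        · exact h
        · exact absurd (h ▸ mul_mem (pow_mem ha i) hg) hc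
  · have h1 : ∀ g ∈ D6.elements, g = 1 ∨ g ^ 2 = matA ^ 2 ∨ g = matA ^ 2 ∨
        g ∈ [matC, matA ^ 2 * matC, (matA ^ 2) ^ 2 * matC] := by decide
    have h2 : ∀ g ∈ G, g = 1 ∨ g ∈ [matC, matA ^ 2 * matC, (matA ^ 2) ^ 2 * matC] := by
      intro g hg
      rcases h1 g (hG g hg) with h | h | h | h
      · exact .inl h
      · exact absurd (h ▸ pow_mem hg 2) ha
      · exact absurd (h ▸ hg) ha
      · exact .inr h
    obtain ⟨⟨g, hg⟩, hg1⟩ := Subgroup.ne_bot_iff_exists_ne_one.1 hne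
    have hgr := (h2 g hg).resolve_left fun h => hg1 (Subtype.ext h)
    have h3 : ∀ x ∈ [matC, matA ^ 2 * matC, (matA ^ 2) ^ 2 * matC],
        ∀ y ∈ [matC, matA ^ 2 * matC, (matA ^ 2) ^ 2 * matC], x = y ∨ x * y = matA ^ 2 ∨
          y * x = matA ^ 2 := by decide
    have h4 : ∀ x ∈ [matC, matA ^ 2 * matC, (matA ^ 2) ^ 2 * matC],
        ∃ h ∈ [1, matA, matA ^ 2], x = h * matC * h⁻¹ := by decide
    obtain ⟨k, -, hk⟩ := h4 g hgr
    refine .inr (.inl (.of_eq_one_or (h := k) rfl hne fun x hx => ?_))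
    rcases h2 x hx with h | h
    · exact .inl h
    · right
      rcases h3 x h g hgr with h' | h' | h'
      · rw [h', hk]
      · exact absurd (h' ▸ mul_mem hx hg) ha
      · exact absurd (h' ▸ mul_mem hg hx) ha

/-- The subgroups of the symmetry group of a square. -/
lemma contains_of_forall_mem_D8 (hne : G ≠ ⊥) (hG : ∀ g ∈ G, g ∈ D8.elements) :
    C2.Contains G ∨ C4.Contains G ∨ D2.Contains G ∨ D2'.Contains G ∨ D4.Contains G ∨
      D4'.Contains G ∨ D8.Contains G := by
  by_cases hb : matB ∈ G
  · by_cases hc : matC ∈ G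
    · refine .inr (.inr (.inr (.inr (.inr (.inr
        (.of_le ((Subgroup.closure_le _).2 ?_) hG))))))
      rintro x (rfl | rfl) <;> assumption
    · refine .inr (.inl (.of_le ((Subgroup.closure_le _).2 ?_) fun g hg => ?_))
      · rintro x rfl
        exact hb
      · have h1 : ∀ g ∈ D8.elements, g ∈ C4.elements ∨
            ∃ i ∈ [0, 1, 2, 3], matB ^ i * g = matC := by decide
        rcases h1 g (hG g hg) with h | ⟨i, -, h⟩
        · exact h
        · exact absurd (h ▸ mul_mem (pow_mem hb i) hg) hc
  have hb1 : ∀ g ∈ G, g ∈ [1, -1, matC, -1 * matC, matCprime, -1 * matCprime] := by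
    have h1 : ∀ g ∈ D8.elements, g = matB ∨ g ^ 3 = matB ∨
        g ∈ [1, -1, matC, -1 * matC, matCprime, -1 * matCprime] := by decide
    intro g hg
    rcases h1 g (hG g hg) with h | h | h
    · exact absurd (h ▸ hg) hb
    · exact absurd (h ▸ pow_mem hg 3) hb
    · exact h
  by_cases h2 : (-1 : GL2Z) ∈ G
  · by_cases hc : matC ∈ G
    · refine .inr (.inr (.inr (.inr (.inl (.of_le ((Subgroup.closure_le _).2 ?_)
        fun g hg => ?_)))))
      · rintro x (rfl | rfl) <;> assumption
      · have h1 : ∀ g ∈ [1, -1, matC, -1 * matC, matCprime, -1 * matCprime],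
            g ∈ D4.elements ∨ g * matC = matB ∨ matC * g = matB := by decide
        rcases h1 g (hb1 g hg) with h | h | h
        · exact h
        · exact absurd (h ▸ mul_mem hg hc) hb
        · exact absurd (h ▸ mul_mem hc hg) hb
    · have hc1 : ∀ g ∈ G, g ∈ D4'.elements := by
        have h1 : ∀ g ∈ [1, -1, matC, -1 * matC, matCprime, -1 * matCprime],
            g ∈ D4'.elements ∨ g = matC ∨ -1 * g = matC := by decide
        intro g hg
        rcases h1 g (hb1 g hg) with h | h | h
        · exact h
        · exact absurd (h ▸ hg) hc
        · exact absurd (h ▸ mul_mem h2 hg) hc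
      by_cases hc' : matCprime ∈ G
      · refine .inr (.inr (.inr (.inr (.inr (.inl (.of_le ((Subgroup.closure_le _).2 ?_) hc1))))))
        rintro x (rfl | rfl) <;> assumption
      · refine .inl (.of_le ((Subgroup.closure_le _).2 ?_) fun g hg => ?_)
        · rintro x rfl
          exact h2
        · have h1 : ∀ g ∈ D4'.elements, g ∈ C2.elements ∨ g = matCprime ∨ -1 * g = matCprime := by
            decide
          rcases h1 g (hc1 g hg) with h | h | h
          · exact h
          · exact absurd (h ▸ hg) hc'
          · exact absurd (h ▸ mul_mem h2 hg) hc'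
  · have h3 : ∀ g ∈ G, g = 1 ∨ g ∈ [matC, -1 * matC, matCprime, -1 * matCprime] := by
      have h1 : ∀ g ∈ [1, -1, matC, -1 * matC, matCprime, -1 * matCprime],
          g = -1 ∨ g = 1 ∨ g ∈ [matC, -1 * matC, matCprime, -1 * matCprime] := by decide
      intro g hg
      rcases h1 g (hb1 g hg) with h | h
      · exact absurd (h ▸ hg) h2
      · exact h
    obtain ⟨⟨g, hg⟩, hg1⟩ := Subgroup.ne_bot_iff_exists_ne_one.1 hne
    have hgr := (h3 g hg).resolve_left fun h => hg1 (Subtype.ext h)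
    have h4 : ∀ x ∈ [matC, -1 * matC, matCprime, -1 * matCprime],
        ∀ y ∈ [matC, -1 * matC, matCprime, -1 * matCprime], x = y ∨ x * y = -1 ∨ x * y = matB ∨
          y * x = matB := by decide
    have h5 : ∀ x ∈ [matC, -1 * matC, matCprime, -1 * matCprime],
        ∃ h ∈ [1, matB], x = h * matC * h⁻¹ ∨ x = h * matCprime * h⁻¹ := by decide
    have h6 : ∀ x ∈ G, x = 1 ∨ x = g := by
      intro x hx
      rcases h3 x hx with h | h
      · exact .inl h
      · rcases h4 x h g hgr with h' | h' | h' | h'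
        · exact .inr h'
        · exact absurd (h' ▸ mul_mem hx hg) h2
        · exact absurd (h' ▸ mul_mem hx hg) hb
        · exact absurd (h' ▸ mul_mem hg hx) hb
    obtain ⟨k, -, hk | hk⟩ := h5 g hgr
    · exact .inr (.inr (.inl (.of_eq_one_or (h := k) rfl hne (hk ▸ h6))))
    · exact .inr (.inr (.inr (.inl (.of_eq_one_or (h := k) rfl hne (hk ▸ h6)))))

/-- The reflections of the hexagon that fix no vertex. -/
def edgeReflections : List GL2Z := [matA * matC, matA ^ 3 * matC, matA ^ 5 * matC]

/-- The rotations of order `3` permute the three reflections transitively by multiplication. -/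
lemma subset_of_mem_edgeReflections (ha : matA ^ 2 ∈ G) {g : GL2Z} (hg : g ∈ G)
    (hgr : g ∈ edgeReflections) : ∀ x ∈ edgeReflections, x ∈ G := by
  have h1 : ∀ g ∈ edgeReflections, ∀ x ∈ edgeReflections,
      ∃ i ∈ [0, 1, 2], (matA ^ 2) ^ i * g = x := by decide
  intro x hx
  obtain ⟨i, -, rfl⟩ := h1 g hgr x hx
  exact mul_mem (pow_mem ha i) hg

/-- The subgroups of the symmetry group of a hexagon, in which three consecutive vertices are moved
to adjacent vertices: without the rotation `A` this is done by reflections that fix no vertex, and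
one such reflection moves only two of the vertices to adjacent ones. -/
lemma contains_of_forall_mem_D12 (hG : ∀ g ∈ G, g ∈ D12.elements)
    (h1 : ∃ g ∈ G, g.1.mulVec ![1, 0] = ![1, 1] ∨ g.1.mulVec ![1, 0] = ![0, -1])
    (h2 : ∃ g ∈ G, g.1.mulVec ![1, 1] = ![0, 1] ∨ g.1.mulVec ![1, 1] = ![1, 0])
    (h3 : ∃ g ∈ G, g.1.mulVec ![0, 1] = ![-1, 0] ∨ g.1.mulVec ![0, 1] = ![1, 1]) :
    C6.Contains G ∨ D6'.Contains G ∨ D12.Contains G := by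
  by_cases ha : matA ∈ G
  · by_cases hc : matC ∈ G
    · refine .inr (.inr (.of_le ((Subgroup.closure_le _).2 ?_) hG))
      rintro x (rfl | rfl) <;> assumption
    · refine .inl (.of_le ((Subgroup.closure_le _).2 ?_) fun g hg => ?_)
      · rintro x rfl
        exact ha
      · have h1 : ∀ g ∈ D12.elements, g ∈ C6.elements ∨
            ∃ i ∈ [0, 1, 2, 3, 4, 5], matA ^ i * g = matC := by decide
        rcases h1 g (hG g hg) with h | ⟨i, -, h⟩
        · exact h
        · exact absurd (h ▸ mul_mem (pow_mem ha i) hg) hc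
  right; left
  obtain ⟨g₁, hg₁, h1⟩ := h1
  obtain ⟨g₂, hg₂, h2⟩ := h2
  obtain ⟨g₃, hg₃, h3⟩ := h3
  have e1 : ∀ g ∈ D12.elements, (g.1.mulVec ![1, 0] = ![1, 1] ∨ g.1.mulVec ![1, 0] = ![0, -1]) →
      g = matA ∨ g ^ 5 = matA ∨ g = matA ^ 3 * matC ∨ g = matA ^ 5 * matC := by decide
  have e2 : ∀ g ∈ D12.elements, (g.1.mulVec ![1, 1] = ![0, 1] ∨ g.1.mulVec ![1, 1] = ![1, 0]) →
      g = matA ∨ g ^ 5 = matA ∨ g = matA * matC ∨ g = matA ^ 5 * matC := by decide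
  have e3 : ∀ g ∈ D12.elements, (g.1.mulVec ![0, 1] = ![-1, 0] ∨ g.1.mulVec ![0, 1] = ![1, 1]) →
      g = matA ∨ g ^ 5 = matA ∨ g = matA * matC ∨ g = matA ^ 3 * matC := by decide
  have hrot : ∀ {g : GL2Z} {P : Prop}, g ∈ G → (g = matA ∨ g ^ 5 = matA ∨ P) → P := by
    rintro g P hg (rfl | h | h)
    · exact absurd hg ha
    · exact absurd (h ▸ pow_mem hg 5) ha
    · exact h
  have f1 := hrot hg₁ (e1 g₁ (hG g₁ hg₁) h1)
  have f2 := hrot hg₂ (e2 g₂ (hG g₂ hg₂) h2)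
  have f3 := hrot hg₃ (e3 g₃ (hG g₃ hg₃) h3)
  have m13 : (matA ^ 3 * matC) * (matA * matC) = matA ^ 2 := by decide
  have m35 : (matA ^ 5 * matC) * (matA ^ 3 * matC) = matA ^ 2 := by decide
  have m15 : (matA * matC) * (matA ^ 5 * matC) = matA ^ 2 := by decide
  have ha2 : matA ^ 2 ∈ G := by
    rcases f1 with rfl | rfl
    · rcases f2 with rfl | rfl
      · exact m13 ▸ mul_mem hg₁ hg₂
      · exact m35 ▸ mul_mem hg₂ hg₁
    · rcases f3 with rfl | rfl
      · exact m15 ▸ mul_mem hg₃ hg₁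
      · exact m35 ▸ mul_mem hg₁ hg₃
  have hc : -matC ∈ G := by
    refine subset_of_mem_edgeReflections ha2 hg₁ ?_ _ (by decide)
    rcases f1 with rfl | rfl <;> decide
  refine .of_le ((Subgroup.closure_le _).2 ?_) fun g hg => ?_
  · rintro x (rfl | rfl) <;> assumption
  · have h1 : ∀ g ∈ D12.elements, g ∈ D6'.elements ∨ (∃ i ∈ [0, 1, 2], (matA ^ 2) ^ i * g = matA) ∨
        ∃ i ∈ [0, 1, 2], (matA ^ 2) ^ i * (g * -matC) = matA := by decide
    rcases h1 g (hG g hg) with h | ⟨i, -, h⟩ | ⟨i, -, h⟩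
    · exact h
    · exact absurd (h ▸ mul_mem (pow_mem ha2 i) hg) ha
    · exact absurd (h ▸ mul_mem (pow_mem ha2 i) (mul_mem hg hc)) ha

/-- A group of symmetries of the hexagon in one of the classes `C6`, `D6'` and `D12` contains the
rotation `A` or all the reflections that fix no vertex. In the class `D6'`, reflections that fix a
vertex are excluded by the fixed vector modulo `3`. -/
lemma matA_mem_or_of_contains (hG : ∀ g ∈ G, g ∈ D12.elements) (hc : c.Contains G)
    (hcl : c = C6 ∨ c = D6' ∨ c = D12) : matA ∈ G ∨ ∀ x ∈ edgeReflections, x ∈ G := by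
  have key : ∀ t d, HasType c.subgroup t d → HasType G t d := by
    obtain ⟨k, rfl⟩ := hc
    exact fun t d h => h.map_conj k
  have h0 : (c = C6 ∨ c = D12) → matA ∈ G := by
    intro h
    obtain ⟨g, hg, ht, hd⟩ := key 1 1 ⟨matA, by
      rw [mem_subgroup_iff]
      rcases h with rfl | rfl <;> decide, by decide, by decide⟩
    have h1 : ∀ g ∈ D12.elements, g.1.trace = 1 → g.1.det = 1 → g = matA ∨ g ^ 5 = matA := by
      decide
    rcases h1 g (hG g hg) ht hd with h | h
    · exact h ▸ hg
    · exact h ▸ pow_mem hg 5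
  rcases hcl with rfl | rfl | rfl
  · exact .inl (h0 (.inl rfl))
  · right
    obtain ⟨g, hg, ht, hd⟩ := key (-1) 1 ⟨matA ^ 2, by rw [mem_subgroup_iff]; decide, by decide,
      by decide⟩
    obtain ⟨r, hr, hrt, hrd⟩ := key 0 (-1) ⟨-matC, by rw [mem_subgroup_iff]; decide, by decide,
      by decide⟩
    have h1 : ∀ g ∈ D12.elements, g.1.trace = -1 → g.1.det = 1 → g = matA ^ 2 ∨ g ^ 2 = matA ^ 2 := by
      decide
    have ha2 : matA ^ 2 ∈ G := by
      rcases h1 g (hG g hg) ht hd with h | h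
      · exact h ▸ hg
      · exact h ▸ pow_mem hg 2
    have h2 : ∀ g ∈ D12.elements, g.1.trace = 0 → g.1.det = -1 → g ∈ edgeReflections ∨
        ∃ i ∈ [0, 1, 2], (matA ^ 2) ^ i * g = matC := by decide
    rcases h2 r (hG r hr) hrt hrd with h | ⟨i, -, h⟩
    · exact subset_of_mem_edgeReflections ha2 hr h
    · exfalso
      have hC : matC ∈ G := h ▸ mul_mem (pow_mem ha2 i) hr
      obtain ⟨k, rfl⟩ := hc
      obtain ⟨v, hv, hfix⟩ := exists_isFixedMod_map_conj (n := 3) k (G := D6'.subgroup) (by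
        simp only [isFixedMod_subgroup_iff]
        decide)
      have h3 : ∀ v : Fin 2 → ZMod 3, (((matA ^ 2).1.map (Int.castRingHom (ZMod 3))).mulVec v = v ∧
          (matC.1.map (Int.castRingHom (ZMod 3))).mulVec v = v) → v = 0 := by decide
      exact hv (h3 v ⟨hfix _ ha2, hfix _ hC⟩)
  · exact .inl (h0 (.inr rfl))

end GroupClass

namespace Fan

/-! ### The standard fans -/

variable {Δ Δ' : Fan} {G : Subgroup GL2Z} {v w : Lattice}

section OfPairs

variable {P : Finset (Lattice × Lattice)} {h1 h2 h3}

lemma pair_mem_ofPairs (h : (v, w) ∈ P) : {v, w} ∈ (ofPairs P h1 h2 h3).cones :=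
  Finset.mem_biUnion.2 ⟨(v, w), h, Finset.mem_powerset_self _⟩

lemma exists_of_ray_mem_ofPairs (h : {v} ∈ (ofPairs P h1 h2 h3).cones) :
    ∃ c ∈ P, v = c.1 ∨ v = c.2 := by
  obtain ⟨c, hc, h⟩ := Finset.mem_biUnion.1 h
  exact ⟨c, hc, by simpa using h⟩

lemma mem_or_mem_of_pair_mem_ofPairs (h : {v, w} ∈ (ofPairs P h1 h2 h3).cones) (hne : v ≠ w) :
    (v, w) ∈ P ∨ (w, v) ∈ P := by
  obtain ⟨⟨p, q⟩, hc, h⟩ := Finset.mem_biUnion.1 h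
  rw [Finset.mem_powerset] at h
  have hv := h (show v ∈ ({v, w} : Finset Lattice) by simp)
  have hw := h (show w ∈ ({v, w} : Finset Lattice) by simp)
  simp only [Finset.mem_insert, Finset.mem_singleton] at hv hw
  rcases hv with rfl | rfl <;> rcases hw with rfl | rfl
  · exact absurd rfl hne
  · exact .inl hc
  · exact .inr hc
  · exact absurd rfl hne

lemma star_ofPairs {u : Lattice} {a : ℤ} (hl : (u, v) ∈ P) (hr : (v, w) ∈ P)
    (h : u + w = a • v) : (ofPairs P h1 h2 h3).Star u v w a :=
  Star.of_pairs (pair_mem_ofPairs hl) (pair_mem_ofPairs hr) (h1 _ hl) (h1 _ hr) h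

lemma MapsTo.mem_or_mem {g : GL2Z} (hg : MapsTo g (ofPairs P h1 h2 h3) (ofPairs P h1 h2 h3))
    (h : (v, w) ∈ P) : (g.1.mulVec v, g.1.mulVec w) ∈ P ∨ (g.1.mulVec w, g.1.mulVec v) ∈ P := by
  refine mem_or_mem_of_pair_mem_ofPairs (hg.pair (pair_mem_ofPairs h)) fun e => ?_
  have h4 := h1 _ h
  rw [show v = w from mulVec_injective g e, detPair_self] at h4
  exact zero_ne_one h4

end OfPairs

lemma Star.eq_one_of_isNegOneRay {u : Lattice} {a : ℤ} (S : Δ.Star u v w a)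
    (h : Δ.IsNegOneRay v) : a = 1 := by
  obtain ⟨_, _, T⟩ := h
  exact (S.unique T).2.2

lemma isRayMinimal_of_forall_not (h : ∀ v, ¬ Δ.IsNegOneRay v) : Δ.IsRayMinimal G := by
  rintro ⟨S, ⟨v, hv⟩, h1, -⟩
  exact h v (h1 v hv)

/-- In a minimal fan every `(-1)`-ray is adjacent to another ray of its orbit, since otherwise the
orbit could be contracted. -/
lemma IsRayMinimal.exists_adjacent (hG : ∀ g ∈ G, MapsTo g Δ Δ) (hmin : Δ.IsRayMinimal G)
    (hv : Δ.IsNegOneRay v) : ∃ g ∈ G, {v, g.1.mulVec v} ∈ Δ.cones ∧ v ≠ g.1.mulVec v := by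
  by_contra! hno
  refine hmin ⟨{x | ∃ g ∈ G, x = g.1.mulVec v}, ⟨v, 1, one_mem _, by simp⟩, ?_, ?_, ?_⟩
  · rintro _ ⟨g, hg, rfl⟩
    exact hv.map (hG g hg)
  · rintro _ ⟨g, hg, rfl⟩ _ ⟨g', hg', rfl⟩ hne hpair
    have h1 := (hG g hg).inv.pair hpair
    rw [inv_mulVec_mulVec, Matrix.mulVec_mulVec, ← Units.val_mul] at h1
    have h2 := hno (g⁻¹ * g') (mul_mem (inv_mem hg) hg') h1
    rw [Units.val_mul, ← Matrix.mulVec_mulVec] at h2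
    apply hne
    nth_rw 1 [h2]
    exact mulVec_inv_mulVec g _
  · rintro g hg _ ⟨g', hg', rfl⟩
    exact ⟨g * g', mul_mem hg hg', by rw [Units.val_mul, Matrix.mulVec_mulVec]⟩

lemma isRayMinimal_of_exists_adjacent
    (h : ∀ v, {v} ∈ Δ.cones → ∃ g ∈ G, {v, g.1.mulVec v} ∈ Δ.cones ∧ v ≠ g.1.mulVec v) :
    Δ.IsRayMinimal G := by
  rintro ⟨S, ⟨v, hv⟩, h1, h2, h3⟩
  obtain ⟨g, hg, hpair, hne⟩ := h v (h1 v hv).mem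
  exact h2 v hv _ (h3 g hg v hv) hne hpair

lemma MapsTo.comp {Δ'' : Fan} {g h : GL2Z} (hg : MapsTo g Δ Δ') (hh : MapsTo h Δ' Δ'') :
    MapsTo (h * g) Δ Δ'' := by
  intro σ hσ
  have := hh _ (hg σ hσ)
  rw [Finset.image_image] at this
  convert this using 2
  ext1 v
  simp only [Function.comp_apply, Units.val_mul, Matrix.mulVec_mulVec]

lemma MapsTo.conj {h : GL2Z} (hh : MapsTo h Δ Δ') (hG : ∀ g ∈ G, MapsTo g Δ Δ) :
    ∀ g ∈ G.map (MulAut.conj h).toMonoidHom, MapsTo g Δ' Δ' := by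
  rintro _ ⟨g, hg, rfl⟩
  change MapsTo (h * g * h⁻¹) Δ' Δ'
  rw [mul_assoc]
  exact (hh.inv.comp (hG g hg)).comp hh

/-- Minimality is transported along an isomorphism `h` of fans, together with the group. -/
lemma IsRayMinimal.of_mapsTo {h : GL2Z} (hh : MapsTo h Δ Δ')
    (hmin : Δ'.IsRayMinimal (G.map (MulAut.conj h).toMonoidHom)) : Δ.IsRayMinimal G := by
  rintro ⟨S, ⟨v, hv⟩, h1, h2, h3⟩
  refine hmin ⟨(fun v => h.1.mulVec v) '' S, ⟨_, v, hv, rfl⟩, ?_, ?_, ?_⟩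
  · rintro _ ⟨v, hv, rfl⟩
    exact (h1 v hv).map hh
  · rintro _ ⟨v, hv, rfl⟩ _ ⟨w, hw, rfl⟩ hne hpair
    have := hh.inv.pair hpair
    rw [inv_mulVec_mulVec, inv_mulVec_mulVec] at this
    exact h2 v hv w hw (fun e => hne (by rw [e])) this
  · rintro _ ⟨g, hg, rfl⟩ _ ⟨v, hv, rfl⟩
    refine ⟨_, h3 g hg v hv, ?_⟩
    change h.1.mulVec (g.1.mulVec v) = (h * g * h⁻¹).1.mulVec (h.1.mulVec v)
    rw [Units.val_mul, Units.val_mul, ← Matrix.mulVec_mulVec, ← Matrix.mulVec_mulVec,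
      inv_mulVec_mulVec]

lemma IsRayMinimal.map_conj {h : GL2Z} (hh : MapsTo h Δ Δ') (hmin : Δ.IsRayMinimal G) :
    Δ'.IsRayMinimal (G.map (MulAut.conj h).toMonoidHom) := by
  refine IsRayMinimal.of_mapsTo hh.inv ?_
  rwa [map_conj_map_conj, inv_mul_cancel, map_conj_one]

lemma not_isNegOneRay_fanP2 (v : Lattice) : ¬ fanP2.IsNegOneRay v := by
  intro h
  have S : ∃ u w, fanP2.Star u v w (-1) := by
    obtain ⟨c, hc, hv⟩ := exists_of_ray_mem_ofPairs h.mem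
    simp only [Finset.mem_insert, Finset.mem_singleton] at hc
    have S1 : fanP2.Star ![-1, -1] ![1, 0] ![0, 1] (-1) :=
      star_ofPairs (by simp) (by simp) (by simp)
    have S2 : fanP2.Star ![1, 0] ![0, 1] ![-1, -1] (-1) :=
      star_ofPairs (by simp) (by simp) (by simp)
    have S3 : fanP2.Star ![0, 1] ![-1, -1] ![1, 0] (-1) :=
      star_ofPairs (by simp) (by simp) (by simp)
    rcases hc with rfl | rfl | rfl <;> rcases hv with rfl | rfl <;>
      first | exact ⟨_, _, S1⟩ | exact ⟨_, _, S2⟩ | exact ⟨_, _, S3⟩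
  obtain ⟨u, w, S⟩ := S
  have := S.eq_one_of_isNegOneRay h
  omega

lemma mem_D6_of_mapsTo {g : GL2Z} (hg : MapsTo g fanP2 fanP2) :
    g ∈ GroupClass.D6.elements := by
  have h := MapsTo.mem_or_mem hg (v := ![1, 0]) (w := ![0, 1]) (by simp)
  simp only [Finset.mem_insert, Finset.mem_singleton, Prod.mk.injEq] at h
  rcases h with (⟨h1, h2⟩ | ⟨h1, h2⟩ | ⟨h1, h2⟩) | (⟨h2, h1⟩ | ⟨h2, h1⟩ | ⟨h2, h1⟩) <;>
    exact mem_of_exists_mulVec_eq (by simp [detPair]) h1 h2 (by decide)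

section Hirzebruch

variable (k : ℕ)

lemma star_fanHirzebruch_fiber : (fanHirzebruch k).Star ![0, -1] ![1, 0] ![0, 1] 0 :=
  star_ofPairs (by simp) (by simp) (by simp)

lemma star_fanHirzebruch_fiber' : (fanHirzebruch k).Star ![0, 1] ![-1, k] ![0, -1] 0 :=
  star_ofPairs (by simp) (by simp) (by simp)

lemma star_fanHirzebruch_section : (fanHirzebruch k).Star ![1, 0] ![0, 1] ![-1, k] k :=
  star_ofPairs (by simp) (by simp) (by simp)

lemma star_fanHirzebruch_section' : (fanHirzebruch k).Star ![-1, k] ![0, -1] ![1, 0] (-k) :=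
  star_ofPairs (by simp) (by simp) (by simp)

variable {k}

lemma ray_fanHirzebruch (h : {v} ∈ (fanHirzebruch k).cones) :
    v = ![1, 0] ∨ v = ![0, 1] ∨ v = ![-1, (k : ℤ)] ∨ v = ![0, -1] := by
  obtain ⟨c, hc, hv⟩ := exists_of_ray_mem_ofPairs h
  simp only [Finset.mem_insert, Finset.mem_singleton] at hc
  rcases hc with rfl | rfl | rfl | rfl <;> rcases hv with rfl | rfl <;> simp

lemma not_isNegOneRay_fanHirzebruch (hk : k ≠ 1) (v : Lattice) :
    ¬ (fanHirzebruch k).IsNegOneRay v := by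
  intro h
  rcases ray_fanHirzebruch h.mem with rfl | rfl | rfl | rfl
  · exact zero_ne_one ((star_fanHirzebruch_fiber k).eq_one_of_isNegOneRay h)
  · exact hk (by exact_mod_cast (star_fanHirzebruch_section k).eq_one_of_isNegOneRay h)
  · exact zero_ne_one ((star_fanHirzebruch_fiber' k).eq_one_of_isNegOneRay h)
  · have := (star_fanHirzebruch_section' k).eq_one_of_isNegOneRay h
    omega

lemma mem_D8_of_mapsTo {g : GL2Z} (hg : MapsTo g (fanHirzebruch 0) (fanHirzebruch 0)) :
    g ∈ GroupClass.D8.elements := by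
  have h := MapsTo.mem_or_mem hg (v := ![1, 0]) (w := ![0, 1]) (by simp)
  simp only [Finset.mem_insert, Finset.mem_singleton, Prod.mk.injEq] at h
  rcases h with (⟨h1, h2⟩ | ⟨h1, h2⟩ | ⟨h1, h2⟩ | ⟨h1, h2⟩) |
      (⟨h2, h1⟩ | ⟨h2, h1⟩ | ⟨h2, h1⟩ | ⟨h2, h1⟩) <;>
    exact mem_of_exists_mulVec_eq (by simp [detPair]) h1 h2 (by decide)

/-- For `k ≥ 1` the section of self-intersection `-k` is fixed by automorphisms. -/
lemma mulVec_of_mapsTo_fanHirzebruch (hk : 1 ≤ k) {g : GL2Z}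
    (hg : MapsTo g (fanHirzebruch k) (fanHirzebruch k)) :
    g.1.mulVec ![0, 1] = ![0, 1] ∧ (g.1.mulVec ![1, 0] = ![1, 0] ∨
      g.1.mulVec ![1, 0] = ![-1, (k : ℤ)]) := by
  have hS := (star_fanHirzebruch_section k).map hg
  have h1 : g.1.mulVec ![0, 1] = ![0, 1] := by
    have T : ∃ u w, (fanHirzebruch k).Star u (g.1.mulVec ![0, 1]) w k := by
      rcases hS with T | T
      · exact ⟨_, _, T⟩
      · exact ⟨_, _, T⟩
    obtain ⟨u, w, T⟩ := T
    rcases ray_fanHirzebruch T.mem with h | h | h | h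
    · rw [h] at T
      have := (T.unique (star_fanHirzebruch_fiber k)).2.2
      omega
    · exact h
    · rw [h] at T
      have := (T.unique (star_fanHirzebruch_fiber' k)).2.2
      omega
    · rw [h] at T
      have := (T.unique (star_fanHirzebruch_section' k)).2.2
      omega
  refine ⟨h1, ?_⟩
  rw [h1] at hS
  rcases hS with T | T
  · exact .inl (T.unique (star_fanHirzebruch_section k)).1
  · exact .inr (T.unique (star_fanHirzebruch_section k)).2.1

/-- For `k ≥ 1` the only non-trivial automorphism of the fan of `F_k` is the reflection that
exchanges the two fibres. -/
lemma eq_one_or_of_mapsTo_fanHirzebruch (hk : 1 ≤ k) {g r : GL2Z}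
    (hg : MapsTo g (fanHirzebruch k) (fanHirzebruch k)) (h1 : r.1.mulVec ![0, 1] = ![0, 1])
    (h2 : r.1.mulVec ![1, 0] = ![-1, (k : ℤ)]) : g = 1 ∨ g = r := by
  have hd : detPair ![1, 0] ![0, 1] = 1 := by simp [detPair]
  obtain ⟨e1, e2 | e2⟩ := mulVec_of_mapsTo_fanHirzebruch hk hg
  · exact .inl (eq_one_of_mulVec_eq hd e2 e1)
  · exact .inr (mulVec_inj_of_basis hd (e2.trans h2.symm) (e1.trans h1.symm))

lemma conj_mulVec (h s : GL2Z) (p : Lattice) :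
    (h * s * h⁻¹).1.mulVec (h.1.mulVec p) = h.1.mulVec (s.1.mulVec p) := by
  rw [Units.val_mul, Units.val_mul, ← Matrix.mulVec_mulVec, ← Matrix.mulVec_mulVec,
    inv_mulVec_mulVec]

lemma matC_mulVec (x y : ℤ) : matC.1.mulVec ![x, y] = ![y, x] := by
  ext i
  fin_cases i <;> simp [matC, Matrix.mulVec, dotProduct, Fin.sum_univ_two]

lemma matCprime_mulVec (x y : ℤ) : matCprime.1.mulVec ![x, y] = ![x, -y] := by
  ext i
  fin_cases i <;> simp [matCprime, Matrix.mulVec, dotProduct, Fin.sum_univ_two]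

/-- For odd `k` the reflection of the fan of `F_k` exchanges the two vectors of a basis. -/
lemma D2_contains_of_mapsTo {m : ℕ} (hne : G ≠ ⊥)
    (hG : ∀ g ∈ G, MapsTo g (fanHirzebruch (2 * m + 1)) (fanHirzebruch (2 * m + 1))) :
    GroupClass.D2.Contains G := by
  have hd : detPair ![1, -(m : ℤ)] ![-1, (m : ℤ) + 1] = 1 := by simp [detPair]
  refine .of_eq_one_or (h := ofColumns _ _ hd) rfl hne fun g hg =>
    eq_one_or_of_mapsTo_fanHirzebruch (by omega) (hG g hg) ?_ ?_
  · have h1 : (![0, 1] : Lattice) = (ofColumns _ _ hd).1.mulVec ![1, 1] := by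
      rw [ofColumns_mulVec]
      ext i
      fin_cases i <;> simp
    rw [h1, conj_mulVec, matC_mulVec]
  · have h1 : (![1, 0] : Lattice) = (ofColumns _ _ hd).1.mulVec ![(m : ℤ) + 1, m] := by
      rw [ofColumns_mulVec]
      ext i
      fin_cases i <;> simp
      ring
    rw [h1, conj_mulVec, matC_mulVec, ofColumns_mulVec]
    ext i
    fin_cases i <;> simp
    ring

/-- For even `k` the reflection of the fan of `F_k` is diagonal in a suitable basis. -/
lemma D2'_contains_of_mapsTo {m : ℕ} (hm : 1 ≤ m) (hne : G ≠ ⊥)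
    (hG : ∀ g ∈ G, MapsTo g (fanHirzebruch (2 * m)) (fanHirzebruch (2 * m))) :
    GroupClass.D2'.Contains G := by
  have hd : detPair ![0, 1] ![-1, (m : ℤ)] = 1 := by simp [detPair]
  refine .of_eq_one_or (h := ofColumns _ _ hd) rfl hne fun g hg =>
    eq_one_or_of_mapsTo_fanHirzebruch (by omega) (hG g hg) ?_ ?_
  · have h1 : (![0, 1] : Lattice) = (ofColumns _ _ hd).1.mulVec ![1, 0] := by
      rw [ofColumns_mulVec]
      ext i
      fin_cases i <;> simp
    refine (congrArg _ h1).trans ?_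
    rw [conj_mulVec, matCprime_mulVec, neg_zero]
    exact h1.symm
  · have h1 : (![1, 0] : Lattice) = (ofColumns _ _ hd).1.mulVec ![(m : ℤ), -1] := by
      rw [ofColumns_mulVec]
      ext i
      fin_cases i <;> simp
    rw [h1, conj_mulVec, matCprime_mulVec, ofColumns_mulVec]
    ext i
    fin_cases i <;> simp
    ring

/-- The exceptional section of `F₁` is fixed by all automorphisms. -/
lemma not_isRayMinimal_fanHirzebruch_one (hG : ∀ g ∈ G, MapsTo g (fanHirzebruch 1)
    (fanHirzebruch 1)) : ¬ (fanHirzebruch 1).IsRayMinimal G := by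
  refine fun h => h ⟨{![0, 1]}, ⟨_, rfl⟩, ?_, ?_, ?_⟩
  · rintro _ rfl
    exact ⟨_, _, star_fanHirzebruch_section 1⟩
  · rintro _ rfl _ rfl hne
    exact absurd rfl hne
  · rintro g hg _ rfl
    exact (mulVec_of_mapsTo_fanHirzebruch le_rfl (hG g hg)).1

end Hirzebruch

section DelPezzo

lemma ray_fanDP6 (h : {v} ∈ fanDP6.cones) :
    v ∈ [![1, 0], ![1, 1], ![0, 1], ![-1, 0], ![-1, -1], ![0, -1]] := by
  obtain ⟨c, hc, hv⟩ := exists_of_ray_mem_ofPairs h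
  simp only [Finset.mem_insert, Finset.mem_singleton] at hc
  rcases hc with rfl | rfl | rfl | rfl | rfl | rfl <;> rcases hv with rfl | rfl <;> simp

/-- The pairs of adjacent rays of the hexagon, in counterclockwise order. -/
def hexagonEdges : List (Lattice × Lattice) :=
  [(![1, 0], ![1, 1]), (![1, 1], ![0, 1]), (![0, 1], ![-1, 0]), (![-1, 0], ![-1, -1]),
    (![-1, -1], ![0, -1]), (![0, -1], ![1, 0])]

lemma pair_mem_fanDP6 (h : (v, w) ∈ hexagonEdges ∨ (w, v) ∈ hexagonEdges) :
    {v, w} ∈ fanDP6.cones := by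
  rcases h with h | h
  · exact pair_mem_ofPairs (by simpa [hexagonEdges] using h)
  · rw [Finset.pair_comm]
    exact pair_mem_ofPairs (by simpa [hexagonEdges] using h)

lemma mem_hexagonEdges (h : {v, w} ∈ fanDP6.cones) (hne : v ≠ w) :
    (v, w) ∈ hexagonEdges ∨ (w, v) ∈ hexagonEdges := by
  have := mem_or_mem_of_pair_mem_ofPairs h hne
  simpa [hexagonEdges] using this

lemma mem_D12_of_mapsTo {g : GL2Z} (hg : MapsTo g fanDP6 fanDP6) :
    g ∈ GroupClass.D12.elements := by
  have h := MapsTo.mem_or_mem hg (v := ![1, 0]) (w := ![1, 1]) (by simp)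
  simp only [Finset.mem_insert, Finset.mem_singleton, Prod.mk.injEq] at h
  rcases h with (⟨h1, h2⟩ | ⟨h1, h2⟩ | ⟨h1, h2⟩ | ⟨h1, h2⟩ | ⟨h1, h2⟩ | ⟨h1, h2⟩) |
      (⟨h2, h1⟩ | ⟨h2, h1⟩ | ⟨h2, h1⟩ | ⟨h2, h1⟩ | ⟨h2, h1⟩ | ⟨h2, h1⟩) <;>
    exact mem_of_exists_mulVec_eq (by simp [detPair]) h1 h2 (by decide)

/-- All rays of the hexagon are `(-1)`-rays, so a group for which it is minimal moves each of them
to an adjacent one. -/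
lemma contains_of_isRayMinimal_fanDP6 (hG : ∀ g ∈ G, MapsTo g fanDP6 fanDP6)
    (hmin : fanDP6.IsRayMinimal G) : GroupClass.C6.Contains G ∨ GroupClass.D6'.Contains G ∨
      GroupClass.D12.Contains G := by
  have key : ∀ {v p q : Lattice}, fanDP6.IsNegOneRay v →
      (∀ c ∈ hexagonEdges, c.1 = v → c.2 = p) → (∀ c ∈ hexagonEdges, c.2 = v → c.1 = q) →
      ∃ g ∈ G, g.1.mulVec v = p ∨ g.1.mulVec v = q := by
    intro v p q hv hp hq
    obtain ⟨g, hg, h, hne⟩ := hmin.exists_adjacent hG hv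
    refine ⟨g, hg, ?_⟩
    rcases mem_hexagonEdges h hne with h | h
    · exact .inl (hp _ h rfl)
    · exact .inr (hq _ h rfl)
  refine GroupClass.contains_of_forall_mem_D12 (fun g hg => mem_D12_of_mapsTo (hG g hg))
    (key ⟨![0, -1], ![1, 1], ?_⟩ (by decide) (by decide))
    (key ⟨![1, 0], ![0, 1], ?_⟩ (by decide) (by decide))
    (key ⟨![1, 1], ![-1, 0], ?_⟩ (by decide) (by decide)) <;>
  exact star_ofPairs (by simp) (by simp) (by simp)

lemma isRayMinimal_fanDP6 (hG : ∀ g ∈ G, MapsTo g fanDP6 fanDP6) {c : GroupClass}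
    (hc : c.Contains G) (hcl : c = .C6 ∨ c = .D6' ∨ c = .D12) : fanDP6.IsRayMinimal G := by
  refine isRayMinimal_of_exists_adjacent fun v hv => ?_
  suffices h : ∃ g ∈ G, ((v, g.1.mulVec v) ∈ hexagonEdges ∨ (g.1.mulVec v, v) ∈ hexagonEdges) ∧
      v ≠ g.1.mulVec v by
    obtain ⟨g, hg, h, hne⟩ := h
    exact ⟨g, hg, pair_mem_fanDP6 h, hne⟩
  have hray := ray_fanDP6 hv
  rcases GroupClass.matA_mem_or_of_contains (fun g hg => mem_D12_of_mapsTo (hG g hg)) hc hcl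
    with hA | hR
  · have h1 : ∀ v ∈ [![1, 0], ![1, 1], ![0, 1], ![-1, 0], ![-1, -1], ![0, -1]],
        ((v, matA.1.mulVec v) ∈ hexagonEdges ∨ (matA.1.mulVec v, v) ∈ hexagonEdges) ∧
          v ≠ matA.1.mulVec v := by decide
    exact ⟨matA, hA, h1 v hray⟩
  · have h1 : ∀ v ∈ [![1, 0], ![1, 1], ![0, 1], ![-1, 0], ![-1, -1], ![0, -1]],
        ∃ g ∈ GroupClass.edgeReflections,
        ((v, g.1.mulVec v) ∈ hexagonEdges ∨ (g.1.mulVec v, v) ∈ hexagonEdges) ∧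
          v ≠ g.1.mulVec v := by decide
    obtain ⟨g, hg, h⟩ := h1 v hray
    exact ⟨g, hR g hg, h⟩

end DelPezzo

end Fan

/-! ### The classification -/

variable (K : Type u) [Field K] {Δ Δ' : Fan} {G : Subgroup GL2Z}

lemma map_conj_ne_bot (hne : G ≠ ⊥) (h : GL2Z) : G.map (MulAut.conj h).toMonoidHom ≠ ⊥ := by
  rwa [Ne, Subgroup.map_eq_bot_iff_of_injective _ (MulAut.conj h).injective]

/-- A minimal fan is standard, and its group is one of the subgroups of the automorphism group of
the standard fan for which it is minimal. -/
lemma Fan.exists_contains_lists (hfin : (G : Set GL2Z).Finite) (hne : G ≠ ⊥)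
    (hG : ∀ g ∈ G, MapsTo g Δ Δ) (hmin : Δ.IsRayMinimal G) :
    ∃ c : GroupClass, c.Contains G ∧ c.Lists K Δ := by
  rcases hmin.exists_mapsTo hfin hne hG with ⟨h, hh⟩ | ⟨k, h, hh⟩ | ⟨h, hh⟩ <;>
    have iso : ToricIso K Δ _ := toricIso_iff.2 ⟨_, hh.inv⟩ <;> have hG' := hh.inv.conj hG <;>
    have hmin' := hmin.map_conj hh.inv <;> have hne' := map_conj_ne_bot hne h⁻¹
  · rcases GroupClass.contains_of_forall_mem_D6 hne' fun g hg => mem_D6_of_mapsTo (hG' g hg)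
      with hc | hc | hc
    · exact ⟨_, hc.of_map_conj, iso⟩
    · exact ⟨_, hc.of_map_conj, .inl iso⟩
    · exact ⟨_, hc.of_map_conj, iso⟩
  · rcases Nat.even_or_odd' k with ⟨m, rfl | rfl⟩
    · rcases Nat.eq_zero_or_pos m with rfl | hm
      · rcases GroupClass.contains_of_forall_mem_D8 hne' fun g hg => mem_D8_of_mapsTo (hG' g hg)
          with hc | hc | hc | hc | hc | hc | hc
        · exact ⟨_, hc.of_map_conj, iso⟩
        · exact ⟨_, hc.of_map_conj, iso⟩
        · exact ⟨_, hc.of_map_conj, .inr (.inl iso)⟩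
        · exact ⟨_, hc.of_map_conj, 0, iso⟩
        · exact ⟨_, hc.of_map_conj, iso⟩
        · exact ⟨_, hc.of_map_conj, iso⟩
        · exact ⟨_, hc.of_map_conj, iso⟩
      · exact ⟨_, (D2'_contains_of_mapsTo hm hne' hG').of_map_conj, m, iso⟩
    · rcases Nat.eq_zero_or_pos m with rfl | hm
      · exact absurd hmin' (not_isRayMinimal_fanHirzebruch_one hG')
      · exact ⟨_, (D2_contains_of_mapsTo hne' hG').of_map_conj, .inr (.inr ⟨m, hm, iso⟩)⟩
  · rcases contains_of_isRayMinimal_fanDP6 hG' hmin' with hc | hc | hc <;>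
      exact ⟨_, hc.of_map_conj, iso⟩

lemma Fan.isRayMinimal_of_toricIso (h : ToricIso K Δ Δ') (hΔ : ∀ v, ¬ Δ'.IsNegOneRay v) :
    Δ.IsRayMinimal G := by
  obtain ⟨g, hg⟩ := toricIso_iff.1 h
  exact isRayMinimal_of_forall_not fun v hv => hΔ _ (hv.map hg)

/-- The listed surfaces are minimal: the fans of `ℙ²` and of `F_k`, `k ≠ 1`, have no `(-1)`-rays at
all, and the hexagon needs a group that moves every ray to an adjacent one. -/
lemma Fan.isRayMinimal_of_lists (hG : ∀ g ∈ G, MapsTo g Δ Δ) {c : GroupClass}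
    (hc : c.Contains G) (hl : c.Lists K Δ) : Δ.IsRayMinimal G := by
  have hP2 : ToricIso K Δ fanP2 → Δ.IsRayMinimal G := fun h =>
    isRayMinimal_of_toricIso K h not_isNegOneRay_fanP2
  have hF : ∀ {k : ℕ}, k ≠ 1 → ToricIso K Δ (fanHirzebruch k) → Δ.IsRayMinimal G := fun hk h =>
    isRayMinimal_of_toricIso K h (not_isNegOneRay_fanHirzebruch hk)
  have hS : (c = .C6 ∨ c = .D6' ∨ c = .D12) → ToricIso K Δ fanDP6 → Δ.IsRayMinimal G := by
    intro hcl h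
    obtain ⟨g, hg⟩ := toricIso_iff.1 h
    exact .of_mapsTo hg (isRayMinimal_fanDP6 (hg.conj hG) (hc.map_conj g) hcl)
  cases c with
  | C2 | C4 | D4 | D4' | D8 => exact hF zero_ne_one hl
  | C3 | D6 => exact hP2 hl
  | C6 | D6' | D12 => exact hS (by simp) hl
  | D2 =>
    rcases hl with hl | hl | ⟨a, ha, hl⟩
    · exact hP2 hl
    · exact hF zero_ne_one hl
    · exact hF (by omega) hl
  | D2' =>
    obtain ⟨a, hl⟩ := hl
    exact hF (by omega) hl

end ToricSurface

theorem mainTheorem5 {K : Type u} [Field K] (Δ : ToricSurface.Fan)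
    (G : Subgroup ToricSurface.GL2Z) (hfin : (G : Set ToricSurface.GL2Z).Finite) (hne : G ≠ ⊥)
    (hG : ∀ g ∈ G, ToricSurface.Fan.MapsTo g Δ Δ) :
    (Δ.IsMinimal K G hG ↔
      ∃ c : ToricSurface.GroupClass, c.Contains G ∧ c.Lists K Δ) ∧
    ∀ c : ToricSurface.GroupClass, c.Contains G → (Δ.IsMinimal K G hG ↔ c.Lists K Δ) := by
  rw [ToricSurface.Fan.isMinimal_iff K hG]
  refine ⟨⟨ToricSurface.Fan.exists_contains_lists K hfin hne hG, ?_⟩, fun c hc => ⟨fun h => ?_, ?_⟩⟩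
  · rintro ⟨c, hc, hl⟩
    exact ToricSurface.Fan.isRayMinimal_of_lists K hG hc hl
  · obtain ⟨c', hc', hl⟩ := ToricSurface.Fan.exists_contains_lists K hfin hne hG h
    exact hc.unique hc' ▸ hl
  · exact ToricSurface.Fan.isRayMinimal_of_lists K hG hc
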